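/- Let $N\ge 2$ and let $F_N$ be the free group of rank $N$. A \emph{geodesic current} on $F_N$ is a positive Borel measure on $\partial^2F_N=\{(x,y)\in\partial F_N\times\partial F_N : x\ne y\}$ that is finite on compact sets, $F_N$-invariant and invariant under the flip $(x,y)\mapsto(y,x)$; $\mathrm{Curr}(F_N)$ carries the weak-* topology and $\mathbb P\mathrm{Curr}(F_N)=(\mathrm{Curr}(F_N)\setminus\{0\})/\mathbb R_{>0}$ the quotient topology. For $1\ne g\in F_N$ let $\eta_g=\sum_{h\in F_N/\langle g\rangle}\left(\delta_{h(g^{-\infty},g^{\infty})}+\delta_{h(g^{\infty},g^{-\infty})}\right)$. Let $\Gamma$ be a finite connected graph with all vertices of degree $\ge 3$ and first Betti number $N$, with a base vertex $x_0$ and a fixed isomorphism $F_N\cong\pi_1(\Gamma,x_0)$; let $E\Gamma$ be the set of its oriented edges, $o(e)$ and $t(e)$ the initial and terminal vertex of $e\in E\Gamma$, and $T_0=\widetilde\Gamma$ the universal covering tree, where $\partial T_0$ is identified with $\partial F_N$. For a reduced edge-path $v$ of length $\ge1$ in $\Gamma$ and a current $\nu$, let $\langle v,\nu\rangle_\Gamma$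 be the $\nu$-measure of the set of all $(x,y)$ such that the geodesic in $T_0$ from $x$ to $y$ passes through a given lift $[p,q]$ of $v$, from $p$ to $q$. Let $\mathcal X$ be an irreducible $\Gamma$-based finite-state Markov chain: its state set is some $S\subseteq E\Gamma$ with $\#S\ge2$, and $p_{\mathcal X}(e,e')>0$ implies $t(e)=o(e')$ and $e'\ne e^{-1}$. Let $\mu_0$ be its stationary probability distribution, and for a word $v=s_1\dots s_k$ in $E\Gamma$, $k\ge 1$, put $\mu_0[k](v)=\mu_0(s_1)p_{\mathcal X}(s_1,s_2)\cdots p_{\mathcal X}(s_{k-1},s_k)$ if all $s_i\in S$, and $\mu_0[k](v)=0$ otherwise. There is a unique geodesic current $\nu_{\mathcal X}$ on $F_N$, the \emph{characteristic current} of $\mathcal X$, with $\langle v,\nu_{\mathcal X}\rangle_\Gamma=\mu_0[k](v)+\mu_0[k](v^{-1})$ for all $k\ge1$ and all reduced edge-paths $v$ of length $k$ in $\Gamma$, and with $\frac12\sum_{e\in E\Gamma}\langle e,\nu_{\mathcal X}\rangle_\Gamma=1$. Let $\mu$ be any initial probability distribution on $S$, let $X_1,X_2,\dots$ be the corresponding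 Markov process and $W_n=X_1\dots X_n$. Let $\mathcal B=(\beta_{e,e'})_{e,e'\in E\Gamma}$ be a closing path system, that is, a family of edge-paths such that every $e\,\beta_{e,e'}\,e'$ is a reduced edge-path in $\Gamma$. Let $\widehat W_n=X_1\dots X_n\,\beta_{X_n,X_1}$, a closed, reduced and cyclically reduced edge-path in $\Gamma$ almost surely. It is regarded as an element of $F_N\cong\pi_1(\Gamma,x_0)$ by means of an arbitrary fixed family of edge-paths $\delta_v$ from $x_0$ to the vertices $v$ of $\Gamma$, namely as the class of $\delta_{o(X_1)}\widehat W_n\,\delta_{o(X_1)}^{-1}$ (and as $1$ on the null event that $\widehat W_n$ is not a closed edge-path). Then: (1) the process $\widehat W_1,\widehat W_2,\dots$ is tame: for every free basis $A$ of $F_N$ there is $C>0$ such that always $|\widehat W_n|_A\le Cn$ for all $n\ge1$; (2) the process is adapted to $\nu_{\mathcal X}$: $\nu_{\mathcal X}\ne0$, and almost surely $\widehat W_n\ne1$ for all large $n$ and $\lim_{n\to\infty}[\eta_{\widehat W_n}]=[\nu_{\mathcal X}]$ in $\mathbb P\mathrm{Curr}(F_N)$. -/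

import Mathlib

open MeasureTheory Filter Topology
open scoped NNReal ENNReal CompactlySupported

noncomputable section

namespace FreeCurrents

/-! ### The boundary of a free group -/

/-- The inverse of a letter `a^{±1}` (equivalently, of an oriented edge). -/
def invLetter {α : Type*} (a : α × Bool) : α × Bool := (a.1, !a.2)

/-- The hyperbolic boundary `∂F(α)`: semi-infinite freely reduced words over `α^{±1}`. -/
def Boundary (α : Type*) : Type _ :=
  {x : ℕ → α × Bool // ∀ n, x (n + 1) ≠ invLetter (x n)}

/-- The subspace topology of the product topology (`α` is meant to be discrete). -/
instance {α : Type*} [TopologicalSpace α] : TopologicalSpace (Boundary α) :=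
  inferInstanceAs (TopologicalSpace {x : ℕ → α × Bool // ∀ n, x (n + 1) ≠ invLetter (x n)})

namespace Boundary

variable {α : Type*}

/-- The word formed by the first `n` letters of a boundary point. -/
def pre (x : Boundary α) (n : ℕ) : List (α × Bool) := List.ofFn fun i : Fin n => x.1 i

/-- The element of the free group given by the first `n` letters of a boundary point. -/
def preElt (x : Boundary α) (n : ℕ) : FreeGroup α := FreeGroup.mk (x.pre n)

/-- Left multiplication of an infinite reduced word by a letter, followed by free reduction. -/
def letterMul [DecidableEq α] (a : α × Bool) (x : Boundary α) : Boundary α :=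
  if h : x.1 0 = invLetter a then ⟨fun n => x.1 (n + 1), fun n => x.2 (n + 1)⟩
  else ⟨fun n => Nat.casesOn n a x.1, fun n => by
    cases n with
    | zero => exact h
    | succ k => exact x.2 k⟩

theorem invLetter_invLetter (a : α × Bool) : invLetter (invLetter a) = a := by
  simp [invLetter]

theorem letterMul_invLetter [DecidableEq α] (a : α × Bool) (x : Boundary α) :
    letterMul (invLetter a) (letterMul a x) = x := by
  by_cases h : x.1 0 = invLetter a
  · have h1 : ¬ (x.1 1 = a) := by
      intro h2
      exact x.2 0 (by rw [h, invLetter_invLetter]; exact h2)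
    apply Subtype.ext
    funext n
    cases n with
    | zero => simp [letterMul, h, h1, invLetter_invLetter]
    | succ k => simp [letterMul, h, h1, invLetter_invLetter]
  · apply Subtype.ext
    funext n
    simp [letterMul, h, invLetter_invLetter]

/-- The homeomorphism of the boundary given by a generator. -/
def genPerm [DecidableEq α] (a : α) : Equiv.Perm (Boundary α) where
  toFun := letterMul (a, true)
  invFun := letterMul (a, false)
  left_inv x := letterMul_invLetter (a, true) x
  right_inv x := letterMul_invLetter (a, false) x

/-- The action of `F(α)` on `∂F(α)` by left multiplication and free reduction. -/
instance [DecidableEq α] : MulAction (FreeGroup α) (Boundary α) where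
  smul g x := (FreeGroup.lift genPerm g : Equiv.Perm (Boundary α)) x
  one_smul x := by
    change (FreeGroup.lift genPerm 1 : Equiv.Perm (Boundary α)) x = x
    simp
  mul_smul g h x := by
    change (FreeGroup.lift genPerm (g * h) : Equiv.Perm (Boundary α)) x =
      (FreeGroup.lift genPerm g : Equiv.Perm (Boundary α))
        ((FreeGroup.lift genPerm h : Equiv.Perm (Boundary α)) x)
    simp

end Boundary

/-- Convergence `u n → x` in `F(α) ∪ ∂F(α)` of a sequence of group elements to a boundary point:
for every `k`, eventually the reduced word of `u n` begins with the first `k` letters of `x`. -/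
def TendstoBoundary {α : Type*} [DecidableEq α] (u : ℕ → FreeGroup α) (x : Boundary α) : Prop :=
  ∀ k, ∀ᶠ n in atTop, x.pre k <+: (u n).toWord

/-- `∂²F(α)`: ordered pairs of distinct boundary points. -/
def DoubleBoundary (α : Type*) : Type _ := {z : Boundary α × Boundary α // z.1 ≠ z.2}

instance {α : Type*} [TopologicalSpace α] : TopologicalSpace (DoubleBoundary α) :=
  inferInstanceAs (TopologicalSpace {z : Boundary α × Boundary α // z.1 ≠ z.2})

instance {α : Type*} [TopologicalSpace α] : MeasurableSpace (DoubleBoundary α) := borel _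

instance {α : Type*} [TopologicalSpace α] : BorelSpace (DoubleBoundary α) := ⟨rfl⟩

namespace DoubleBoundary

variable {α : Type*}

/-- The flip `(x, y) ↦ (y, x)`. -/
def flip (z : DoubleBoundary α) : DoubleBoundary α := ⟨(z.1.2, z.1.1), z.2.symm⟩

/-- The diagonal action `g (x, y) = (g x, g y)`. -/
def act [DecidableEq α] (g : FreeGroup α) (z : DoubleBoundary α) : DoubleBoundary α :=
  ⟨(g • z.1.1, g • z.1.2), fun h => z.2 (MulAction.injective g h)⟩

end DoubleBoundary

/-! ### Geodesic currents on `F_N = F(a_1, …, a_N)` -/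

/-- A geodesic current on `F_N`: a positive Borel measure on `∂²F_N`, finite on compact sets,
`F_N`-invariant and flip-invariant. -/
@[ext]
structure GeodesicCurrent (N : ℕ) where
  toMeasure : Measure (DoubleBoundary (Fin N))
  finite_on_compacts : ∀ K : Set (DoubleBoundary (Fin N)), IsCompact K → toMeasure K < ∞
  invariant : ∀ (g : FreeGroup (Fin N)) (B : Set (DoubleBoundary (Fin N))), MeasurableSet B →
    toMeasure (DoubleBoundary.act g ⁻¹' B) = toMeasure B
  flip_invariant : ∀ B : Set (DoubleBoundary (Fin N)), MeasurableSet B →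
    toMeasure (DoubleBoundary.flip ⁻¹' B) = toMeasure B

/-- The weak-* topology on `Curr(F_N)`: the coarsest one for which `ν ↦ ∫ f dν` is continuous for
every compactly supported continuous `f`. -/
instance (N : ℕ) : TopologicalSpace (GeodesicCurrent N) :=
  TopologicalSpace.induced
    (fun (ν : GeodesicCurrent N) (f : C_c(DoubleBoundary (Fin N), ℝ)) => ∫ z, f z ∂ν.toMeasure)
    inferInstance

/-- `Curr(F_N) ∖ {0}`, with the subspace topology. -/
abbrev NonzeroCurrent (N : ℕ) : Type := {ν : GeodesicCurrent N // ν.toMeasure ≠ 0}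

/-- The orbit relation of the multiplicative action of `ℝ_{>0}` on `Curr(F_N) ∖ {0}`. -/
instance projSetoid (N : ℕ) : Setoid (NonzeroCurrent N) where
  r ν ν' := ∃ c : ℝ≥0, 0 < c ∧ ν'.1.toMeasure = c • ν.1.toMeasure
  iseqv :=
    { refl := fun ν => ⟨1, one_pos, by simp⟩
      symm := by
        rintro ν ν' ⟨c, hc, h⟩
        exact ⟨c⁻¹, inv_pos.mpr hc, by rw [h, smul_smul, inv_mul_cancel₀ hc.ne', one_smul]⟩
      trans := by
        rintro ν ν' ν'' ⟨c, hc, h⟩ ⟨d, hd, h'⟩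
        exact ⟨d * c, mul_pos hd hc, by rw [h', h, smul_smul]⟩ }

/-- `ℙCurr(F_N)`, with the quotient topology. -/
abbrev ProjectiveCurrent (N : ℕ) : Type := Quotient (projSetoid N)

/-- `z = (g^{-∞}, g^{∞})`, where `g^{±∞} = lim g^{±n}`. For `g ≠ 1` there is exactly one
such `z`, for `g = 1` there is none. -/
def IsPoles {N : ℕ} (g : FreeGroup (Fin N)) (z : DoubleBoundary (Fin N)) : Prop :=
  TendstoBoundary (fun n => g⁻¹ ^ n) z.1.1 ∧ TendstoBoundary (fun n => g ^ n) z.1.2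

/-- The counting current (as a measure) `η_g = ∑_{h ∈ F_N/⟨g⟩} δ_{h(g^{-∞}, g^∞)} +
δ_{h(g^∞, g^{-∞})}` of `g ≠ 1`; the summands do not depend on the coset representatives. -/
def countingMeasure {N : ℕ} (g : FreeGroup (Fin N)) : Measure (DoubleBoundary (Fin N)) :=
  Measure.sum fun c : FreeGroup (Fin N) ⧸ Subgroup.zpowers g =>
    Measure.sum fun z : {z : DoubleBoundary (Fin N) // IsPoles g z} =>
      Measure.dirac (DoubleBoundary.act c.out z.1) +
        Measure.dirac (DoubleBoundary.act c.out z.1.flip)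

/-! ### `F_N`-valued processes `W_1, W_2, …` (the index `0` is never used) -/

/-- Tameness: for every free basis `A` there is `C > 0` with `|W_n|_A ≤ C n` always, `n ≥ 1`. -/
def IsTame {Ω : Type*} {N : ℕ} (W : ℕ → Ω → FreeGroup (Fin N)) : Prop :=
  ∀ A : FreeGroupBasis (Fin N) (FreeGroup (Fin N)), ∃ C : ℝ, 0 < C ∧
    ∀ n : ℕ, 1 ≤ n → ∀ ω, ((A.repr (W n ω)).norm : ℝ) ≤ C * n

/-- `W` is `ν`-adapted: `ν ≠ 0`, and almost surely `W_n ≠ 1` for all large `n` and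
`[η_{W_n}] → [ν]` in `ℙCurr(F_N)`. The sequence `η` consists of the counting currents of the
`W_n`, from some index on. -/
def IsAdapted {Ω : Type*} [MeasurableSpace Ω] (P : Measure Ω) {N : ℕ}
    (W : ℕ → Ω → FreeGroup (Fin N)) (ν : GeodesicCurrent N) : Prop :=
  ∃ hν : ν.toMeasure ≠ 0, ∀ᵐ ω ∂P, ∃ η : ℕ → NonzeroCurrent N,
    (∀ᶠ n in atTop, W n ω ≠ 1 ∧ (η n).1.toMeasure = countingMeasure (W n ω)) ∧
    Tendsto (fun n => (⟦η n⟧ : ProjectiveCurrent N)) atTop (𝓝 ⟦⟨ν, hν⟩⟧)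

/-! ### Finite-state Markov chains -/

/-- A finite-state Markov chain with state set `S`. -/
structure FSMC (S : Type*) [Fintype S] where
  p : S → S → ℝ
  nonneg : ∀ s s', 0 ≤ p s s'
  sum_eq_one : ∀ s, ∑ s', p s s' = 1

/-- `μ` is a probability distribution on the finite set `S`. -/
def IsDistribution {S : Type*} [Fintype S] (μ : S → ℝ) : Prop :=
  (∀ s, 0 ≤ μ s) ∧ ∑ s, μ s = 1

namespace FSMC

variable {S : Type*} [Fintype S]

/-- The `n`-step transition probabilities. -/
def nStep [DecidableEq S] (X : FSMC S) (n : ℕ) : S → S → ℝ := ((Matrix.of X.p) ^ n : Matrix S S ℝ)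

def IsIrreducible [DecidableEq S] (X : FSMC S) : Prop :=
  ∀ s s', ∃ n : ℕ, 1 ≤ n ∧ 0 < X.nStep n s s'

def IsStationary (X : FSMC S) (μ : S → ℝ) : Prop :=
  IsDistribution μ ∧ ∀ s', ∑ s, μ s * X.p s s' = μ s'

/-- `p(s, s_1) p(s_1, s_2) ⋯ p(s_{n-1}, s_n)`. -/
def chainProb (X : FSMC S) : S → List S → ℝ
  | _, [] => 1
  | s, t :: L => X.p s t * X.chainProb t L

/-- `μ(s_1) p(s_1, s_2) ⋯ p(s_{n-1}, s_n)`. -/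
def wordProb (X : FSMC S) (μ : S → ℝ) : List S → ℝ
  | [] => 1
  | s :: L => μ s * X.chainProb s L

/-- `Y 0, Y 1, …` (that is, `X_1, X_2, …`) is a Markov process of the chain with initial
distribution `μ`: the event that it begins with `s_1 … s_n` has probability
`μ(s_1) p(s_1, s_2) ⋯ p(s_{n-1}, s_n)`. -/
def IsMarkovSequence (X : FSMC S) (μ : S → ℝ) {Ω : Type*} [MeasurableSpace Ω] (P : Measure Ω)
    (Y : ℕ → Ω → S) : Prop :=
  (∀ i s, MeasurableSet (Y i ⁻¹' {s})) ∧
  ∀ L : List S, P {ω | (List.range L.length).map (fun i => Y i ω) = L} =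
    ENNReal.ofReal (X.wordProb μ L)

end FSMC

/-! ### Graphs, edge-paths and simplicial charts -/

/-- An oriented graph (loops and multiple edges allowed) with vertex set `V` and set `E` of
topological edges. Its oriented edges are the elements of `E × Bool`: `(e, true)` is `e` with its
given orientation and `(e, false)` is `e⁻¹`. -/
structure OrientedGraph (V E : Type*) where
  src : E → V
  tgt : E → V

namespace OrientedGraph

variable {V E : Type*} (Γ : OrientedGraph V E)

/-- Initial vertex of an oriented edge. -/
def o (e : E × Bool) : V := if e.2 then Γ.src e.1 else Γ.tgt e.1

/-- Terminal vertex of an oriented edge. -/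
def t (e : E × Bool) : V := if e.2 then Γ.tgt e.1 else Γ.src e.1

/-- `Γ.IsPath u L v`: the list `L` of oriented edges is an edge-path from `u` to `v`. It is a
reduced edge-path if moreover `FreeGroup.IsReduced L`. -/
def IsPath : V → List (E × Bool) → V → Prop
  | u, [], v => u = v
  | u, e :: L, v => Γ.o e = u ∧ IsPath (Γ.t e) L v

variable {Γ}

theorem IsPath.append {u v w : V} {L M : List (E × Bool)} (h : Γ.IsPath u L v)
    (h' : Γ.IsPath v M w) : Γ.IsPath u (L ++ M) w := by
  induction L generalizing u with
  | nil => rw [show u = v from h]; exact h'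
  | cons e L ih => exact ⟨h.1, ih h.2⟩

theorem o_inv (e : E × Bool) : Γ.o (e.1, !e.2) = Γ.t e := by
  rcases e with ⟨e, b⟩; cases b <;> simp [o, t]

theorem t_inv (e : E × Bool) : Γ.t (e.1, !e.2) = Γ.o e := by
  rcases e with ⟨e, b⟩; cases b <;> simp [o, t]

theorem IsPath.invRev {u v : V} {L : List (E × Bool)} (h : Γ.IsPath u L v) :
    Γ.IsPath v (FreeGroup.invRev L) u := by
  induction L generalizing u with
  | nil => exact (show u = v from h).symm
  | cons e L ih =>
    rw [FreeGroup.invRev_cons]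
    refine (ih h.2).append ?_
    have : FreeGroup.invRev [e] = [(e.1, !e.2)] := by simp [FreeGroup.invRev]
    rw [this]
    exact ⟨o_inv e, (t_inv e).trans h.1⟩

/-- The fundamental group `π_1(Γ, x₀)`: classes of closed edge-paths at `x₀` modulo insertion and
deletion of subpaths `e e⁻¹`, with concatenation. Two edge-paths are equivalent iff they are equal
as elements of the free group on `E`, so this is a subgroup of that free group. -/
def pi1 (Γ : OrientedGraph V E) (x₀ : V) : Subgroup (FreeGroup E) where
  carrier := {g | ∃ L, Γ.IsPath x₀ L x₀ ∧ FreeGroup.mk L = g}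
  one_mem' := ⟨[], rfl, rfl⟩
  mul_mem' := by
    rintro _ _ ⟨L, hL, rfl⟩ ⟨M, hM, rfl⟩
    exact ⟨L ++ M, hL.append hM, FreeGroup.mul_mk.symm⟩
  inv_mem' := by
    rintro _ ⟨L, hL, rfl⟩
    exact ⟨FreeGroup.invRev L, hL.invRev, FreeGroup.inv_mk.symm⟩

/-- First Betti number of a finite connected graph. -/
def betti (_Γ : OrientedGraph V E) : ℤ := (Nat.card E : ℤ) - Nat.card V + 1

end OrientedGraph

/-- A simplicial chart on `F_N`: a finite connected oriented graph with all vertices of degree at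
least `3` and first Betti number `N`, a base vertex, and a marking isomorphism. -/
structure SimplicialChart (N : ℕ) (V E : Type*) [Fintype V] [Fintype E]
    extends OrientedGraph V E where
  connected : ∀ u v, ∃ L, toOrientedGraph.IsPath u L v
  three_le_degree : ∀ v, 3 ≤ Nat.card {e : E × Bool // toOrientedGraph.o e = v}
  betti_eq : toOrientedGraph.betti = N
  base : V
  marking : FreeGroup (Fin N) ≃* toOrientedGraph.pi1 base

namespace SimplicialChart

variable {N : ℕ} {V E : Type*} [Fintype V] [Fintype E] (Γ : SimplicialChart N V E)

/-- `p` is a vertex of the universal covering tree `T₀` of `(Γ, x₀)` lying over `v`. The vertices of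
`T₀` are the classes of edge-paths issuing from `x₀`, as elements of the free group on `E`; `g ∈ F_N`
acts on them by left multiplication with `marking g`. Two of them are joined by an edge of
`T₀` with label `e` iff they are `p` and `p * e`. -/
def IsLift (v : V) (p : FreeGroup E) : Prop := ∃ L, Γ.IsPath Γ.base L v ∧ FreeGroup.mk L = p

/-- `γ` is the sequence of vertices of an oriented bi-infinite geodesic (a bi-infinite path without
backtracking) in the tree `T₀`. -/
def IsGeodesic (γ : ℤ → FreeGroup E) : Prop :=
  (∀ n, ∃ v, Γ.IsLift v (γ n)) ∧
  ∃ l : ℤ → E × Bool, ∀ n, γ (n + 1) = γ n * FreeGroup.mk [l n] ∧ l (n + 1) ≠ invLetter (l n)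

/-- The vertices `p n` of `T₀` converge to the point of `∂T₀` identified with `x ∈ ∂F_N` by the
equivariant quasi-isometry `F_N → T₀`, `g ↦ g x̃₀ = marking g`. -/
def TendstoEnd [DecidableEq E] (p : ℕ → FreeGroup E) (x : Boundary (Fin N)) : Prop :=
  ∃ ξ : Boundary E,
    TendstoBoundary (fun n => (Γ.marking (x.preElt n) : FreeGroup E)) ξ ∧ TendstoBoundary p ξ

/-- The cylinder `Cyl_Γ([p, q])`: pairs `(x, y)` for which the geodesic of `T₀` from `x` to `y`
passes through `[p, q]`, from `p` to `q`. -/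
def cyl [DecidableEq E] (p q : FreeGroup E) : Set (DoubleBoundary (Fin N)) :=
  {z | ∃ γ : ℤ → FreeGroup E, Γ.IsGeodesic γ ∧
    Γ.TendstoEnd (fun n : ℕ => γ (-(n : ℤ))) z.1.1 ∧ Γ.TendstoEnd (fun n : ℕ => γ n) z.1.2 ∧
    ∃ i j : ℤ, i ≤ j ∧ γ i = p ∧ γ j = q}

/-- The chain `X` with state set `S ⊆ EΓ` is `Γ`-based. -/
def IsBased {S : Finset (E × Bool)} (X : FSMC S) : Prop :=
  2 ≤ S.card ∧ ∀ e e' : S, 0 < X.p e e' → Γ.t e = Γ.o e' ∧ (e' : E × Bool) ≠ invLetter e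

end SimplicialChart

/-- `μ₀[k](v) = μ₀(s_1) p(s_1, s_2) ⋯ p(s_{k-1}, s_k)` for a word `v` in the oriented edges,
extended by zero to words that are not words in the states. -/
def extWordProb {E : Type*} [DecidableEq E] {S : Finset (E × Bool)} (X : FSMC S) (μ₀ : S → ℝ)
    (v : List (E × Bool)) : ℝ :=
  if h : ∀ e ∈ v, e ∈ S then X.wordProb μ₀ (v.attachWith (· ∈ S) h) else 0

namespace SimplicialChart

variable {N : ℕ} {V E : Type*} [Fintype V] [Fintype E] [DecidableEq E] (Γ : SimplicialChart N V E)

/-- `ν` is the characteristic current of the chain `X`: with `μ₀` the stationary distribution,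
`⟨v, ν⟩_Γ = μ₀[k](v) + μ₀[k](v⁻¹)` for every reduced edge-path `v` of length `k ≥ 1`, where
`⟨v, ν⟩_Γ` is the measure of the cylinder of any lift `[p, p v]` of `v` to `T₀`; and
`⟨T₀, ν⟩ = ½ ∑_{e ∈ EΓ} ⟨e, ν⟩_Γ = 1`. -/
def IsCharacteristicCurrent {S : Finset (E × Bool)} (X : FSMC S) (ν : GeodesicCurrent N) : Prop :=
  ∃ μ₀ : S → ℝ, X.IsStationary μ₀ ∧
    (∀ (u w : V) (v : List (E × Bool)) (p : FreeGroup E), v ≠ [] → Γ.IsPath u v w →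
      FreeGroup.IsReduced v → Γ.IsLift u p →
      ν.toMeasure (Γ.cyl p (p * FreeGroup.mk v)) =
        ENNReal.ofReal (extWordProb X μ₀ v + extWordProb X μ₀ (FreeGroup.invRev v))) ∧
    ∀ p : E × Bool → FreeGroup E, (∀ e, Γ.IsLift (Γ.o e) (p e)) →
      (∑ e, ν.toMeasure (Γ.cyl (p e) (p e * FreeGroup.mk [e]))) / 2 = 1

/-- Closing path systems: reduced edge-paths `β e e'` such that `e β_{e,e'} e'` is always a
reduced edge-path. -/
def IsClosingSystem (β : E × Bool → E × Bool → List (E × Bool)) : Prop :=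
  ∀ e e', Γ.IsPath (Γ.o e) (e :: (β e e' ++ [e'])) (Γ.t e') ∧
    FreeGroup.IsReduced (e :: (β e e' ++ [e']))

open Classical in
/-- The element of `F_N` given by a closed edge-path `c`, after joining its initial vertex `v` to the
base vertex by the path `δ v`: the `F_N`-element of the loop `δ_v c δ_v⁻¹`. Only
the conjugacy class does not depend on `δ`. (The value is `1` if `c` is empty or not a closed
path.) -/
def loopElt (δ : V → List (E × Bool)) : List (E × Bool) → FreeGroup (Fin N)
  | [] => 1
  | e :: c =>
    if h : Γ.IsPath Γ.base (δ (Γ.o e) ++ (e :: c) ++ FreeGroup.invRev (δ (Γ.o e))) Γ.base then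
      Γ.marking.symm ⟨FreeGroup.mk _, ⟨_, h, rfl⟩⟩
    else 1

end SimplicialChart

/-- The closing `γ β_{e,e'}` of a nonempty edge-path `γ` with last edge `e` and first edge `e'`. -/
def closing {E : Type*} (β : E × Bool → E × Bool → List (E × Bool)) (γ : List (E × Bool)) :
    List (E × Bool) :=
  if h : γ ≠ [] then γ ++ β (γ.getLast h) (γ.head h) else []

/-- The walk `W_n = X_1 ⋯ X_n` driven by the process `Y 0 = X_1, Y 1 = X_2, …`. -/
def walk {E Ω : Type*} {S : Finset (E × Bool)} (Y : ℕ → Ω → S) (n : ℕ) (ω : Ω) :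
    List (E × Bool) :=
  (List.range n).map fun i => (Y i ω : E × Bool)

end FreeCurrents

end

/-!
The currents are compared through the measures of cylinders. The cylinders `cyl p (p v)` of the
lifts of nontrivial reduced edge-paths `v` form a basis of compact open subsets of `∂²F_N` which
is closed under nonempty intersections (`isCompactOpenPiBasis_cylinders`). Hence a current is
determined by its values on cylinders (`measure_ext`), convergence on cylinders implies weak-*
convergence (`IsCompactOpenPiBasis.tendsto_integral`), and limits of the values of measures on
cylinders are again the values of a measure (`IsCompactOpenPiBasis.exists_measure`, by Riesz
representation of a limiting functional). If these values depend only on `v` and not on its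
direction, the measure is a current (`exists_current`).

If `g ∈ F_N` is represented by a cyclically reduced closed edge-path `w`, then its axis in the
universal covering tree is labelled by the repetitions of `w`, and the translates of the axis
through a given lift of `v` correspond to the occurrences of `v` in the cyclic word `w`. So `η_g`
of the cylinder is the number of occurrences of `v` and `v⁻¹` in `w`
(`IsAxis.countingMeasure_cyl`). For the closed-up walk `w = Ŵ_n` this differs by a bounded amount
from the number of occurrences of `v` and `v⁻¹` in the trajectory of the Markov process up to time
`n` (`abs_cyclicCount_sub_wordCount_le`).

By the ergodic theorem for irreducible chains, almost surely the frequency of every word `v` in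
the trajectory converges to `μ₀[k](v)` (`exists_ae_tendsto_wordCount`). It is derived from a
strong law of large numbers for bounded orthogonal variables (`ae_tendsto_of_orthogonal`), applied
to the deviations of the transitions from their conditional probabilities; the limit of the
frequencies of the states is stationary, and the stationary distribution is unique. Consequently
`η_{Ŵ_n} / n` converges on cylinders to `μ₀[k](v) + μ₀[k](v⁻¹)` along almost every trajectory
(`tendsto_countingMeasure_cyl`). A single such trajectory yields the characteristic current
(`exists_isCharacteristicCurrent`), and convergence along almost all of them is adaptedness
(`IsCharacteristicCurrent.exists_tendsto`).

The description of the cylinders rests on the geometry of the tree. The universal covering tree is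
the subtree of the Cayley tree of the free group `F(E)` on the edges formed by the lifts of the
vertices, and the marking embeds `F_N` into `F(E)`. Both this embedding and its inverse are
controlled on prefixes (`exists_prefixAgree_markingHom`, `exists_prefixAgree_of_markingHom`),
which gives the embedding `bdry` of `∂F_N` into `∂F(E)`. A vertex `p` lies on the line from `ξ` to
`ζ` if and only if the words `p⁻¹ ξ` and `p⁻¹ ζ` begin with different letters
(`Connects.exists_eq_iff`).

Tameness holds because the length of `Ŵ_n` is at most `n` plus a constant and each edge
contributes a bounded number of letters (`exists_norm_pathElt_le`).
-/

noncomputable section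

namespace FreeCurrents

/-! ### Reduced words and common prefixes -/

section Words

variable {α : Type*}

theorem ne_invLetter_iff {a b : α × Bool} : b ≠ invLetter a ↔ (a.1 = b.1 → a.2 = b.2) := by
  rcases a with ⟨a, i⟩; rcases b with ⟨b, j⟩
  cases i <;> cases j <;> simp [invLetter, eq_comm]

theorem invLetter_invLetter (a : α × Bool) : invLetter (invLetter a) = a :=
  Boundary.invLetter_invLetter a

theorem invLetter_injective : Function.Injective (invLetter : α × Bool → α × Bool) :=
  Function.LeftInverse.injective invLetter_invLetter

theorem isReduced_iff_isChain {L : List (α × Bool)} :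
    FreeGroup.IsReduced L ↔ L.IsChain fun a b => b ≠ invLetter a := by
  unfold FreeGroup.IsReduced
  simp only [ne_invLetter_iff]

theorem isReduced_iff_getElem {L : List (α × Bool)} :
    FreeGroup.IsReduced L ↔ ∀ i (h : i + 1 < L.length), L[i + 1] ≠ invLetter L[i] := by
  rw [isReduced_iff_isChain, List.isChain_iff_getElem]

theorem isReduced_ofFn {l : ℕ → α × Bool} (h : ∀ n, l (n + 1) ≠ invLetter (l n)) (n : ℕ) :
    FreeGroup.IsReduced (List.ofFn fun i : Fin n => l i) := by
  rw [isReduced_iff_getElem]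
  intro i hi
  simpa using h i

theorem _root_.FreeGroup.IsReduced.take {L : List (α × Bool)} (h : FreeGroup.IsReduced L) (k : ℕ) :
    FreeGroup.IsReduced (L.take k) := h.infix (List.take_prefix k L).isInfix

theorem _root_.FreeGroup.IsReduced.drop {L : List (α × Bool)} (h : FreeGroup.IsReduced L) (k : ℕ) :
    FreeGroup.IsReduced (L.drop k) := h.infix (List.drop_suffix k L).isInfix

theorem isReduced_append_iff {L M : List (α × Bool)} :
    FreeGroup.IsReduced (L ++ M) ↔ FreeGroup.IsReduced L ∧ FreeGroup.IsReduced M ∧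
      ∀ x ∈ L.getLast?, ∀ y ∈ M.head?, y ≠ invLetter x := by
  simp only [isReduced_iff_isChain, List.isChain_append]

theorem invRev_append (L M : List (α × Bool)) :
    FreeGroup.invRev (L ++ M) = FreeGroup.invRev M ++ FreeGroup.invRev L := by
  simp [FreeGroup.invRev]

theorem invRev_singleton (a : α × Bool) : FreeGroup.invRev [a] = [invLetter a] := by
  simp [FreeGroup.invRev, invLetter]

theorem mk_invLetter (a : α × Bool) :
    FreeGroup.mk [invLetter a] = (FreeGroup.mk [a])⁻¹ := by
  rw [FreeGroup.inv_mk, invRev_singleton]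

theorem mk_append (L M : List (α × Bool)) :
    FreeGroup.mk (L ++ M) = FreeGroup.mk L * FreeGroup.mk M := FreeGroup.mul_mk.symm

theorem mk_cons (a : α × Bool) (M : List (α × Bool)) :
    FreeGroup.mk (a :: M) = FreeGroup.mk [a] * FreeGroup.mk M := by
  rw [← mk_append]; rfl

theorem mk_ofFn_succ (l : ℕ → α × Bool) (n : ℕ) :
    FreeGroup.mk (List.ofFn fun i : Fin (n + 1) => l i) =
      FreeGroup.mk (List.ofFn fun i : Fin n => l i) * FreeGroup.mk [l n] := by
  rw [List.ofFn_succ_last, mk_append]; simp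

variable [DecidableEq α]

theorem _root_.FreeGroup.IsReduced.toWord_mk {L : List (α × Bool)} (h : FreeGroup.IsReduced L) :
    (FreeGroup.mk L).toWord = L := by
  rw [FreeGroup.toWord_mk, h.reduce_eq]

theorem _root_.FreeGroup.IsReduced.invRev {L : List (α × Bool)} (h : FreeGroup.IsReduced L) :
    FreeGroup.IsReduced (FreeGroup.invRev L) := by
  apply FreeGroup.IsReduced.of_reduce_eq
  rw [FreeGroup.reduce_invRev, h.reduce_eq]

theorem mk_injOn_isReduced {L M : List (α × Bool)} (hL : FreeGroup.IsReduced L)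
    (hM : FreeGroup.IsReduced M) (h : FreeGroup.mk L = FreeGroup.mk M) : L = M := by
  rw [← hL.toWord_mk, h, hM.toWord_mk]

theorem toWord_mul_letter (u : FreeGroup α) (a : α × Bool) :
    (u * FreeGroup.mk [a]).toWord = u.toWord ++ [a] ∨
      u.toWord = (u * FreeGroup.mk [a]).toWord ++ [invLetter a] := by
  have hu : u = FreeGroup.mk u.toWord := FreeGroup.mk_toWord.symm
  have hr : FreeGroup.IsReduced u.toWord := FreeGroup.isReduced_toWord
  rcases List.eq_nil_or_concat u.toWord with h | ⟨L, b, h⟩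
  · left
    rw [hu, h, ← mk_append]
    exact FreeGroup.IsReduced.singleton.toWord_mk
  · rw [List.concat_eq_append] at h
    by_cases hab : a = invLetter b
    · right
      subst hab
      have h1 : u * FreeGroup.mk [invLetter b] = FreeGroup.mk L := by
        rw [hu, h, mk_append, mk_invLetter, mul_inv_cancel_right]
      have hL : FreeGroup.IsReduced L :=
        hr.infix (by rw [h]; exact (List.prefix_append _ _).isInfix)
      rw [h1, hL.toWord_mk, invLetter_invLetter, h]
    · left
      conv_lhs => rw [hu, ← mk_append]
      apply FreeGroup.IsReduced.toWord_mk
      rw [isReduced_append_iff]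
      refine ⟨hr, FreeGroup.IsReduced.singleton, ?_⟩
      rw [h]
      simpa using hab

/-- `u` and `v` have the same first `k` letters (and at least `k` letters). -/
def PrefixAgree (k : ℕ) (u v : FreeGroup α) : Prop :=
  k ≤ u.toWord.length ∧ u.toWord.take k = v.toWord.take k

namespace PrefixAgree

variable {k : ℕ} {u v w : FreeGroup α}

theorem refl (h : k ≤ u.toWord.length) : PrefixAgree k u u := ⟨h, rfl⟩

theorem le_right (h : PrefixAgree k u v) : k ≤ v.toWord.length := by
  have := congrArg List.length h.2
  simp only [List.length_take] at this
  have := h.1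
  omega

theorem symm (h : PrefixAgree k u v) : PrefixAgree k v u := ⟨h.le_right, h.2.symm⟩

theorem trans (h : PrefixAgree k u v) (h' : PrefixAgree k v w) : PrefixAgree k u w :=
  ⟨h.1, h.2.trans h'.2⟩

theorem mono {j : ℕ} (h : PrefixAgree k u v) (hj : j ≤ k) : PrefixAgree j u v := by
  refine ⟨hj.trans h.1, ?_⟩
  have := congrArg (List.take j) h.2
  simpa [List.take_take, min_eq_left hj] using this

end PrefixAgree

theorem prefixAgree_mul_mk (u : FreeGroup α) (D : List (α × Bool)) (k : ℕ)
    (h : k + D.length ≤ u.toWord.length) : PrefixAgree k u (u * FreeGroup.mk D) := by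
  induction D generalizing u with
  | nil => exact ⟨by simpa using h, by rw [← FreeGroup.one_eq_mk, mul_one]⟩
  | cons a D ih =>
    rw [mk_cons, ← mul_assoc]
    simp only [List.length_cons] at h
    rcases toWord_mul_letter u a with h1 | h1
    · refine PrefixAgree.trans ⟨by omega, ?_⟩ (ih _ (by rw [h1]; simp; omega))
      rw [h1, List.take_append_of_le_length (by omega)]
    · have h2 := congrArg List.length h1
      simp only [List.length_append, List.length_singleton] at h2
      refine PrefixAgree.trans ⟨by omega, ?_⟩ (ih _ (by omega))
      rw [h1, List.take_append_of_le_length (by omega)]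

/-- Elements at distance at most `|d|` from each other agree except near their ends. -/
theorem prefixAgree_mul (u d : FreeGroup α) (k : ℕ) (h : k + d.norm ≤ u.norm) :
    PrefixAgree k u (u * d) := by
  have := prefixAgree_mul_mk u d.toWord k h
  rwa [FreeGroup.mk_toWord] at this

/-- A coarsely Lipschitz, metrically proper map from a prefix-closed set of words to a free group
extends continuously to infinity: words with long common prefixes have images with long common
prefixes. -/
theorem exists_prefixAgree_of_lipschitz {β : Type*} {A : Set (List (β × Bool))}
    (hA : ∀ L ∈ A, ∀ k, L.take k ∈ A) (f : List (β × Bool) → FreeGroup α) (c : ℕ)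
    (hstep : ∀ L a, L ++ [a] ∈ A → ((f L)⁻¹ * f (L ++ [a])).norm ≤ c)
    (hprop : ∀ K, ∃ k, ∀ L ∈ A, k ≤ L.length → K ≤ (f L).norm) (K : ℕ) :
    ∃ k, ∀ L ∈ A, ∀ M ∈ A, k ≤ L.length → L.take k = M.take k → PrefixAgree K (f L) (f M) := by
  obtain ⟨k, hk⟩ := hprop (K + c)
  refine ⟨k, ?_⟩
  -- Beyond the first `k` letters the images have norm at least `K + c`, so that none of the steps,
  -- of length at most `c`, changes their first `K` letters.
  have key : ∀ L ∈ A, k ≤ L.length → PrefixAgree K (f (L.take k)) (f L) := by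
    intro L hL hkL
    have hn : ∀ m, k + m ≤ L.length → PrefixAgree K (f (L.take k)) (f (L.take (k + m))) := by
      intro m
      induction m with
      | zero =>
        intro h
        have := hk (L.take k) (hA L hL k) (by simp; omega)
        exact PrefixAgree.refl (by simp only [FreeGroup.norm] at this ⊢; rw [add_zero] at *; omega)
      | succ m ih =>
        intro h
        refine (ih (by omega)).trans ?_
        have h1 : L.take (k + (m + 1)) = L.take (k + m) ++ [L[k + m]] := by
          rw [← add_assoc, List.take_succ_eq_append_getElem (by omega)]
        have h2 := hstep (L.take (k + m)) L[k + m] (h1 ▸ hA L hL _)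
        have h3 := hk (L.take (k + m)) (hA L hL _) (by simp; omega)
        have := prefixAgree_mul (f (L.take (k + m)))
          ((f (L.take (k + m)))⁻¹ * f (L.take (k + m) ++ [L[k + m]])) K (by omega)
        rwa [mul_inv_cancel_left, ← h1] at this
    have := hn (L.length - k) (by omega)
    rwa [show k + (L.length - k) = L.length by omega, List.take_length] at this
  intro L hL M hM hkL hLM
  have hkM : k ≤ M.length := by
    have := congrArg List.length hLM
    simp only [List.length_take] at this
    omega
  exact (key L hL hkL).symm.trans (hLM ▸ key M hM hkM)

theorem finite_norm_lt [Finite α] (K : ℕ) : {g : FreeGroup α | g.norm < K}.Finite := by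
  refine Set.Finite.of_finite_image (f := FreeGroup.toWord) ?_ FreeGroup.toWord_injective.injOn
  refine (List.finite_length_lt (α × Bool) K).subset ?_
  rintro _ ⟨g, hg, rfl⟩
  exact hg

/-- A map into a free group of finite rank which is injective up to finitely many values of an
auxiliary invariant `e` is metrically proper. -/
theorem exists_le_norm_of_injOn {β κ : Type*} [Finite α] [Finite κ] {A : Set (List (β × Bool))}
    (f : List (β × Bool) → FreeGroup α) (e : List (β × Bool) → κ)
    (hinj : Set.InjOn (fun L => (f L, e L)) A) (K : ℕ) :
    ∃ k, ∀ L ∈ A, k ≤ L.length → K ≤ (f L).norm := by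
  have hfin : {L ∈ A | (f L).norm < K}.Finite := by
    refine Set.Finite.of_finite_image (f := fun L => (f L, e L)) ?_ (hinj.mono fun L h => h.1)
    refine ((finite_norm_lt K).prod (Set.finite_univ (α := κ))).subset ?_
    rintro _ ⟨L, hL, rfl⟩
    exact ⟨hL.2, trivial⟩
  obtain ⟨k, hk⟩ := (hfin.image List.length).bddAbove
  refine ⟨k + 1, fun L hL h => ?_⟩
  by_contra hlt
  have := hk ⟨L, ⟨hL, not_le.mp hlt⟩, rfl⟩
  omega

end Words

/-! ### Convergence to the boundary of a free group -/

section Convergence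

variable {α : Type*}

namespace Boundary

theorem length_pre (x : Boundary α) (n : ℕ) : (x.pre n).length = n := by simp [pre]

theorem getElem_pre (x : Boundary α) (n i : ℕ) (h : i < (x.pre n).length) :
    (x.pre n)[i] = x.1 i := by simp [pre]

theorem isReduced_pre (x : Boundary α) (n : ℕ) : FreeGroup.IsReduced (x.pre n) :=
  isReduced_ofFn x.2 n

theorem take_pre (x : Boundary α) {k n : ℕ} (h : k ≤ n) : (x.pre n).take k = x.pre k := by
  apply List.ext_getElem
  · simp [length_pre, h]
  · intro i h1 h2
    simp [getElem_pre]

theorem pre_eq_iff {x y : Boundary α} {n : ℕ} : x.pre n = y.pre n ↔ ∀ i < n, x.1 i = y.1 i := by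
  constructor
  · intro h i hi
    have h1 := getElem_pre x n i (by rwa [length_pre])
    have h2 := getElem_pre y n i (by rwa [length_pre])
    rw [← h1, ← h2]
    simp only [h]
  · intro h
    apply List.ext_getElem
    · simp [length_pre]
    · intro i h1 h2
      rw [getElem_pre, getElem_pre]
      exact h i (by rwa [length_pre] at h1)

theorem pre_mono {x y : Boundary α} {m n : ℕ} (h : m ≤ n) (hxy : x.pre n = y.pre n) :
    x.pre m = y.pre m := by
  rw [← take_pre x h, ← take_pre y h, hxy]

theorem ext_pre {x y : Boundary α} (h : ∀ n, x.pre n = y.pre n) : x = y := by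
  apply Subtype.ext
  funext n
  exact pre_eq_iff.mp (h (n + 1)) n (Nat.lt_succ_self n)

/-- The infinite word with its first `n` letters deleted. -/
def shift (x : Boundary α) (n : ℕ) : Boundary α := ⟨fun i => x.1 (n + i), fun i => x.2 (n + i)⟩

end Boundary

variable [DecidableEq α]

theorem Boundary.toWord_preElt (x : Boundary α) (n : ℕ) : (x.preElt n).toWord = x.pre n :=
  (x.isReduced_pre n).toWord_mk

theorem tendstoBoundary_iff_take {u : ℕ → FreeGroup α} {x : Boundary α} :
    TendstoBoundary u x ↔ ∀ K, ∀ᶠ n in atTop, (u n).toWord.take K = x.pre K := by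
  have : ∀ K n, x.pre K <+: (u n).toWord ↔ (u n).toWord.take K = x.pre K := by
    intro K n
    rw [List.prefix_iff_eq_take, x.length_pre, eq_comm]
  simp only [TendstoBoundary, this]

theorem TendstoBoundary.unique {u : ℕ → FreeGroup α} {x y : Boundary α}
    (hx : TendstoBoundary u x) (hy : TendstoBoundary u y) : x = y := by
  rw [tendstoBoundary_iff_take] at hx hy
  refine Boundary.ext_pre fun K => ?_
  obtain ⟨n, h1, h2⟩ := ((hx K).and (hy K)).exists
  exact h1.symm.trans h2

theorem TendstoBoundary.comp {u : ℕ → FreeGroup α} {x : Boundary α} (hx : TendstoBoundary u x)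
    {a : ℕ → ℕ} (ha : Tendsto a atTop atTop) : TendstoBoundary (fun n => u (a n)) x :=
  fun K => ha.eventually (hx K)

theorem Boundary.tendsto_preElt (x : Boundary α) : TendstoBoundary x.preElt x := by
  intro K
  filter_upwards [eventually_ge_atTop K] with n hn
  rw [x.toWord_preElt, ← x.take_pre hn]
  exact List.take_prefix _ _

/-- Convergence to `x` is agreement on longer and longer prefixes with the prefixes of `x`. -/
theorem tendstoBoundary_iff_prefixAgree {u : ℕ → FreeGroup α} {x : Boundary α} :
    TendstoBoundary u x ↔ ∀ K, ∀ᶠ n in atTop, PrefixAgree K (x.preElt K) (u n) := by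
  simp only [tendstoBoundary_iff_take, PrefixAgree, Boundary.toWord_preElt, Boundary.length_pre,
    le_refl, true_and, Boundary.take_pre, eq_comm]

theorem TendstoBoundary.mul_right {u : ℕ → FreeGroup α} {x : Boundary α}
    (hx : TendstoBoundary u x) (d : FreeGroup α) : TendstoBoundary (fun n => u n * d) x := by
  rw [tendstoBoundary_iff_prefixAgree] at hx ⊢
  intro K
  filter_upwards [hx (K + d.norm)] with n hn
  have h1 : PrefixAgree K (x.preElt K) (x.preElt (K + d.norm)) := by
    simp [PrefixAgree, Boundary.toWord_preElt, Boundary.length_pre, Boundary.take_pre]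
  exact h1.trans ((hn.mono (by omega)).trans (prefixAgree_mul _ _ _ hn.le_right))

/-- A sequence which is Cauchy for the prefix metric converges to a boundary point. -/
theorem exists_tendstoBoundary {u : ℕ → FreeGroup α}
    (h : ∀ K, ∃ w : FreeGroup α, ∀ᶠ n in atTop, PrefixAgree K w (u n)) :
    ∃ x, TendstoBoundary u x := by
  choose w hw using h
  have hlen : ∀ K, K ≤ (w K).toWord.length := fun K => (hw K).exists.choose_spec.1
  have hcomp : ∀ K L, K ≤ L → PrefixAgree K (w K) (w L) := by
    intro K L hKL
    obtain ⟨n, h1, h2⟩ := ((hw K).and (hw L)).exists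
    exact h1.trans (h2.mono hKL).symm
  have hget : ∀ K L i (hi : i < K) (hKL : K ≤ L),
      (w K).toWord[i]'(hi.trans_le (hlen K)) =
        (w L).toWord[i]'((hi.trans_le hKL).trans_le (hlen L)) := by
    intro K L i hi hKL
    have := (hcomp K L hKL).2
    have h1 : i < ((w K).toWord.take K).length := by
      have := hlen K
      simp; omega
    have h2 : ((w K).toWord.take K)[i]'h1 = ((w L).toWord.take K)[i]'(this ▸ h1) := by
      simp only [this]
    simpa using h2
  let x : Boundary α := ⟨fun i => (w (i + 1)).toWord[i]'(hlen _), fun i => by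
    have h1 := (isReduced_iff_getElem.mp (FreeGroup.isReduced_toWord (x := w (i + 1 + 1)))) i
      (hlen (i + 1 + 1))
    rwa [← hget (i + 1) (i + 1 + 1) i (by omega) (by omega)] at h1⟩
  refine ⟨x, ?_⟩
  rw [tendstoBoundary_iff_take]
  intro K
  filter_upwards [hw K] with n hn
  rw [← hn.2]
  apply List.ext_getElem
  · have := hlen K
    simp [Boundary.length_pre, this]
  · intro i h1 h2
    rw [Boundary.getElem_pre, List.getElem_take]
    rw [Boundary.length_pre] at h2
    exact (hget (i + 1) K i (by omega) (by omega)).symm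

/-! ### The action on the boundary -/

theorem mk_singleton_smul (a : α × Bool) (x : Boundary α) :
    FreeGroup.mk [a] • x = Boundary.letterMul a x := by
  change (FreeGroup.lift Boundary.genPerm (FreeGroup.mk [a]) : Equiv.Perm (Boundary α)) x = _
  rcases a with ⟨a, b⟩
  cases b
  · simp only [FreeGroup.lift_mk, List.map_cons, List.map_nil, List.prod_singleton, cond_false]
    rfl
  · simp only [FreeGroup.lift_mk, List.map_cons, List.map_nil, List.prod_singleton, cond_true]
    rfl

theorem letterMul_of_eq {a : α × Bool} {x : Boundary α} (h : x.1 0 = invLetter a) :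
    Boundary.letterMul a x = x.shift 1 := by
  apply Subtype.ext
  funext n
  simp [Boundary.letterMul, h, Boundary.shift, add_comm]

theorem letterMul_zero_of_ne {a : α × Bool} {x : Boundary α} (h : x.1 0 ≠ invLetter a) :
    (Boundary.letterMul a x).1 0 = a := by
  simp [Boundary.letterMul, h]

theorem letterMul_succ_of_ne {a : α × Bool} {x : Boundary α} (h : x.1 0 ≠ invLetter a) (n : ℕ) :
    (Boundary.letterMul a x).1 (n + 1) = x.1 n := by
  simp [Boundary.letterMul, h]

/-- A group element acts on the boundary with Lipschitz constant `2 ^ |g|` in the prefix metric. -/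
theorem pre_mk_smul_eq {x y : Boundary α} (L : List (α × Bool)) {K : ℕ}
    (h : x.pre (K + L.length) = y.pre (K + L.length)) :
    (FreeGroup.mk L • x).pre K = (FreeGroup.mk L • y).pre K := by
  induction L generalizing K with
  | nil => simpa [← FreeGroup.one_eq_mk] using h
  | cons a L ih =>
    rw [mk_cons, mul_smul, mul_smul, mk_singleton_smul, mk_singleton_smul]
    have h1 := ih (K := K + 1) (by rwa [List.length_cons, ← add_assoc, add_right_comm] at h)
    generalize FreeGroup.mk L • x = x' at h1
    generalize FreeGroup.mk L • y = y' at h1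
    rw [Boundary.pre_eq_iff] at h1 ⊢
    have h0 := h1 0 (by omega)
    intro i hi
    by_cases hx : x'.1 0 = invLetter a
    · rw [letterMul_of_eq hx, letterMul_of_eq (h0 ▸ hx)]
      exact h1 (1 + i) (by omega)
    · have hy : y'.1 0 ≠ invLetter a := h0 ▸ hx
      cases i with
      | zero => rw [letterMul_zero_of_ne hx, letterMul_zero_of_ne hy]
      | succ i => rw [letterMul_succ_of_ne hx, letterMul_succ_of_ne hy]; exact h1 i (by omega)

theorem pre_smul_eq {x y : Boundary α} (g : FreeGroup α) {K : ℕ}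
    (h : x.pre (K + g.norm) = y.pre (K + g.norm)) : (g • x).pre K = (g • y).pre K := by
  have := pre_mk_smul_eq g.toWord h
  rwa [FreeGroup.mk_toWord] at this

/-- If the reduced word `L` is a prefix of `x`, then `L⁻¹ x` is obtained by deleting this prefix. -/
theorem inv_mk_smul_of_pre_eq {L : List (α × Bool)} {x : Boundary α} (h : x.pre L.length = L) :
    (FreeGroup.mk L)⁻¹ • x = x.shift L.length := by
  induction L generalizing x with
  | nil =>
    rw [← FreeGroup.one_eq_mk, inv_one, one_smul]
    apply Subtype.ext
    funext i
    simp [Boundary.shift]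
  | cons a L ih =>
    have hx : ∀ i (hi : i < (a :: L).length), x.1 i = (a :: L)[i] := by
      intro i hi
      rw [← Boundary.getElem_pre x (a :: L).length i (by rwa [Boundary.length_pre])]
      simp only [h]
    rw [mk_cons, mul_inv_rev, mul_smul, ← mk_invLetter, mk_singleton_smul,
      letterMul_of_eq (by rw [invLetter_invLetter]; exact hx 0 (by simp)), ih]
    · apply Subtype.ext
      funext i
      simp only [Boundary.shift, List.length_cons]
      rw [← add_assoc, add_comm 1]
    · apply List.ext_getElem
      · simp [Boundary.length_pre]
      · intro i h1 h2
        rw [Boundary.getElem_pre]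
        have := hx (i + 1) (by simpa using h2)
        simpa [Boundary.shift, add_comm] using this

/-- If the reduced word `L` is not a prefix of `x`, then the last letter of `L` survives in
`L⁻¹ x`. -/
theorem inv_mk_smul_zero_of_pre_ne {L : List (α × Bool)} (hL : FreeGroup.IsReduced L)
    (hne : L ≠ []) {x : Boundary α} (h : x.pre L.length ≠ L) :
    ((FreeGroup.mk L)⁻¹ • x).1 0 = invLetter (L.getLast hne) := by
  induction L generalizing x with
  | nil => exact absurd rfl hne
  | cons a L ih =>
    rw [mk_cons, mul_inv_rev, mul_smul, ← mk_invLetter, mk_singleton_smul]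
    by_cases hx : x.1 0 = a
    · rw [letterMul_of_eq (by rwa [invLetter_invLetter])]
      have hpre : (x.shift 1).pre L.length ≠ L := by
        intro h'
        apply h
        apply List.ext_getElem
        · simp [Boundary.length_pre]
        · intro i h1 h2
          rw [Boundary.getElem_pre]
          cases i with
          | zero => simpa using hx
          | succ i =>
            have h3 : i < ((x.shift 1).pre L.length).length := by
              rw [Boundary.length_pre]; simpa using h2
            have h4 := Boundary.getElem_pre (x.shift 1) L.length i h3
            simp only [h'] at h4
            simp [h4, Boundary.shift, add_comm]
      have hL' : L ≠ [] := by
        rintro rfl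
        exact hpre rfl
      rw [ih (hL.drop 1) hL' hpre, List.getLast_cons hL']
    · have hx' : x.1 0 ≠ invLetter (invLetter a) := by rwa [invLetter_invLetter]
      have hz := letterMul_zero_of_ne hx'
      by_cases hL' : L = []
      · subst hL'
        rw [← FreeGroup.one_eq_mk, inv_one, one_smul]
        simpa using hz
      · rw [List.getLast_cons hL']
        refine ih (hL.drop 1) hL' fun hpre => ?_
        have hpos : 0 < L.length := List.length_pos_iff.mpr hL'
        have h0 : L[0] = invLetter a := by
          rw [← hz, ← Boundary.getElem_pre _ L.length 0 (by rwa [Boundary.length_pre])]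
          simp only [hpre]
        have := isReduced_iff_getElem.mp hL 0 (by simpa using hpos)
        exact this (by simpa using h0)

theorem TendstoBoundary.mk_singleton_mul {u : ℕ → FreeGroup α} {x : Boundary α}
    (hx : TendstoBoundary u x) (a : α × Bool) :
    TendstoBoundary (fun n => FreeGroup.mk [a] * u n) (Boundary.letterMul a x) := by
  rw [tendstoBoundary_iff_take] at hx ⊢
  intro K
  filter_upwards [hx (K + 1)] with n hn
  have hw : (u n).toWord = x.1 0 :: (u n).toWord.tail := by
    have hlen : 0 < (u n).toWord.length := by
      have := congrArg List.length hn
      rw [List.length_take, Boundary.length_pre] at this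
      omega
    have h0 : (u n).toWord[0] = x.1 0 := by
      rw [← Boundary.getElem_pre x (K + 1) 0 (by simp [Boundary.length_pre])]
      simp only [← hn, List.getElem_take]
    rw [← h0, List.getElem_zero_eq_head, List.cons_head_tail]
  have htail : (u n).toWord.tail.take K = (x.shift 1).pre K := by
    rw [hw] at hn
    apply List.ext_getElem
    · have := congrArg List.length hn
      simpa [Boundary.length_pre] using this
    · intro i h1 h2
      have h3 := Boundary.getElem_pre x (K + 1) (i + 1)
        (by simpa [Boundary.length_pre] using h2)
      simp only [← hn, List.take_succ_cons, List.getElem_cons_succ] at h3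
      rw [h3, Boundary.getElem_pre]
      simp [Boundary.shift, add_comm]
  have hred : FreeGroup.IsReduced (u n).toWord := FreeGroup.isReduced_toWord
  by_cases h : x.1 0 = invLetter a
  · have : FreeGroup.mk [a] * u n = FreeGroup.mk (u n).toWord.tail := by
      conv_lhs => rw [← FreeGroup.mk_toWord (x := u n), hw, mk_cons (x.1 0), h, mk_invLetter,
        mul_inv_cancel_left]
    rw [this, letterMul_of_eq h, ← htail, FreeGroup.IsReduced.toWord_mk]
    rw [← List.drop_one]
    exact hred.drop 1
  · have : FreeGroup.mk [a] * u n = FreeGroup.mk (a :: (u n).toWord) := by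
      rw [mk_cons a (u n).toWord, FreeGroup.mk_toWord]
    rw [this, FreeGroup.IsReduced.toWord_mk]
    · apply List.ext_getElem
      · have := congrArg List.length hn
        simp [Boundary.length_pre] at this ⊢
        omega
      · intro i h1 h2
        rw [Boundary.getElem_pre, List.getElem_take]
        cases i with
        | zero => rw [letterMul_zero_of_ne h]; rfl
        | succ i =>
          rw [letterMul_succ_of_ne h]
          have h3 := Boundary.getElem_pre x (K + 1) i
            (by simp [Boundary.length_pre] at h2 ⊢; omega)
          simp only [← hn, List.getElem_take] at h3
          simpa using h3
    · rw [hw, isReduced_iff_isChain, List.isChain_cons_cons]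
      rw [hw, isReduced_iff_isChain] at hred
      exact ⟨h, hred⟩

/-- Left multiplication is continuous up to the boundary. -/
theorem TendstoBoundary.smul {u : ℕ → FreeGroup α} {x : Boundary α}
    (hx : TendstoBoundary u x) (g : FreeGroup α) :
    TendstoBoundary (fun n => g * u n) (g • x) := by
  have key : ∀ L : List (α × Bool),
      TendstoBoundary (fun n => FreeGroup.mk L * u n) (FreeGroup.mk L • x) := by
    intro L
    induction L with
    | nil => simpa [← FreeGroup.one_eq_mk] using hx
    | cons a L ih =>
      rw [mk_cons, mul_smul, mk_singleton_smul]
      simpa only [mul_assoc] using ih.mk_singleton_mul a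
  have := key g.toWord
  rwa [FreeGroup.mk_toWord] at this

end Convergence

/-! ### Bi-infinite geodesics in the Cayley tree of a free group -/

section Geodesics

variable {α : Type*}

/-- `γ` is the sequence of vertices of a bi-infinite path without backtracking in the Cayley tree of
the free group, and `l` is the sequence of the labels of its edges. -/
structure IsGeodLine (γ : ℤ → FreeGroup α) (l : ℤ → α × Bool) : Prop where
  step : ∀ n, γ (n + 1) = γ n * FreeGroup.mk [l n]
  red : ∀ n, l (n + 1) ≠ invLetter (l n)

/-- The word of length `n` read on a labelled line from position `i`. -/
def seg (l : ℤ → α × Bool) (i : ℤ) (n : ℕ) : List (α × Bool) := List.ofFn fun j : Fin n => l (i + j)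

theorem length_seg (l : ℤ → α × Bool) (i : ℤ) (n : ℕ) : (seg l i n).length = n := by simp [seg]

/-- The bi-infinite path through `1` with given labels. -/
def lineOf (l : ℤ → α × Bool) (n : ℤ) : FreeGroup α :=
  if 0 ≤ n then FreeGroup.mk (List.ofFn fun j : Fin n.toNat => l j)
  else FreeGroup.mk (List.ofFn fun j : Fin (-n).toNat => invLetter (l (-1 - j)))

theorem lineOf_zero (l : ℤ → α × Bool) : lineOf l 0 = 1 := by
  simp [lineOf, FreeGroup.one_eq_mk]

theorem isGeodLine_lineOf {l : ℤ → α × Bool} (h : ∀ n, l (n + 1) ≠ invLetter (l n)) :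
    IsGeodLine (lineOf l) l := by
  have hneg : ∀ k : ℕ, lineOf l (-k) =
      FreeGroup.mk (List.ofFn fun j : Fin k => invLetter (l (-1 - (j : ℕ)))) := by
    intro k
    rcases Nat.eq_zero_or_pos k with rfl | hk
    · simp [lineOf]
    · rw [lineOf, if_neg (by omega)]
      simp
  refine ⟨fun n => ?_, h⟩
  rcases le_or_gt 0 n with hn | hn
  · lift n to ℕ using hn
    have := mk_ofFn_succ (fun i : ℕ => l i) n
    rw [lineOf, if_pos (by omega), lineOf, if_pos (by omega)]
    simpa using this
  · obtain ⟨k, rfl⟩ : ∃ k : ℕ, n = -((k + 1 : ℕ) : ℤ) := ⟨(-n - 1).toNat, by omega⟩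
    have := mk_ofFn_succ (fun i : ℕ => invLetter (l (-1 - i))) k
    rw [show -((k + 1 : ℕ) : ℤ) + 1 = -(k : ℤ) by push_cast; ring, hneg, hneg, this, mk_invLetter,
      show -((k + 1 : ℕ) : ℤ) = -1 - (k : ℤ) by push_cast; ring, inv_mul_cancel_right]

namespace IsGeodLine

variable {γ : ℤ → FreeGroup α} {l : ℤ → α × Bool}

theorem shift (h : IsGeodLine γ l) (m : ℤ) :
    IsGeodLine (fun n => γ (n + m)) fun n => l (n + m) where
  step n := by
    have := h.step (n + m)
    rwa [add_right_comm] at this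
  red n := by
    have := h.red (n + m)
    rwa [add_right_comm] at this

theorem mul_left (h : IsGeodLine γ l) (g : FreeGroup α) : IsGeodLine (fun n => g * γ n) l where
  step n := by rw [h.step, mul_assoc]
  red := h.red

theorem rev (h : IsGeodLine γ l) :
    IsGeodLine (fun n => γ (-n)) fun n => invLetter (l (-1 - n)) where
  step n := by
    have := h.step (-(n + 1))
    rw [show -(n + 1) + 1 = -n by ring] at this
    rw [this, mk_invLetter, show -1 - n = -(n + 1) by ring, mul_inv_cancel_right]
  red n := by
    have := h.red (-1 - (n + 1))
    rw [show -1 - (n + 1) + 1 = -1 - n by ring] at this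
    rw [invLetter_invLetter]
    intro e
    exact this (by rw [e])

theorem isReduced_seg (h : IsGeodLine γ l) (i : ℤ) (n : ℕ) : FreeGroup.IsReduced (seg l i n) := by
  refine isReduced_ofFn (l := fun j : ℕ => l (i + j)) (fun j => ?_) n
  have := h.red (i + j)
  rwa [show i + (j : ℤ) + 1 = i + ((j + 1 : ℕ) : ℤ) by push_cast; ring] at this

theorem add_nat (h : IsGeodLine γ l) (i : ℤ) (n : ℕ) :
    γ (i + n) = γ i * FreeGroup.mk (seg l i n) := by
  induction n with
  | zero => simp [seg, ← FreeGroup.one_eq_mk]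
  | succ n ih =>
    have := mk_ofFn_succ (fun j : ℕ => l (i + j)) n
    rw [seg, this, ← mul_assoc]
    rw [seg] at ih
    rw [← ih, ← h.step]
    push_cast
    ring_nf

/-- The boundary point reached by the labels from position `i` on. -/
def ray (h : IsGeodLine γ l) (i : ℤ) : Boundary α :=
  ⟨fun n => l (i + n), fun n => by
    have := h.red (i + n)
    rwa [show i + (n : ℤ) + 1 = i + ((n + 1 : ℕ) : ℤ) by push_cast; ring] at this⟩

/-- Two lines which meet a vertex and have the same labels coincide. -/
theorem eq_of_eq (h : IsGeodLine γ l) {γ' : ℤ → FreeGroup α} (h' : IsGeodLine γ' l)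
    (h0 : γ 0 = γ' 0) (n : ℤ) : γ n = γ' n := by
  have pos : ∀ {γ γ' : ℤ → FreeGroup α} {l : ℤ → α × Bool}, IsGeodLine γ l → IsGeodLine γ' l →
      γ 0 = γ' 0 → ∀ n : ℕ, γ n = γ' n := by
    intro γ γ' l h h' h0 n
    have h1 := h.add_nat 0 n
    have h2 := h'.add_nat 0 n
    rw [zero_add] at h1 h2
    rw [h1, h2, h0]
  rcases le_total 0 n with hn | hn
  · lift n to ℕ using hn
    exact pos h h' h0 n
  · have := pos h.rev h'.rev (by simpa using h0) (-n).toNat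
    simpa [Int.toNat_of_nonneg (show 0 ≤ -n by omega)] using this

variable [DecidableEq α]

theorem norm_add_nat (h : IsGeodLine γ l) (i : ℤ) (n : ℕ) : ((γ i)⁻¹ * γ (i + n)).norm = n := by
  rw [h.add_nat, inv_mul_cancel_left, FreeGroup.norm, (h.isReduced_seg i n).toWord_mk, length_seg]

theorem norm_sub (h : IsGeodLine γ l) (i j : ℤ) : ((γ i)⁻¹ * γ j).norm = (j - i).natAbs := by
  have key : ∀ i j : ℤ, i ≤ j → ((γ i)⁻¹ * γ j).norm = (j - i).natAbs := by
    intro i j hij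
    obtain ⟨n, rfl⟩ : ∃ n : ℕ, j = i + n := ⟨(j - i).toNat, by omega⟩
    rw [h.norm_add_nat]
    omega
  rcases le_total i j with hij | hij
  · exact key i j hij
  · rw [← FreeGroup.norm_inv_eq, mul_inv_rev, inv_inv, key j i hij]
    omega

theorem injective (h : IsGeodLine γ l) : Function.Injective γ := by
  intro i j hij
  have := h.norm_sub i j
  rw [hij, inv_mul_cancel, FreeGroup.norm_one] at this
  omega

theorem tendsto_ray (h : IsGeodLine γ l) (i : ℤ) :
    TendstoBoundary (fun n : ℕ => γ (i + n)) (γ i • h.ray i) := by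
  have h1 := ((h.ray i).tendsto_preElt).smul (γ i)
  convert h1 using 2 with n
  rw [h.add_nat]
  rfl

end IsGeodLine

/-- The geodesic line `γ` with labels `l` goes from the boundary point `ξ` to the boundary
point `ζ`. -/
structure Connects [DecidableEq α] (γ : ℤ → FreeGroup α) (l : ℤ → α × Bool) (ξ ζ : Boundary α) :
    Prop extends IsGeodLine γ l where
  neg : TendstoBoundary (fun n : ℕ => γ (-(n : ℤ))) ξ
  pos : TendstoBoundary (fun n : ℕ => γ n) ζ

namespace Connects

variable [DecidableEq α] {γ : ℤ → FreeGroup α} {l : ℤ → α × Bool} {ξ ζ : Boundary α}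

theorem mul_left (h : Connects γ l ξ ζ) (g : FreeGroup α) :
    Connects (fun n => g * γ n) l (g • ξ) (g • ζ) where
  toIsGeodLine := h.toIsGeodLine.mul_left g
  neg := h.neg.smul g
  pos := h.pos.smul g

theorem rev (h : Connects γ l ξ ζ) :
    Connects (fun n => γ (-n)) (fun n => invLetter (l (-1 - n))) ζ ξ where
  toIsGeodLine := h.toIsGeodLine.rev
  neg := by simpa using h.pos
  pos := h.neg

theorem pos_eq (h : Connects γ l ξ ζ) (i : ℤ) : ζ = γ i • h.ray i := by
  have hray := h.tendsto_ray i
  rcases le_total 0 i with hi | hi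
  · lift i to ℕ using hi
    refine TendstoBoundary.unique ?_ hray
    have := h.pos.comp (a := fun n => i + n) (tendsto_atTop_mono (fun n => by simp) tendsto_id)
    simpa using this
  · refine TendstoBoundary.unique h.pos ?_
    have h2 := hray.comp (a := fun n => (-i).toNat + n)
      (tendsto_atTop_mono (fun n => by simp) tendsto_id)
    convert h2 using 2 with n
    congr 1
    push_cast
    rw [Int.toNat_of_nonneg (by omega)]
    ring

theorem inv_smul_pos (h : Connects γ l ξ ζ) (i : ℤ) (n : ℕ) :
    ((γ i)⁻¹ • ζ).1 n = l (i + n) := by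
  rw [h.pos_eq i, inv_smul_smul]
  rfl

theorem inv_smul_neg (h : Connects γ l ξ ζ) (i : ℤ) (n : ℕ) :
    ((γ i)⁻¹ • ξ).1 n = invLetter (l (i - 1 - n)) := by
  have := h.rev.inv_smul_pos (-i) n
  simp only [neg_neg] at this
  rw [this]
  congr 2
  ring

theorem shift (h : Connects γ l ξ ζ) (m : ℤ) :
    Connects (fun n => γ (n + m)) (fun n => l (n + m)) ξ ζ := by
  have key : ∀ {γ : ℤ → FreeGroup α} {l : ℤ → α × Bool} {ξ ζ : Boundary α}, Connects γ l ξ ζ →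
      ∀ m : ℤ, TendstoBoundary (fun n : ℕ => γ (n + m)) ζ := by
    intro γ l ξ ζ h m
    have := h.tendsto_ray m
    rw [← h.pos_eq m] at this
    simpa only [add_comm] using this
  refine ⟨h.toIsGeodLine.shift m, ?_, key h m⟩
  have := key h.rev (-m)
  simpa [add_comm] using this

theorem ne (h : Connects γ l ξ ζ) : ξ ≠ ζ := by
  rintro rfl
  have h1 := h.inv_smul_pos 0 0
  rw [h.inv_smul_neg 0 0] at h1
  have h2 := h.red (-1)
  simp only [Nat.cast_zero, sub_zero, add_zero, zero_sub] at h1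
  rw [neg_add_cancel, h1] at h2
  exact h2 rfl

/-- The vertices of the line from `ξ` to `ζ` are the group elements from which `ξ` and `ζ` are seen
in different directions. -/
theorem exists_eq_iff (h : Connects γ l ξ ζ) (p : FreeGroup α) :
    (∃ i, γ i = p) ↔ (p⁻¹ • ξ).1 0 ≠ (p⁻¹ • ζ).1 0 := by
  constructor
  · rintro ⟨i, rfl⟩
    rw [h.inv_smul_pos, h.inv_smul_neg]
    have := h.red (i - 1)
    rw [sub_add_cancel] at this
    simpa using this.symm
  · intro hp
    -- After a translation the line passes through `1`, and `p` is then a prefix of one of its ends.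
    have h' := h.mul_left (γ 0)⁻¹
    set q := (γ 0)⁻¹ * p with hq
    have hp' : (q⁻¹ • (γ 0)⁻¹ • ξ).1 0 ≠ (q⁻¹ • (γ 0)⁻¹ • ζ).1 0 := by
      simpa [hq, smul_smul] using hp
    have hmk : q = FreeGroup.mk q.toWord := FreeGroup.mk_toWord.symm
    have hred : FreeGroup.IsReduced q.toWord := FreeGroup.isReduced_toWord
    suffices ∃ i, (γ 0)⁻¹ * γ i = q by
      obtain ⟨i, hi⟩ := this
      exact ⟨i, mul_left_cancel hi⟩
    by_cases h1 : ((γ 0)⁻¹ • ζ).pre q.toWord.length = q.toWord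
    · refine ⟨q.toWord.length, ?_⟩
      have h2 := h'.add_nat 0 q.toWord.length
      simp only [zero_add, inv_mul_cancel, one_mul] at h2
      have h4 : seg l 0 q.toWord.length = q.toWord :=
        Eq.trans (by simp only [seg, Boundary.pre, h.inv_smul_pos]) h1
      rw [h2, h4, ← hmk]
    by_cases h3 : ((γ 0)⁻¹ • ξ).pre q.toWord.length = q.toWord
    · refine ⟨-q.toWord.length, ?_⟩
      have h2 := h'.rev.add_nat 0 q.toWord.length
      simp only [zero_add, neg_zero, inv_mul_cancel, one_mul] at h2
      have h4 : seg (fun n => invLetter (l (-1 - n))) 0 q.toWord.length = q.toWord :=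
        Eq.trans (by simp only [seg, Boundary.pre, h.inv_smul_neg, zero_add, zero_sub]) h3
      rw [h2, h4, ← hmk]
    · exfalso
      have hne : q.toWord ≠ [] := by
        intro e
        apply h1
        rw [e]
        rfl
      apply hp'
      have e1 := inv_mk_smul_zero_of_pre_ne hred hne h1
      have e2 := inv_mk_smul_zero_of_pre_ne hred hne h3
      rw [← hmk] at e1 e2
      rw [e1, e2]

/-- A geodesic line is determined by its ends, up to the choice of the origin. -/
theorem exists_shift (h : Connects γ l ξ ζ) {γ' : ℤ → FreeGroup α} {l' : ℤ → α × Bool}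
    (h' : Connects γ' l' ξ ζ) : ∃ m, ∀ n, γ' n = γ (n + m) ∧ l' n = l (n + m) := by
  obtain ⟨m, hm⟩ := (h.exists_eq_iff (γ' 0)).mpr ((h'.exists_eq_iff (γ' 0)).mp ⟨0, rfl⟩)
  have hl : ∀ n, l' n = l (n + m) := by
    intro n
    rcases le_or_gt 0 n with hn | hn
    · lift n to ℕ using hn
      have h1 := h'.inv_smul_pos 0 n
      rw [← hm, h.inv_smul_pos, zero_add, add_comm] at h1
      exact h1.symm
    · have h1 := h'.inv_smul_neg 0 (-1 - n).toNat
      rw [← hm, h.inv_smul_neg, Int.toNat_of_nonneg (by omega)] at h1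
      have := invLetter_injective h1
      rw [show m - 1 - (-1 - n) = n + m by ring, show (0 : ℤ) - 1 - (-1 - n) = n by ring] at this
      exact this.symm
  refine ⟨m, fun n => ⟨?_, hl n⟩⟩
  have hs := h.toIsGeodLine.shift m
  rw [← show l' = fun n => l (n + m) from funext hl] at hs
  exact h'.toIsGeodLine.eq_of_eq hs (by simpa using hm.symm) n

end Connects

/-- Two distinct boundary points are the ends of a geodesic line. -/
theorem exists_connects [DecidableEq α] {ξ ζ : Boundary α} (h : ξ ≠ ζ) :
    ∃ γ l, Connects γ l ξ ζ := by
  obtain ⟨m, hm, hmin⟩ : ∃ m, ξ.1 m ≠ ζ.1 m ∧ ∀ i < m, ξ.1 i = ζ.1 i := by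
    have hex : ∃ m, ξ.1 m ≠ ζ.1 m := by
      by_contra! hall
      exact h (Subtype.ext (funext hall))
    classical
    exact ⟨Nat.find hex, Nat.find_spec hex, fun i hi => not_not.mp (Nat.find_min hex hi)⟩
  have hpre : ξ.pre m = ζ.pre m := Boundary.pre_eq_iff.mpr hmin
  -- The line comes in along `ξ` to the point where `ξ` and `ζ` branch, and leaves along `ζ`.
  let l : ℤ → α × Bool := fun n =>
    if 0 ≤ n then ζ.1 (m + n.toNat) else invLetter (ξ.1 (m + (-1 - n).toNat))
  have hl : ∀ n, l (n + 1) ≠ invLetter (l n) := by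
    intro n
    rcases lt_trichotomy n (-1) with hn | rfl | hn
    · simp only [l]
      rw [if_neg (by omega), if_neg (by omega), invLetter_invLetter]
      have := ξ.2 (m + (-1 - (n + 1)).toNat)
      rw [show m + (-1 - (n + 1)).toNat + 1 = m + (-1 - n).toNat by omega] at this
      exact this.symm
    · simp only [l]
      rw [if_pos (by omega), if_neg (by omega), invLetter_invLetter]
      simpa using hm.symm
    · simp only [l]
      rw [if_pos (by omega), if_pos (by omega)]
      have := ζ.2 (m + n.toNat)
      rwa [show m + n.toNat + 1 = m + (n + 1).toNat by omega] at this
  have hline := isGeodLine_lineOf hl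
  refine ⟨_, l, hline.mul_left (ζ.preElt m), ?_, ?_⟩
  · have h1 := (hline.mul_left (ζ.preElt m)).rev.tendsto_ray 0
    convert h1 using 2
    · simp
    · simp only [neg_zero, lineOf_zero, mul_one]
      rw [eq_comm, ← eq_inv_smul_iff, Boundary.preElt, ← hpre,
        inv_mk_smul_of_pre_eq (by rw [Boundary.length_pre])]
      apply Subtype.ext
      funext n
      simp only [IsGeodLine.ray, Boundary.shift, l, zero_add, Boundary.length_pre]
      rw [if_neg (by omega), invLetter_invLetter,
        show (-1 - (-1 - (n : ℤ))).toNat = n by omega]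
  · have h1 := (hline.mul_left (ζ.preElt m)).tendsto_ray 0
    convert h1 using 2
    · simp
    · simp only [lineOf_zero, mul_one]
      rw [eq_comm, ← eq_inv_smul_iff, Boundary.preElt,
        inv_mk_smul_of_pre_eq (by rw [Boundary.length_pre])]
      apply Subtype.ext
      funext n
      simp only [IsGeodLine.ray, Boundary.shift, l, zero_add, Boundary.length_pre]
      rw [if_pos (by omega)]
      congr 1

end Geodesics

/-! ### Edge-paths and lifts -/

namespace OrientedGraph

variable {V E : Type*} {Γ : OrientedGraph V E}

theorem isPath_append_iff {L M : List (E × Bool)} {u w : V} :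
    Γ.IsPath u (L ++ M) w ↔ ∃ v, Γ.IsPath u L v ∧ Γ.IsPath v M w := by
  induction L generalizing u with
  | nil => exact ⟨fun h => ⟨u, rfl, h⟩, fun ⟨v, h, h'⟩ => (show u = v from h) ▸ h'⟩
  | cons e L ih =>
    simp only [List.cons_append, IsPath, ih]
    exact ⟨fun ⟨h, v, h1, h2⟩ => ⟨v, ⟨h, h1⟩, h2⟩, fun ⟨v, ⟨h, h1⟩, h2⟩ => ⟨h, v, h1, h2⟩⟩

theorem IsPath.end_unique {L : List (E × Bool)} {u v w : V} (h : Γ.IsPath u L v)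
    (h' : Γ.IsPath u L w) : v = w := by
  induction L generalizing u with
  | nil => exact (show u = v from h).symm.trans h'
  | cons e L ih => exact ih h.2 h'.2

theorem isPath_singleton (e : E × Bool) : Γ.IsPath (Γ.o e) [e] (Γ.t e) := ⟨rfl, rfl⟩

theorem IsPath.red {L M : List (E × Bool)} {u v : V} (h : Γ.IsPath u L v)
    (hr : FreeGroup.Red L M) : Γ.IsPath u M v := by
  induction hr with
  | refl => exact h
  | tail _ hs ih =>
    cases hs with
    | @not L₁ L₂ x b =>
      obtain ⟨w, h1, h2, h3, h4⟩ := isPath_append_iff.mp ih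
      refine h1.append ?_
      have := t_inv (Γ := Γ) (x, b)
      simp only at this
      rw [this] at h4
      rwa [h2] at h4

theorem IsPath.take {L : List (E × Bool)} {u v : V} (h : Γ.IsPath u L v) (k : ℕ) :
    ∃ w, Γ.IsPath u (L.take k) w := by
  rw [← List.take_append_drop k L, isPath_append_iff] at h
  exact ⟨_, h.choose_spec.1⟩

end OrientedGraph

namespace SimplicialChart

open OrientedGraph

variable {N : ℕ} {V E : Type*} [Fintype V] [Fintype E] (Γ : SimplicialChart N V E)

/-- The marking, as an injective homomorphism of `F_N` into the free group on the edges. -/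
def markingHom : FreeGroup (Fin N) →* FreeGroup E :=
  (Γ.pi1 Γ.base).subtype.comp Γ.marking.toMonoidHom

theorem markingHom_apply (g : FreeGroup (Fin N)) : Γ.markingHom g = (Γ.marking g : FreeGroup E) :=
  rfl

theorem markingHom_injective : Function.Injective Γ.markingHom :=
  Subtype.val_injective.comp Γ.marking.injective

variable {Γ}

theorem isLift_markingHom (g : FreeGroup (Fin N)) : Γ.IsLift Γ.base (Γ.markingHom g) :=
  (Γ.marking g).2

theorem IsLift.exists_markingHom_eq {p : FreeGroup E} (h : Γ.IsLift Γ.base p) :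
    ∃ g, Γ.markingHom g = p :=
  ⟨Γ.marking.symm ⟨p, h⟩, by simp [markingHom_apply]⟩

theorem IsLift.mul_mk {u w : V} {p : FreeGroup E} (h : Γ.IsLift u p) {L : List (E × Bool)}
    (hL : Γ.IsPath u L w) : Γ.IsLift w (p * FreeGroup.mk L) := by
  obtain ⟨M, hM, rfl⟩ := h
  exact ⟨M ++ L, hM.append hL, mk_append M L⟩

theorem IsLift.markingHom_mul {u : V} {p : FreeGroup E} (h : Γ.IsLift u p)
    (g : FreeGroup (Fin N)) : Γ.IsLift u (Γ.markingHom g * p) := by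
  obtain ⟨M, hM, rfl⟩ := h
  exact (isLift_markingHom g).mul_mk hM

/-- The group acts transitively on the lifts of a vertex. -/
theorem IsLift.exists_markingHom_mul_eq {u : V} {p q : FreeGroup E} (hp : Γ.IsLift u p)
    (hq : Γ.IsLift u q) : ∃ g, Γ.markingHom g * p = q := by
  obtain ⟨L, hL, rfl⟩ := hp
  obtain ⟨g, hg⟩ := (hq.mul_mk hL.invRev).exists_markingHom_eq
  exact ⟨g, by rw [hg, ← FreeGroup.inv_mk, inv_mul_cancel_right]⟩

variable (Γ)

theorem exists_isLift (v : V) : ∃ p, Γ.IsLift v p := by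
  obtain ⟨L, hL⟩ := Γ.connected Γ.base v
  exact ⟨_, L, hL, rfl⟩

variable {Γ} in
theorem IsLift.isPath_toWord [DecidableEq E] {u w : V} {p q : FreeGroup E} (hp : Γ.IsLift u p)
    (hq : Γ.IsLift w q) : Γ.IsPath u (p⁻¹ * q).toWord w := by
  obtain ⟨L, hL, rfl⟩ := hp
  obtain ⟨M, hM, rfl⟩ := hq
  rw [FreeGroup.inv_mk, ← mk_append, FreeGroup.toWord_mk]
  exact (hL.invRev.append hM).red FreeGroup.reduce.red

/-- The inverse of the marking, with an unspecified value outside of the fundamental group. -/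
def unmark (p : FreeGroup E) : FreeGroup (Fin N) := Function.invFun Γ.markingHom p

theorem unmark_markingHom (g : FreeGroup (Fin N)) : Γ.unmark (Γ.markingHom g) = g :=
  Function.leftInverse_invFun Γ.markingHom_injective g

variable {Γ} in
theorem IsLift.markingHom_unmark {p : FreeGroup E} (h : Γ.IsLift Γ.base p) :
    Γ.markingHom (Γ.unmark p) = p := by
  obtain ⟨g, rfl⟩ := h.exists_markingHom_eq
  rw [unmark_markingHom]

/-- The element of `F_N` given by a path from `u` to `w`, closed up by means of the paths `δ`. -/
def pathElt (δ : V → List (E × Bool)) (u w : V) (L : List (E × Bool)) : FreeGroup (Fin N) :=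
  Γ.unmark (FreeGroup.mk (δ u) * FreeGroup.mk L * (FreeGroup.mk (δ w))⁻¹)

variable {Γ} in
theorem markingHom_pathElt {δ : V → List (E × Bool)} (hδ : ∀ v, Γ.IsPath Γ.base (δ v) v) {u w : V}
    {L : List (E × Bool)} (hL : Γ.IsPath u L w) :
    Γ.markingHom (Γ.pathElt δ u w L) =
      FreeGroup.mk (δ u) * FreeGroup.mk L * (FreeGroup.mk (δ w))⁻¹ := by
  apply IsLift.markingHom_unmark
  rw [FreeGroup.inv_mk]
  exact (IsLift.mul_mk ⟨_, hδ u, rfl⟩ hL).mul_mk (hδ w).invRev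

variable {Γ} in
theorem pathElt_append {δ : V → List (E × Bool)} (hδ : ∀ v, Γ.IsPath Γ.base (δ v) v) {u v w : V}
    {L M : List (E × Bool)} (hL : Γ.IsPath u L v) (hM : Γ.IsPath v M w) :
    Γ.pathElt δ u w (L ++ M) = Γ.pathElt δ u v L * Γ.pathElt δ v w M := by
  apply Γ.markingHom_injective
  rw [map_mul, markingHom_pathElt hδ hL, markingHom_pathElt hδ hM,
    markingHom_pathElt hδ (hL.append hM), mk_append]
  group

/-- Closing up paths is Lipschitz. -/
theorem exists_norm_pathElt_le {δ : V → List (E × Bool)} (hδ : ∀ v, Γ.IsPath Γ.base (δ v) v)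
    (ℓ : FreeGroup (Fin N) → ℕ) (hone : ℓ 1 = 0) (hmul : ∀ g h, ℓ (g * h) ≤ ℓ g + ℓ h) :
    ∃ c, ∀ u w L, Γ.IsPath u L w → ℓ (Γ.pathElt δ u w L) ≤ c * L.length := by
  let c := Finset.univ.sup fun e : E × Bool => ℓ (Γ.pathElt δ (Γ.o e) (Γ.t e) [e])
  refine ⟨c, fun u w L hL => ?_⟩
  induction L generalizing u with
  | nil =>
    obtain rfl : u = w := hL
    have : Γ.pathElt δ u u [] = 1 := by
      apply Γ.markingHom_injective
      rw [markingHom_pathElt hδ (show Γ.IsPath u [] u from rfl), ← FreeGroup.one_eq_mk,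
        mul_one, mul_inv_cancel, map_one]
    rw [this, hone]
    exact Nat.zero_le _
  | cons e L ih =>
    obtain ⟨rfl, h2⟩ := hL
    rw [show e :: L = [e] ++ L from rfl, pathElt_append hδ (isPath_singleton e) h2]
    have h3 : ℓ (Γ.pathElt δ (Γ.o e) (Γ.t e) [e]) ≤ c :=
      Finset.le_sup (f := fun e : E × Bool => ℓ (Γ.pathElt δ (Γ.o e) (Γ.t e) [e]))
        (Finset.mem_univ e)
    calc _ ≤ _ := hmul _ _
      _ ≤ c + c * L.length := add_le_add h3 (ih _ h2)
      _ = _ := by simp; ring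

/-! ### The boundary of the universal covering tree -/

variable [DecidableEq E]

/-- The marking extends continuously to infinity. -/
theorem exists_prefixAgree_markingHom (K : ℕ) : ∃ k, ∀ g h : FreeGroup (Fin N),
    PrefixAgree k g h → PrefixAgree K (Γ.markingHom g) (Γ.markingHom h) := by
  let c := Finset.univ.sup fun a : Fin N × Bool => (Γ.markingHom (FreeGroup.mk [a])).norm
  obtain ⟨k, hk⟩ := exists_prefixAgree_of_lipschitz
    (A := {L : List (Fin N × Bool) | FreeGroup.IsReduced L})
    (fun L hL k => FreeGroup.IsReduced.take hL k) (fun L => Γ.markingHom (FreeGroup.mk L)) c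
    (fun L a _ => by
      rw [mk_append, map_mul, inv_mul_cancel_left]
      exact Finset.le_sup (f := fun a : Fin N × Bool => (Γ.markingHom (FreeGroup.mk [a])).norm)
        (Finset.mem_univ a))
    (exists_le_norm_of_injOn _ (fun _ => ()) (fun L hL M hM h => by
      refine mk_injOn_isReduced hL hM (Γ.markingHom_injective ?_)
      simpa using h)) K
  refine ⟨k, fun g h hgh => ?_⟩
  have := hk g.toWord FreeGroup.isReduced_toWord h.toWord FreeGroup.isReduced_toWord hgh.1 hgh.2
  simpa only [FreeGroup.mk_toWord] using this

/-- The inverse of the marking extends continuously to infinity. It is extended to all edge-paths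
issuing from the base vertex by closing them up with fixed paths `d`, in order to compare the images
of long paths with a common prefix one edge at a time. -/
theorem exists_prefixAgree_of_markingHom (K : ℕ) : ∃ k, ∀ g h : FreeGroup (Fin N),
    PrefixAgree k (Γ.markingHom g) (Γ.markingHom h) → PrefixAgree K g h := by
  classical
  choose d' hd' using Γ.connected Γ.base
  let d : V → List (E × Bool) := fun v => if v = Γ.base then [] else d' v
  have hd : ∀ v, Γ.IsPath Γ.base (d v) v := by
    intro v
    by_cases hv : v = Γ.base
    · simp only [d, hv, if_true]
      rfl
    · simp only [d, hv, if_false]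
      exact hd' v
  let en : List (E × Bool) → V := fun L =>
    if h : ∃ v, Γ.IsPath Γ.base L v then h.choose else Γ.base
  have hen : ∀ L v, Γ.IsPath Γ.base L v → en L = v := by
    intro L v h
    have hex : ∃ v, Γ.IsPath Γ.base L v := ⟨v, h⟩
    simp only [en, dif_pos hex]
    exact hex.choose_spec.end_unique h
  let f : List (E × Bool) → FreeGroup (Fin N) := fun L => Γ.pathElt d Γ.base (en L) L
  have hbase : FreeGroup.mk (d Γ.base) = 1 := by simp [d, FreeGroup.one_eq_mk]
  have hf : ∀ L v, Γ.IsPath Γ.base L v →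
      Γ.markingHom (f L) = FreeGroup.mk L * (FreeGroup.mk (d v))⁻¹ := by
    intro L v h
    simp only [f, hen L v h]
    rw [markingHom_pathElt hd h, hbase, one_mul]
  obtain ⟨c, hc⟩ := Γ.exists_norm_pathElt_le hd FreeGroup.norm FreeGroup.norm_one
    FreeGroup.norm_mul_le
  obtain ⟨k, hk⟩ := exists_prefixAgree_of_lipschitz
    (A := {L : List (E × Bool) | FreeGroup.IsReduced L ∧ ∃ v, Γ.IsPath Γ.base L v})
    (fun L hL k => ⟨hL.1.take k, hL.2.choose_spec.take k⟩) f c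
    (by
      rintro L a ⟨-, v, hv⟩
      obtain ⟨w, hw, rfl, rfl⟩ := isPath_append_iff.mp hv
      have : (f L)⁻¹ * f (L ++ [a]) = Γ.pathElt d (Γ.o a) (Γ.t a) [a] := by
        apply Γ.markingHom_injective
        rw [map_mul, map_inv, hf L _ hw, hf _ _ hv, markingHom_pathElt hd (isPath_singleton a),
          mk_append]
        group
      rw [this]
      simpa using hc _ _ _ (isPath_singleton (Γ := Γ.toOrientedGraph) a))
    (exists_le_norm_of_injOn f en (by
      rintro L ⟨hL, v, hv⟩ M ⟨hM, w, hw⟩ h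
      simp only [Prod.mk.injEq] at h
      refine mk_injOn_isReduced hL hM ?_
      obtain rfl : v = w := by rw [← hen L v hv, ← hen M w hw, h.2]
      have := hf L v hv
      rw [h.1, hf M v hw] at this
      exact (mul_right_cancel this).symm)) K
  have hpath : ∀ g, Γ.IsPath Γ.base (Γ.markingHom g).toWord Γ.base := by
    intro g
    have := (isLift_markingHom (1 : FreeGroup (Fin N))).isPath_toWord (isLift_markingHom (Γ := Γ) g)
    simpa using this
  have hfg : ∀ g, f (Γ.markingHom g).toWord = g := by
    intro g
    apply Γ.markingHom_injective
    rw [hf _ _ (hpath g), hbase, FreeGroup.mk_toWord, inv_one, mul_one]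
  refine ⟨k, fun g h hgh => ?_⟩
  have := hk _ ⟨FreeGroup.isReduced_toWord, _, hpath g⟩ _ ⟨FreeGroup.isReduced_toWord, _, hpath h⟩
    hgh.1 hgh.2
  rwa [hfg, hfg] at this

theorem exists_bdry (x : Boundary (Fin N)) :
    ∃ ξ : Boundary E, TendstoBoundary (fun n => Γ.markingHom (x.preElt n)) ξ := by
  apply exists_tendstoBoundary
  intro K
  obtain ⟨k, hk⟩ := Γ.exists_prefixAgree_markingHom K
  refine ⟨Γ.markingHom (x.preElt k), ?_⟩
  filter_upwards [tendstoBoundary_iff_prefixAgree.mp x.tendsto_preElt k] with n hn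
  exact hk _ _ hn

/-- The embedding of `∂F_N` into the boundary of the free group on the edges whose image is the
boundary of the universal covering tree. -/
def bdry (x : Boundary (Fin N)) : Boundary E := (Γ.exists_bdry x).choose

theorem tendsto_bdry {u : ℕ → FreeGroup (Fin N)} {x : Boundary (Fin N)}
    (h : TendstoBoundary u x) : TendstoBoundary (fun n => Γ.markingHom (u n)) (Γ.bdry x) := by
  have h0 := (Γ.exists_bdry x).choose_spec
  rw [tendstoBoundary_iff_prefixAgree] at h0 h ⊢
  intro K
  obtain ⟨k, hk⟩ := Γ.exists_prefixAgree_markingHom K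
  obtain ⟨m, h1, h2⟩ :=
    ((h0 K).and (tendstoBoundary_iff_prefixAgree.mp x.tendsto_preElt k)).exists
  filter_upwards [h k] with n hn
  exact h1.trans (hk _ _ (h2.symm.trans hn))

theorem tendstoEnd_iff {p : ℕ → FreeGroup E} {x : Boundary (Fin N)} :
    Γ.TendstoEnd p x ↔ TendstoBoundary p (Γ.bdry x) := by
  have h := Γ.tendsto_bdry x.tendsto_preElt
  constructor
  · rintro ⟨ξ, h1, h2⟩
    obtain rfl := h1.unique h
    exact h2
  · exact fun h2 => ⟨_, h, h2⟩

theorem bdry_smul (g : FreeGroup (Fin N)) (x : Boundary (Fin N)) :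
    Γ.bdry (g • x) = Γ.markingHom g • Γ.bdry x := by
  have h1 := Γ.tendsto_bdry (x.tendsto_preElt.smul g)
  have h2 := (Γ.tendsto_bdry x.tendsto_preElt).smul (Γ.markingHom g)
  simp only [map_mul] at h1
  exact h1.unique h2

/-- The embedding of boundaries is uniformly continuous. -/
theorem exists_pre_bdry_eq (K : ℕ) :
    ∃ k, ∀ x y, x.pre k = y.pre k → (Γ.bdry x).pre K = (Γ.bdry y).pre K := by
  obtain ⟨k, hk⟩ := Γ.exists_prefixAgree_markingHom K
  refine ⟨k, fun x y hxy => ?_⟩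
  have hx := Γ.tendsto_bdry x.tendsto_preElt
  have hy := Γ.tendsto_bdry y.tendsto_preElt
  rw [tendstoBoundary_iff_take] at hx hy
  obtain ⟨n, ⟨h1, h2⟩, h3⟩ := (((hx K).and (hy K)).and (eventually_ge_atTop k)).exists
  rw [← h1, ← h2]
  refine (hk _ _ ⟨?_, ?_⟩).2
  · rwa [Boundary.toWord_preElt, Boundary.length_pre]
  · rw [Boundary.toWord_preElt, Boundary.toWord_preElt, Boundary.take_pre _ h3,
      Boundary.take_pre _ h3, hxy]

/-- The embedding of boundaries has a uniformly continuous inverse. -/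
theorem exists_pre_eq_of_bdry (K : ℕ) :
    ∃ k, ∀ x y, (Γ.bdry x).pre k = (Γ.bdry y).pre k → x.pre K = y.pre K := by
  obtain ⟨k, hk⟩ := Γ.exists_prefixAgree_of_markingHom K
  refine ⟨k, fun x y hxy => ?_⟩
  have hx := tendstoBoundary_iff_prefixAgree.mp (Γ.tendsto_bdry x.tendsto_preElt) k
  have hy := tendstoBoundary_iff_take.mp (Γ.tendsto_bdry y.tendsto_preElt) k
  obtain ⟨n, ⟨h1, h2⟩, h3⟩ := ((hx.and hy).and (eventually_ge_atTop K)).exists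
  have h4 := (hk (x.preElt n) (y.preElt n) ⟨h1.le_right, by
    rw [h2, ← hxy, ← h1.2, Boundary.toWord_preElt, Boundary.take_pre _ le_rfl]⟩).2
  rwa [Boundary.toWord_preElt, Boundary.toWord_preElt, Boundary.take_pre _ h3,
    Boundary.take_pre _ h3] at h4

theorem bdry_injective : Function.Injective Γ.bdry := by
  intro x y h
  refine Boundary.ext_pre fun K => ?_
  obtain ⟨k, hk⟩ := Γ.exists_pre_eq_of_bdry K
  exact hk x y (by rw [h])

/-! ### Geodesics of the universal covering tree and cylinders -/

/-- `γ` is a geodesic line, with labels `l`, from the end `z.1` to the end `z.2` of the universal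
covering tree. -/
def Joins (γ : ℤ → FreeGroup E) (l : ℤ → E × Bool) (z : DoubleBoundary (Fin N)) : Prop :=
  Connects γ l (Γ.bdry z.1.1) (Γ.bdry z.1.2)

theorem exists_joins (z : DoubleBoundary (Fin N)) : ∃ γ l, Γ.Joins γ l z :=
  exists_connects fun h => z.2 (Γ.bdry_injective h)

variable {Γ}

namespace Joins

variable {γ : ℤ → FreeGroup E} {l : ℤ → E × Bool} {z : DoubleBoundary (Fin N)}

/-- A line joining two ends of the universal covering tree runs in this tree: each of its vertices
lies on the reduced path between two points of the orbit of the base vertex near the two ends. -/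
theorem exists_isLift (h : Γ.Joins γ l z) (n : ℤ) : ∃ v, Γ.IsLift v (γ n) := by
  have hne := (h.exists_eq_iff (γ n)).mp ⟨n, rfl⟩
  have h1 := ((Γ.tendsto_bdry z.1.1.tendsto_preElt).smul (γ n)⁻¹) 1
  have h2 := ((Γ.tendsto_bdry z.1.2.tendsto_preElt).smul (γ n)⁻¹) 1
  obtain ⟨k, ⟨A, hA⟩, ⟨B, hB⟩⟩ := (h1.and h2).exists
  set g := z.1.1.preElt k
  set g' := z.1.2.preElt k
  set a := ((γ n)⁻¹ • Γ.bdry z.1.1).1 0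
  set b := ((γ n)⁻¹ • Γ.bdry z.1.2).1 0
  have ha : ((γ n)⁻¹ • Γ.bdry z.1.1).pre 1 = [a] := rfl
  have hb : ((γ n)⁻¹ • Γ.bdry z.1.2).pre 1 = [b] := rfl
  rw [ha] at hA
  rw [hb] at hB
  have hrA : FreeGroup.IsReduced ([a] ++ A) := hA ▸ FreeGroup.isReduced_toWord
  have hrB : FreeGroup.IsReduced ([b] ++ B) := hB ▸ FreeGroup.isReduced_toWord
  have hred : FreeGroup.IsReduced (FreeGroup.invRev ([a] ++ A) ++ ([b] ++ B)) := by
    rw [isReduced_append_iff]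
    refine ⟨hrA.invRev, hrB, ?_⟩
    rw [invRev_append, invRev_singleton]
    simpa [invLetter_invLetter] using hne.symm
  have hmA : (γ n)⁻¹ * Γ.markingHom g = FreeGroup.mk ([a] ++ A) := by
    rw [hA, FreeGroup.mk_toWord]
  have hmB : (γ n)⁻¹ * Γ.markingHom g' = FreeGroup.mk ([b] ++ B) := by
    rw [hB, FreeGroup.mk_toWord]
  have hpath := (isLift_markingHom (Γ := Γ) g).isPath_toWord (isLift_markingHom (Γ := Γ) g')
  have he : (Γ.markingHom g)⁻¹ * Γ.markingHom g' =
      FreeGroup.mk (FreeGroup.invRev ([a] ++ A) ++ ([b] ++ B)) := by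
    rw [mk_append, ← FreeGroup.inv_mk, ← hmA, ← hmB]
    group
  rw [he, hred.toWord_mk, isPath_append_iff] at hpath
  obtain ⟨v, hv, -⟩ := hpath
  refine ⟨v, ?_⟩
  have := (isLift_markingHom (Γ := Γ) g).mul_mk hv
  rw [← FreeGroup.inv_mk, ← hmA] at this
  simpa using this

theorem isGeodesic (h : Γ.Joins γ l z) : Γ.IsGeodesic γ :=
  ⟨h.exists_isLift, l, fun n => ⟨h.step n, h.red n⟩⟩

theorem mem_cyl_iff (h : Γ.Joins γ l z) {p q : FreeGroup E} :
    z ∈ Γ.cyl p q ↔ ∃ i j, i ≤ j ∧ γ i = p ∧ γ j = q := by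
  constructor
  · rintro ⟨γ', ⟨-, l', h'⟩, h1, h2, i, j, hij, rfl, rfl⟩
    rw [tendstoEnd_iff] at h1 h2
    obtain ⟨m, hm⟩ := Connects.exists_shift h
      (γ' := γ') (l' := l') ⟨⟨fun n => (h' n).1, fun n => (h' n).2⟩, h1, h2⟩
    exact ⟨i + m, j + m, by omega, (hm i).1.symm, (hm j).1.symm⟩
  · rintro ⟨i, j, hij, rfl, rfl⟩
    exact ⟨γ, h.isGeodesic, Γ.tendstoEnd_iff.mpr h.neg, Γ.tendstoEnd_iff.mpr h.pos, i, j, hij,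
      rfl, rfl⟩

theorem act (h : Γ.Joins γ l z) (g : FreeGroup (Fin N)) :
    Γ.Joins (fun n => Γ.markingHom g * γ n) l (DoubleBoundary.act g z) := by
  have := h.mul_left (Γ.markingHom g)
  rwa [← bdry_smul, ← bdry_smul] at this

theorem flip (h : Γ.Joins γ l z) :
    Γ.Joins (fun n => γ (-n)) (fun n => invLetter (l (-1 - n))) z.flip := h.rev

end Joins

theorem act_mem_cyl_iff {g : FreeGroup (Fin N)} {z : DoubleBoundary (Fin N)} {p q : FreeGroup E} :
    DoubleBoundary.act g z ∈ Γ.cyl p q ↔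
      z ∈ Γ.cyl ((Γ.markingHom g)⁻¹ * p) ((Γ.markingHom g)⁻¹ * q) := by
  obtain ⟨γ, l, h⟩ := Γ.exists_joins z
  simp only [h.mem_cyl_iff, (h.act g).mem_cyl_iff, eq_inv_mul_iff_mul_eq]

theorem flip_mem_cyl_iff {z : DoubleBoundary (Fin N)} {p q : FreeGroup E} :
    z.flip ∈ Γ.cyl p q ↔ z ∈ Γ.cyl q p := by
  obtain ⟨γ, l, h⟩ := Γ.exists_joins z
  rw [h.mem_cyl_iff, h.flip.mem_cyl_iff]
  constructor
  · rintro ⟨i, j, hij, hi, hj⟩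
    exact ⟨-j, -i, by omega, hj, hi⟩
  · rintro ⟨i, j, hij, hi, hj⟩
    exact ⟨-j, -i, by omega, by simpa using hj, by simpa using hi⟩

theorem Joins.mem_cyl_mul_mk_iff {γ : ℤ → FreeGroup E} {l : ℤ → E × Bool}
    {z : DoubleBoundary (Fin N)} (h : Γ.Joins γ l z) {p : FreeGroup E} {v : List (E × Bool)}
    (hv : FreeGroup.IsReduced v) :
    z ∈ Γ.cyl p (p * FreeGroup.mk v) ↔ ∃ i, γ i = p ∧ seg l i v.length = v := by
  rw [h.mem_cyl_iff]
  constructor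
  · rintro ⟨i, j, hij, rfl, hj⟩
    refine ⟨i, rfl, ?_⟩
    obtain ⟨n, rfl⟩ : ∃ n : ℕ, j = i + n := ⟨(j - i).toNat, by omega⟩
    rw [h.add_nat] at hj
    have := mk_injOn_isReduced (h.isReduced_seg i n) hv (mul_left_cancel hj)
    rw [← this, length_seg]
  · rintro ⟨i, rfl, hi⟩
    exact ⟨i, i + v.length, by omega, rfl, by rw [h.add_nat, hi]⟩

/-- Membership in a cylinder is a condition on finitely many letters of the two ends, seen from the
initial vertex of the cylinder. -/
theorem mem_cyl_mul_mk_iff_pre {z : DoubleBoundary (Fin N)} {p : FreeGroup E}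
    {v : List (E × Bool)} (hne : v ≠ []) (hv : FreeGroup.IsReduced v) :
    z ∈ Γ.cyl p (p * FreeGroup.mk v) ↔ (p⁻¹ • Γ.bdry z.1.2).pre v.length = v ∧
      (p⁻¹ • Γ.bdry z.1.1).1 0 ≠ v.head hne := by
  obtain ⟨γ, l, h⟩ := Γ.exists_joins z
  have hpre : ∀ i n, ((γ i)⁻¹ • Γ.bdry z.1.2).pre n = seg l i n := by
    intro i n
    simp only [Boundary.pre, seg, h.inv_smul_pos]
  have hhead : (p⁻¹ • Γ.bdry z.1.2).pre v.length = v →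
      (p⁻¹ • Γ.bdry z.1.2).1 0 = v.head hne := by
    intro e
    have hlen : 0 < v.length := List.length_pos_iff.mpr hne
    rw [← Boundary.getElem_pre _ v.length 0 (by rwa [Boundary.length_pre]),
      ← List.getElem_zero_eq_head hlen]
    simp only [e]
  rw [h.mem_cyl_mul_mk_iff hv]
  constructor
  · rintro ⟨i, rfl, hi⟩
    have e : ((γ i)⁻¹ • Γ.bdry z.1.2).pre v.length = v := (hpre i _).trans hi
    refine ⟨e, ?_⟩
    rw [← hhead e]
    exact (h.exists_eq_iff (γ i)).mp ⟨i, rfl⟩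
  · rintro ⟨e, hne'⟩
    rw [← hhead e] at hne'
    obtain ⟨i, rfl⟩ := (h.exists_eq_iff p).mpr hne'
    exact ⟨i, rfl, (hpre i _).symm.trans e⟩

end SimplicialChart

/-! ### Vague convergence tested on a basis of compact open sets -/

theorem exists_finite_subset_sUnion {X : Type*} [TopologicalSpace X] {K : Set X} (hK : IsCompact K)
    {𝒯 : Set (Set X)} (ho : ∀ C ∈ 𝒯, IsOpen C) (hc : K ⊆ ⋃₀ 𝒯) :
    ∃ T ⊆ 𝒯, T.Finite ∧ K ⊆ ⋃₀ T := by
  obtain ⟨T, hT, hTf, hKT⟩ := hK.elim_finite_subcover_image (c := id) ho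
    (by simpa only [id, ← Set.sUnion_eq_biUnion] using hc)
  exact ⟨T, hT, hTf, by rwa [Set.sUnion_eq_biUnion]⟩

/-- A basis of compact open sets which is closed under nonempty intersections. -/
structure IsCompactOpenPiBasis {X : Type*} [TopologicalSpace X] (𝒞 : Set (Set X)) : Prop where
  basis : TopologicalSpace.IsTopologicalBasis 𝒞
  pi : IsPiSystem 𝒞
  isCompact : ∀ C ∈ 𝒞, IsCompact C

/-- The vector space spanned by the indicator functions of the members of `𝒞`. -/
def stepFunctions {X : Type*} (𝒞 : Set (Set X)) : Submodule ℝ (X → ℝ) :=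
  Submodule.span ℝ ((fun C : Set X => C.indicator (1 : X → ℝ)) '' 𝒞)

section StepFunctions

variable {X : Type*} {𝒞 : Set (Set X)}

theorem indicator_mem_stepFunctions {C : Set X} (hC : C ∈ 𝒞) :
    C.indicator (1 : X → ℝ) ∈ stepFunctions 𝒞 :=
  Submodule.subset_span ⟨C, hC, rfl⟩

theorem indicator_stepFunctions (hpi : IsPiSystem 𝒞) {C : Set X} (hC : C ∈ 𝒞) {f : X → ℝ}
    (hf : f ∈ stepFunctions 𝒞) : C.indicator f ∈ stepFunctions 𝒞 := by
  induction hf using Submodule.span_induction with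
  | mem f hf =>
    obtain ⟨D, hD, rfl⟩ := hf
    simp only
    rw [Set.indicator_indicator]
    rcases Set.eq_empty_or_nonempty (C ∩ D) with h | h
    · rw [h, Set.indicator_empty]
      exact zero_mem _
    · exact indicator_mem_stepFunctions (hpi C hC D hD h)
  | zero =>
    rw [show C.indicator (0 : X → ℝ) = 0 from Set.indicator_zero' ..]
    exact zero_mem _
  | add f g _ _ hf hg =>
    rw [Set.indicator_add']
    exact add_mem hf hg
  | smul a f _ hf =>
    rw [show C.indicator (a • f) = a • C.indicator f from Set.indicator_const_smul C a f]
    exact Submodule.smul_mem _ a hf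

/-- A function which oscillates little on each of finitely many members of `𝒞` is uniformly close
to a step function on their union. -/
theorem exists_stepFunction_close (hpi : IsPiSystem 𝒞) (f : X → ℝ) (ε : ℝ) {T : Set (Set X)}
    (hT : T.Finite) (hT𝒞 : T ⊆ 𝒞) (hosc : ∀ C ∈ T, ∃ a, ∀ x ∈ C, |f x - a| ≤ ε) :
    ∃ g ∈ stepFunctions 𝒞, (∀ x ∈ ⋃₀ T, |f x - g x| ≤ ε) ∧ ∀ x ∉ ⋃₀ T, g x = 0 := by
  induction T, hT using Set.Finite.induction_on with
  | empty => exact ⟨0, zero_mem _, by simp, by simp⟩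
  | @insert C T _ _ ih =>
    obtain ⟨g, hg, h1, h2⟩ := ih ((Set.subset_insert C T).trans hT𝒞)
      fun D hD => hosc D (Set.mem_insert_of_mem C hD)
    obtain ⟨a, ha⟩ := hosc C (Set.mem_insert C T)
    have hC : C ∈ 𝒞 := hT𝒞 (Set.mem_insert C T)
    refine ⟨g - C.indicator g + a • C.indicator 1, add_mem (sub_mem hg
      (indicator_stepFunctions hpi hC hg)) (Submodule.smul_mem _ a
      (indicator_mem_stepFunctions hC)), ?_, ?_⟩
    · intro x hx
      rw [Set.sUnion_insert] at hx
      by_cases hxC : x ∈ C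
      · simpa [hxC] using ha x hxC
      · simpa [hxC] using h1 x (hx.resolve_left hxC)
    · intro x hx
      rw [Set.sUnion_insert, Set.mem_union, not_or] at hx
      simp [hx.1, h2 x hx.2]

theorem integrable_stepFunction [MeasurableSpace X] {μ : Measure X}
    (hmeas : ∀ C ∈ 𝒞, MeasurableSet C) (hfin : ∀ C ∈ 𝒞, μ C ≠ ∞) {f : X → ℝ}
    (hf : f ∈ stepFunctions 𝒞) : Integrable f μ := by
  induction hf using Submodule.span_induction with
  | mem f hf =>
    obtain ⟨C, hC, rfl⟩ := hf
    exact (integrable_indicator_iff (hmeas C hC)).mpr (integrableOn_const (hfin C hC))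
  | zero => exact integrable_zero _ _ _
  | add f g _ _ hf hg => exact hf.add hg
  | smul a f _ hf => exact hf.smul a

theorem exists_tendsto_integral_stepFunction [MeasurableSpace X] {ι : Type*} {F : Filter ι}
    {μ : ι → Measure X} (hmeas : ∀ C ∈ 𝒞, MeasurableSet C) (hfin : ∀ i, ∀ C ∈ 𝒞, μ i C ≠ ∞)
    {L : Set X → ℝ} (hL : ∀ C ∈ 𝒞, Tendsto (fun i => (μ i).real C) F (𝓝 (L C))) {f : X → ℝ}
    (hf : f ∈ stepFunctions 𝒞) :
    ∃ a, Tendsto (fun i => ∫ x, f x ∂(μ i)) F (𝓝 a) ∧ ∀ ν : Measure X, (∀ C ∈ 𝒞, ν C ≠ ∞) →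
      (∀ C ∈ 𝒞, ν.real C = L C) → ∫ x, f x ∂ν = a := by
  induction hf using Submodule.span_induction with
  | mem f hf =>
    obtain ⟨C, hC, rfl⟩ := hf
    simp only [integral_indicator_one (hmeas C hC)]
    exact ⟨L C, hL C hC, fun ν _ h => h C hC⟩
  | zero => exact ⟨0, by simpa using tendsto_const_nhds, by simp⟩
  | add f g hf hg ihf ihg =>
    obtain ⟨a, ha, ha'⟩ := ihf
    obtain ⟨b, hb, hb'⟩ := ihg
    have hadd : ∀ ν : Measure X, (∀ C ∈ 𝒞, ν C ≠ ∞) →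
        ∫ x, (f + g) x ∂ν = ∫ x, f x ∂ν + ∫ x, g x ∂ν := fun ν hν =>
      integral_add (integrable_stepFunction hmeas hν hf) (integrable_stepFunction hmeas hν hg)
    refine ⟨a + b, ?_, fun ν h1 h2 => by rw [hadd ν h1, ha' ν h1 h2, hb' ν h1 h2]⟩
    simp only [fun i => hadd (μ i) (hfin i)]
    exact ha.add hb
  | smul c f _ ih =>
    obtain ⟨a, ha, ha'⟩ := ih
    simp only [Pi.smul_apply, integral_smul]
    exact ⟨c • a, ha.const_smul c, fun ν h1 h2 => by rw [ha' ν h1 h2]⟩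

end StepFunctions

namespace IsCompactOpenPiBasis

variable {X : Type*} [TopologicalSpace X] {𝒞 : Set (Set X)}

theorem isOpen (h𝒞 : IsCompactOpenPiBasis 𝒞) {C : Set X} (hC : C ∈ 𝒞) : IsOpen C :=
  h𝒞.basis.isOpen hC

/-- Compactly supported continuous functions are uniform limits of step functions, with supports in
a fixed compact set. -/
theorem exists_stepFunction_approx (h𝒞 : IsCompactOpenPiBasis 𝒞) (f : C_c(X, ℝ)) :
    ∃ h ∈ stepFunctions 𝒞, ∀ ε > 0, ∃ g ∈ stepFunctions 𝒞, ∀ x, |f x - g x| ≤ ε * h x := by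
  have hK : IsCompact (tsupport f) := f.hasCompactSupport
  obtain ⟨T₀, hT₀, hfin₀, hcov₀⟩ := exists_finite_subset_sUnion hK (fun C hC => h𝒞.isOpen hC)
    (by rw [h𝒞.basis.sUnion_eq]; exact Set.subset_univ _)
  have hh0 : ∀ x, 0 ≤ ∑ C ∈ hfin₀.toFinset, C.indicator (1 : X → ℝ) x := fun x =>
    Finset.sum_nonneg fun C _ => Set.indicator_nonneg (fun _ _ => zero_le_one) x
  refine ⟨fun x => ∑ C ∈ hfin₀.toFinset, C.indicator (1 : X → ℝ) x, ?_, fun ε hε => ?_⟩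
  · have := Submodule.sum_mem (stepFunctions 𝒞) (t := hfin₀.toFinset)
      (f := fun C => C.indicator (1 : X → ℝ))
      fun C hC => indicator_mem_stepFunctions (hT₀ (hfin₀.mem_toFinset.mp hC))
    convert this using 1
    funext x
    simp
  let 𝒯 : Set (Set X) := {C | C ∈ 𝒞 ∧ (∃ D ∈ T₀, C ⊆ D) ∧ ∃ a, ∀ x ∈ C, |f x - a| ≤ ε}
  obtain ⟨T, hT, hfin, hcov⟩ := exists_finite_subset_sUnion (𝒯 := 𝒯) hK
    (fun C hC => h𝒞.isOpen hC.1) (by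
      intro x hx
      obtain ⟨D, hD, hxD⟩ := hcov₀ hx
      have hU : IsOpen (D ∩ {y | |f y - f x| < ε}) :=
        (h𝒞.isOpen (hT₀ hD)).inter (isOpen_lt ((f.continuous.sub continuous_const).abs)
          continuous_const)
      obtain ⟨C, hC, hxC, hCU⟩ := h𝒞.basis.exists_subset_of_mem_open
        (show x ∈ D ∩ {y | |f y - f x| < ε} from ⟨hxD, by simpa using hε⟩) hU
      exact ⟨C, ⟨hC, ⟨D, hD, fun y hy => (hCU hy).1⟩, f x, fun y hy => (hCU hy).2.le⟩, hxC⟩)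
  obtain ⟨g, hg, h1, h2⟩ := exists_stepFunction_close h𝒞.pi f ε hfin (fun C hC => (hT hC).1)
    fun C hC => (hT hC).2.2
  refine ⟨g, hg, fun x => ?_⟩
  by_cases hx : x ∈ ⋃₀ T
  · refine (h1 x hx).trans ?_
    obtain ⟨C, hC, hxC⟩ := hx
    obtain ⟨D, hD, hCD⟩ := (hT hC).2.1
    have : (1 : ℝ) ≤ ∑ C ∈ hfin₀.toFinset, C.indicator (1 : X → ℝ) x := by
      refine le_trans ?_ (Finset.single_le_sum (f := fun C : Set X => C.indicator (1 : X → ℝ) x)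
        (fun C _ => Set.indicator_nonneg (fun _ _ => zero_le_one) x) (hfin₀.mem_toFinset.mpr hD))
      simp [hCD hxC]
    exact le_mul_of_one_le_right hε.le this
  · have hfx : f x = 0 := image_eq_zero_of_notMem_tsupport fun h => hx (hcov h)
    rw [hfx, h2 x hx, sub_zero, abs_zero]
    exact mul_nonneg hε.le (hh0 x)

variable [MeasurableSpace X]

theorem isFiniteMeasureOnCompacts (h𝒞 : IsCompactOpenPiBasis 𝒞) {μ : Measure X}
    (hfin : ∀ C ∈ 𝒞, μ C ≠ ∞) :
    IsFiniteMeasureOnCompacts μ := by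
  refine ⟨fun K hK => ?_⟩
  obtain ⟨T, hT, hTf, hKT⟩ := exists_finite_subset_sUnion hK (fun C hC => h𝒞.isOpen hC)
    (by rw [h𝒞.basis.sUnion_eq]; exact Set.subset_univ _)
  refine (measure_mono hKT).trans_lt ?_
  rw [Set.sUnion_eq_biUnion]
  exact measure_biUnion_lt_top hTf fun C hC => (hfin C (hT hC)).lt_top

variable [BorelSpace X]

theorem measurableSet (h𝒞 : IsCompactOpenPiBasis 𝒞) {C : Set X} (hC : C ∈ 𝒞) :
    MeasurableSet C :=
  (h𝒞.isOpen hC).measurableSet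

theorem integrable (h𝒞 : IsCompactOpenPiBasis 𝒞) {μ : Measure X} (hfin : ∀ C ∈ 𝒞, μ C ≠ ∞)
    (f : C_c(X, ℝ)) :
    Integrable f μ := by
  have := h𝒞.isFiniteMeasureOnCompacts hfin
  exact f.continuous.integrable_of_hasCompactSupport f.hasCompactSupport

theorem abs_integral_sub_le (h𝒞 : IsCompactOpenPiBasis 𝒞) {μ : Measure X}
    (hfin : ∀ C ∈ 𝒞, μ C ≠ ∞) {f : C_c(X, ℝ)}
    {g h : X → ℝ} (hg : g ∈ stepFunctions 𝒞) (hh : h ∈ stepFunctions 𝒞) {ε : ℝ}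
    (hfg : ∀ x, |f x - g x| ≤ ε * h x) :
    |∫ x, f x ∂μ - ∫ x, g x ∂μ| ≤ ε * ∫ x, h x ∂μ := by
  have hif := h𝒞.integrable hfin f
  have hig := integrable_stepFunction (fun C hC => h𝒞.measurableSet hC) hfin hg
  have hih := integrable_stepFunction (fun C hC => h𝒞.measurableSet hC) hfin hh
  rw [← integral_sub hif hig, ← integral_const_mul]
  refine (abs_integral_le_integral_abs).trans ?_
  exact integral_mono (hif.sub hig).abs (hih.const_mul ε) hfg

variable {ι : Type*} {F : Filter ι} {μ : ι → Measure X}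

/-- Convergence on a π-system forming a basis of compact open sets implies vague convergence. -/
theorem tendsto_integral (h𝒞 : IsCompactOpenPiBasis 𝒞) (hfin : ∀ i, ∀ C ∈ 𝒞, μ i C ≠ ∞)
    {ν : Measure X}
    (hν : ∀ C ∈ 𝒞, ν C ≠ ∞)
    (hL : ∀ C ∈ 𝒞, Tendsto (fun i => (μ i).real C) F (𝓝 (ν.real C))) (f : C_c(X, ℝ)) :
    Tendsto (fun i => ∫ x, f x ∂(μ i)) F (𝓝 (∫ x, f x ∂ν)) := by
  have hmeas : ∀ C ∈ 𝒞, MeasurableSet C := fun C hC => h𝒞.measurableSet hC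
  obtain ⟨h, hh, happrox⟩ := h𝒞.exists_stepFunction_approx f
  have hstep : ∀ g ∈ stepFunctions 𝒞,
      Tendsto (fun i => ∫ x, g x ∂(μ i)) F (𝓝 (∫ x, g x ∂ν)) := by
    intro g hg
    obtain ⟨a, ha, ha'⟩ := exists_tendsto_integral_stepFunction hmeas hfin hL hg
    rwa [ha' ν hν fun C _ => rfl]
  rw [Metric.tendsto_nhds]
  intro ε hε
  set H := ∫ x, h x ∂ν
  have hη : 0 < ε / (2 * (|H| + 1) + 1) := by positivity
  set η := ε / (2 * (|H| + 1) + 1) with hηdef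
  have hηe : η * (2 * (|H| + 1) + 1) = ε := by
    rw [hηdef]
    field_simp
  obtain ⟨g, hg, hfg⟩ := happrox η hη
  have e1 := Metric.tendsto_nhds.mp (hstep g hg) η hη
  have e2 := Metric.tendsto_nhds.mp (hstep h hh) 1 one_pos
  filter_upwards [e1, e2] with i h1 h2
  rw [Real.dist_eq] at h1 h2 ⊢
  have h3 := h𝒞.abs_integral_sub_le (hfin i) hg hh hfg
  have h4 := h𝒞.abs_integral_sub_le hν hg hh hfg
  have h5 : ∫ x, h x ∂(μ i) < |H| + 1 := by
    have := (abs_lt.mp h2).2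
    have := le_abs_self H
    linarith
  have h6 : H < |H| + 1 := by
    have := le_abs_self H
    linarith
  have h7 := mul_lt_mul_of_pos_left h5 hη
  have h8 := mul_lt_mul_of_pos_left h6 hη
  rw [abs_le] at h3 h4
  rw [abs_lt] at h1 ⊢
  constructor <;> nlinarith [h3.1, h3.2, h4.1, h4.2, h1.1, h1.2]

/-- If the measures of all members of the basis converge, then the limits are the values of a
measure. This is the Riesz representation of the functional `f ↦ lim ∫ f dμ_i`. -/
theorem exists_measure [T2Space X] [LocallyCompactSpace X] [F.NeBot]
    (h𝒞 : IsCompactOpenPiBasis 𝒞)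
    (hfin : ∀ i, ∀ C ∈ 𝒞, μ i C ≠ ∞) {L : Set X → ℝ}
    (hL : ∀ C ∈ 𝒞, Tendsto (fun i => (μ i).real C) F (𝓝 (L C))) :
    ∃ ν : Measure X, ∀ C ∈ 𝒞, ν C = ENNReal.ofReal (L C) := by
  have hmeas : ∀ C ∈ 𝒞, MeasurableSet C := fun C hC => h𝒞.measurableSet hC
  -- The integrals are bounded, so that they converge along an ultrafilter.
  have hlim : ∀ f : C_c(X, ℝ), ∃ a,
      Tendsto (fun i => ∫ x, f x ∂(μ i)) (Ultrafilter.of F) (𝓝 a) := by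
    intro f
    obtain ⟨h, hh, happrox⟩ := h𝒞.exists_stepFunction_approx f
    obtain ⟨g, hg, hfg⟩ := happrox 1 one_pos
    obtain ⟨a, ha, -⟩ := exists_tendsto_integral_stepFunction hmeas hfin hL hg
    obtain ⟨b, hb, -⟩ := exists_tendsto_integral_stepFunction hmeas hfin hL hh
    have hev : ∀ᶠ i in (Ultrafilter.of F : Filter ι),
        ∫ x, f x ∂(μ i) ∈ Metric.closedBall (0 : ℝ) (|a| + |b| + 2) := by
      have e1 := Metric.tendsto_nhds.mp ha 1 one_pos
      have e2 := Metric.tendsto_nhds.mp hb 1 one_pos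
      filter_upwards [(e1.and e2).filter_mono (Ultrafilter.of_le F)] with i hi
      have h3 := h𝒞.abs_integral_sub_le (hfin i) hg hh hfg
      rw [Real.dist_eq, Real.dist_eq] at hi
      obtain ⟨h1, h2⟩ := hi
      rw [mem_closedBall_zero_iff, Real.norm_eq_abs, abs_le]
      rw [abs_le] at h3
      rw [abs_lt] at h1 h2
      have := le_abs_self a
      have := le_abs_self b
      have := neg_abs_le a
      constructor <;> linarith [h3.1, h3.2, h1.1, h1.2, h2.1, h2.2]
    obtain ⟨a, -, ha⟩ := (isCompact_closedBall (0 : ℝ) (|a| + |b| + 2)).ultrafilter_le_nhds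
      ((Ultrafilter.of F).map fun i => ∫ x, f x ∂(μ i)) (le_principal_iff.mpr hev)
    exact ⟨a, ha⟩
  choose Λ hΛ using hlim
  have hint : ∀ i f, Integrable (fun x => (f : C_c(X, ℝ)) x) (μ i) := fun i f =>
    h𝒞.integrable (hfin i) f
  let Λ' : C_c(X, ℝ) →ₚ[ℝ] ℝ := PositiveLinearMap.mk₀
    { toFun := Λ
      map_add' := fun f g => by
        refine tendsto_nhds_unique (hΛ (f + g)) ?_
        convert (hΛ f).add (hΛ g) using 2 with i
        exact integral_add (hint i f) (hint i g)
      map_smul' := fun c f => by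
        refine tendsto_nhds_unique (hΛ (c • f)) ?_
        convert (hΛ f).const_smul c using 2 with i
        · exact integral_smul c _
        · rfl }
    (fun f hf => ge_of_tendsto' (hΛ f) fun i => integral_nonneg hf)
  refine ⟨RealRMK.rieszMeasure Λ', fun C hC => ?_⟩
  let f : C_c(X, ℝ) := ⟨⟨C.indicator 1, continuous_one.indicator (by
      rw [(IsClopen.frontier_eq ⟨(h𝒞.isCompact C hC).isClosed, h𝒞.isOpen hC⟩)]
      simp)⟩,
    HasCompactSupport.intro (h𝒞.isCompact C hC) fun x hx => Set.indicator_of_notMem hx _⟩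
  have h1 : ∫ x, f x ∂(RealRMK.rieszMeasure Λ') = (RealRMK.rieszMeasure Λ').real C :=
    integral_indicator_one (hmeas C hC)
  rw [RealRMK.integral_rieszMeasure] at h1
  have h2 : Λ f = L C := by
    refine tendsto_nhds_unique (hΛ f) ?_
    refine ((hL C hC).mono_left (Ultrafilter.of_le F)).congr fun i => ?_
    exact (integral_indicator_one (hmeas C hC)).symm
  have h3 : (RealRMK.rieszMeasure Λ').real C = L C := h1.symm.trans h2
  rw [← h3, Measure.real, ENNReal.ofReal_toReal (h𝒞.isCompact C hC).measure_lt_top.ne]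

end IsCompactOpenPiBasis

/-! ### The topology of the boundary and of the double boundary -/

section BoundaryTopology

variable {α : Type*} [TopologicalSpace α]

namespace Boundary

theorem continuous_apply (i : ℕ) : Continuous fun x : Boundary α => x.1 i :=
  (_root_.continuous_apply i).comp continuous_subtype_val

instance [T2Space α] : T2Space (Boundary α) :=
  inferInstanceAs (T2Space {x : ℕ → α × Bool // ∀ n, x (n + 1) ≠ invLetter (x n)})

instance [SecondCountableTopology α] : SecondCountableTopology (Boundary α) :=
  (Topology.IsInducing.subtypeVal :
    Topology.IsInducing (Subtype.val : Boundary α → ℕ → α × Bool)).secondCountableTopology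

theorem exists_pre_subset {U : Set (Boundary α)} (hU : IsOpen U) {x : Boundary α} (hx : x ∈ U) :
    ∃ k, ∀ y : Boundary α, y.pre k = x.pre k → y ∈ U := by
  obtain ⟨W, hW, rfl⟩ := isOpen_induced_iff.mp hU
  obtain ⟨I, u, hu, hI⟩ := isOpen_pi_iff.mp hW x.1 hx
  obtain ⟨k, hk⟩ := I.bddAbove
  refine ⟨k + 1, fun y hy => hI fun i hi => ?_⟩
  rw [pre_eq_iff.mp hy i (Nat.lt_succ_of_le (hk hi))]
  exact (hu i hi).2

variable [DiscreteTopology α]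

theorem isOpen_setOf_pre_eq (x : Boundary α) (k : ℕ) :
    IsOpen {y : Boundary α | y.pre k = x.pre k} := by
  have : {y : Boundary α | y.pre k = x.pre k} = ⋂ i ∈ Finset.range k, {y | y.1 i = x.1 i} := by
    ext y
    simp [pre_eq_iff]
  rw [this]
  refine isOpen_biInter_finset fun i _ => ?_
  exact (isOpen_discrete {x.1 i}).preimage (continuous_apply i)

theorem isClopen_of_pre {B : Set (Boundary α × Boundary α)} {k : ℕ}
    (hB : ∀ z z' : Boundary α × Boundary α, z'.1.pre k = z.1.pre k → z'.2.pre k = z.2.pre k →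
      (z ∈ B ↔ z' ∈ B)) : IsClopen B := by
  have hopen : ∀ {B : Set (Boundary α × Boundary α)} {k : ℕ},
      (∀ z z' : Boundary α × Boundary α, z'.1.pre k = z.1.pre k → z'.2.pre k = z.2.pre k →
        (z ∈ B ↔ z' ∈ B)) → IsOpen B := by
    intro B k hB
    rw [isOpen_iff_mem_nhds]
    intro z hz
    refine mem_of_superset (((isOpen_setOf_pre_eq z.1 k).prod
      (isOpen_setOf_pre_eq z.2 k)).mem_nhds ⟨rfl, rfl⟩) ?_
    rintro z' ⟨h1, h2⟩
    exact (hB z z' h1 h2).mp hz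
  exact ⟨⟨hopen fun z z' h1 h2 => not_congr (hB z z' h1 h2)⟩, hopen hB⟩

instance [Finite α] : CompactSpace (Boundary α) := by
  have hclosed : IsClosed {x : ℕ → α × Bool | ∀ n, x (n + 1) ≠ invLetter (x n)} := by
    simp only [Set.ofPred_forall]
    refine isClosed_iInter fun n => ?_
    have : {x : ℕ → α × Bool | x (n + 1) ≠ invLetter (x n)} =
        (fun x : ℕ → α × Bool => (x (n + 1), x n)) ⁻¹' {q | q.1 ≠ invLetter q.2} := rfl
    rw [this]
    exact (isClosed_discrete _).preimage
      ((_root_.continuous_apply (n + 1)).prodMk (_root_.continuous_apply n))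
  exact isCompact_iff_compactSpace.mp hclosed.isCompact

end Boundary

namespace DoubleBoundary

theorem isEmbedding_val :
    Topology.IsEmbedding (Subtype.val : DoubleBoundary α → Boundary α × Boundary α) :=
  Topology.IsEmbedding.subtypeVal

instance [T2Space α] : T2Space (DoubleBoundary α) :=
  inferInstanceAs (T2Space {z : Boundary α × Boundary α // z.1 ≠ z.2})

instance [SecondCountableTopology α] : SecondCountableTopology (DoubleBoundary α) :=
  isEmbedding_val.isInducing.secondCountableTopology

instance [DiscreteTopology α] [Finite α] : LocallyCompactSpace (DoubleBoundary α) :=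
  (isOpen_ne_fun continuous_fst continuous_snd :
    IsOpen {z : Boundary α × Boundary α | z.1 ≠ z.2}).isOpenEmbedding_subtypeVal.locallyCompactSpace

theorem exists_pre_subset [DiscreteTopology α] {U : Set (DoubleBoundary α)} (hU : IsOpen U)
    {z : DoubleBoundary α} (hz : z ∈ U) : ∃ k, ∀ z' : DoubleBoundary α,
      z'.1.1.pre k = z.1.1.pre k → z'.1.2.pre k = z.1.2.pre k → z' ∈ U := by
  obtain ⟨W, hW, rfl⟩ := isOpen_induced_iff.mp hU
  obtain ⟨A, B, hA, hB, hzA, hzB, hAB⟩ := isOpen_prod_iff.mp hW z.1.1 z.1.2 hz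
  obtain ⟨k, hk⟩ := Boundary.exists_pre_subset hA hzA
  obtain ⟨m, hm⟩ := Boundary.exists_pre_subset hB hzB
  refine ⟨max k m, fun z' h1 h2 => hAB ⟨hk _ ?_, hm _ ?_⟩⟩
  · exact Boundary.pre_mono (le_max_left _ _) h1
  · exact Boundary.pre_mono (le_max_right _ _) h2

end DoubleBoundary

end BoundaryTopology

/-! ### Cylinders as a basis of the topology -/

namespace SimplicialChart

open OrientedGraph

variable {N : ℕ} {V E : Type*} [Fintype V] [Fintype E] [DecidableEq E] (Γ : SimplicialChart N V E)

theorem exists_pre_smul_bdry_eq (g : FreeGroup E) (K : ℕ) :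
    ∃ k, ∀ x y, x.pre k = y.pre k → (g • Γ.bdry x).pre K = (g • Γ.bdry y).pre K := by
  obtain ⟨k, hk⟩ := Γ.exists_pre_bdry_eq (K + g.norm)
  exact ⟨k, fun x y h => pre_smul_eq g (hk x y h)⟩

variable {Γ}

/-- A cylinder is the trace on `∂²F_N` of a clopen subset of `∂F_N × ∂F_N` disjoint from the
diagonal. -/
theorem exists_isClopen_cyl {p : FreeGroup E} {v : List (E × Bool)} (hne : v ≠ [])
    (hv : FreeGroup.IsReduced v) : ∃ B : Set (Boundary (Fin N) × Boundary (Fin N)), IsClopen B ∧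
      (∀ z ∈ B, z.1 ≠ z.2) ∧ Γ.cyl p (p * FreeGroup.mk v) = Subtype.val ⁻¹' B := by
  refine ⟨{z | (p⁻¹ • Γ.bdry z.2).pre v.length = v ∧ (p⁻¹ • Γ.bdry z.1).1 0 ≠ v.head hne},
    ?_, ?_, ?_⟩
  · obtain ⟨k, hk⟩ := Γ.exists_pre_smul_bdry_eq p⁻¹ v.length
    refine Boundary.isClopen_of_pre (k := k) fun z z' h1 h2 => ?_
    have e1 := hk _ _ h1
    have e2 := hk _ _ h2
    have e3 := Boundary.pre_eq_iff.mp e1 0 (List.length_pos_iff.mpr hne)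
    simp only [Set.mem_ofPred_eq, e2, e3]
  · rintro ⟨x, y⟩ ⟨h1, h2⟩ h
    simp only at h h1 h2
    subst h
    apply h2
    have hlen : 0 < v.length := List.length_pos_iff.mpr hne
    rw [← Boundary.getElem_pre _ v.length 0 (by rwa [Boundary.length_pre]),
      ← List.getElem_zero_eq_head hlen]
    simp only [h1]
  · ext z
    exact mem_cyl_mul_mk_iff_pre hne hv

variable (Γ) in
/-- The cylinders of the lifts of nontrivial reduced edge-paths. -/
def cylinders : Set (Set (DoubleBoundary (Fin N))) :=
  {C | ∃ u w v p, v ≠ [] ∧ Γ.IsPath u v w ∧ FreeGroup.IsReduced v ∧ Γ.IsLift u p ∧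
    C = Γ.cyl p (p * FreeGroup.mk v)}

theorem Joins.cyl_mem_cylinders {γ : ℤ → FreeGroup E} {l : ℤ → E × Bool}
    {z : DoubleBoundary (Fin N)} (h : Γ.Joins γ l z) {i j : ℤ} (hij : i < j) :
    Γ.cyl (γ i) (γ j) ∈ Γ.cylinders := by
  obtain ⟨n, rfl⟩ : ∃ n : ℕ, j = i + n := ⟨(j - i).toNat, by omega⟩
  obtain ⟨u, hu⟩ := h.exists_isLift i
  obtain ⟨w, hw⟩ := h.exists_isLift (i + n)
  refine ⟨u, w, seg l i n, γ i, ?_, ?_, h.isReduced_seg i n, hu, by rw [h.add_nat]⟩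
  · rw [← List.length_pos_iff, length_seg]
    omega
  · have := hu.isPath_toWord hw
    rwa [h.add_nat, inv_mul_cancel_left, (h.isReduced_seg i n).toWord_mk] at this

theorem isOpen_of_mem_cylinders {C : Set (DoubleBoundary (Fin N))} (hC : C ∈ Γ.cylinders) :
    IsOpen C := by
  obtain ⟨u, w, v, p, hne, -, hv, -, rfl⟩ := hC
  obtain ⟨B, hB, -, h⟩ := exists_isClopen_cyl (Γ := Γ) (p := p) hne hv
  rw [h]
  exact hB.isOpen.preimage DoubleBoundary.isEmbedding_val.continuous

theorem isCompact_of_mem_cylinders {C : Set (DoubleBoundary (Fin N))} (hC : C ∈ Γ.cylinders) :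
    IsCompact C := by
  obtain ⟨u, w, v, p, hne, -, hv, -, rfl⟩ := hC
  obtain ⟨B, hB, hd, h⟩ := exists_isClopen_cyl (Γ := Γ) (p := p) hne hv
  rw [h]
  refine (DoubleBoundary.isEmbedding_val.isInducing.isCompact_preimage_iff ?_).mpr
    hB.isClosed.isCompact
  intro z hz
  exact ⟨⟨z, hd z hz⟩, rfl⟩

variable (Γ) in
theorem isTopologicalBasis_cylinders : TopologicalSpace.IsTopologicalBasis Γ.cylinders := by
  refine TopologicalSpace.isTopologicalBasis_of_isOpen_of_nhds
    (fun C hC => isOpen_of_mem_cylinders hC) fun z U hz hU => ?_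
  obtain ⟨K, hK⟩ := DoubleBoundary.exists_pre_subset hU hz
  obtain ⟨k, hk⟩ := Γ.exists_pre_eq_of_bdry K
  obtain ⟨γ, l, h⟩ := Γ.exists_joins z
  set m := k + (γ 0).norm + 1
  refine ⟨Γ.cyl (γ (-m)) (γ m), h.cyl_mem_cylinders (by omega),
    h.mem_cyl_iff.mpr ⟨-m, m, by omega, rfl, rfl⟩, fun z' hz' => ?_⟩
  -- The line of `z'` contains the segment `γ [-m, m]`, so that both ends of `z'`, seen from
  -- `γ 0`, agree with those of `z` on `m` letters.
  obtain ⟨γ', l', h', hj'⟩ : ∃ γ' l', Γ.Joins γ' l' z' ∧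
      γ' (-m) = γ (-m) ∧ ∃ j, -(m : ℤ) ≤ j ∧ γ' j = γ m := by
    obtain ⟨γ', l', h'⟩ := Γ.exists_joins z'
    obtain ⟨i, j, hij, hi, hj⟩ := h'.mem_cyl_iff.mp hz'
    refine ⟨_, _, Connects.shift h' (i + m), by simpa using hi, j - i - m, by omega, ?_⟩
    simpa using hj
  obtain ⟨hi, j, hij, hj⟩ := hj'
  have hjm : j = m := by
    have h1 := h.norm_sub (-m) m
    have h2 := h'.norm_sub (-m) j
    rw [hi, hj, h1] at h2
    omega
  subst hjm
  have hseg : seg l (-m) (2 * m) = seg l' (-m) (2 * m) := by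
    have h1 := h.add_nat (-m) (2 * m)
    have h2 := h'.add_nat (-m) (2 * m)
    rw [show -(m : ℤ) + ((2 * m : ℕ) : ℤ) = m by push_cast; ring] at h1 h2
    rw [hi, hj, h1] at h2
    exact mk_injOn_isReduced (h.isReduced_seg _ _) (h'.isReduced_seg _ _) (mul_left_cancel h2)
  have hl : ∀ n : ℤ, -(m : ℤ) ≤ n → n < m → l n = l' n := by
    intro n h1 h2
    obtain ⟨a, rfl⟩ : ∃ a : ℕ, n = -m + a := ⟨(n + m).toNat, by omega⟩
    have h3 := congrFun (List.ofFn_injective hseg) ⟨a, by omega⟩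
    exact h3
  have h0 : γ' 0 = γ 0 := by
    have h1 := h.add_nat (-m) m
    have h2 := h'.add_nat (-m) m
    rw [neg_add_cancel] at h1 h2
    have h3 : seg l (-m) m = seg l' (-m) m :=
      congrArg List.ofFn (funext fun a => hl _ (by omega) (by omega))
    rw [h1, h2, hi, h3]
  have key : ∀ x x' : Boundary (Fin N),
      (∀ n < m, ((γ 0)⁻¹ • Γ.bdry x').1 n = ((γ 0)⁻¹ • Γ.bdry x).1 n) → x'.pre K = x.pre K := by
    intro x x' hx
    apply hk
    have h1 := pre_smul_eq (x := (γ 0)⁻¹ • Γ.bdry x') (y := (γ 0)⁻¹ • Γ.bdry x) (γ 0) (K := k)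
      (Boundary.pre_eq_iff.mpr fun n hn => hx n (by omega))
    simpa using h1
  refine hK z' (key _ _ fun n hn => ?_) (key _ _ fun n hn => ?_)
  · rw [h.inv_smul_neg, ← h0, h'.inv_smul_neg, hl _ (by omega) (by omega)]
  · rw [h.inv_smul_pos, ← h0, h'.inv_smul_pos, hl _ (by omega) (by omega)]

variable (Γ) in
/-- If two cylinders meet, then their segments lie on a common line, and their intersection is the
cylinder of the convex hull of the two segments. -/
theorem isPiSystem_cylinders : IsPiSystem Γ.cylinders := by
  rintro _ ⟨-, -, v, p, hv, -, hrv, -, rfl⟩ _ ⟨-, -, v', p', hv', -, hrv', -, rfl⟩ ⟨z, hz, hz'⟩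
  set q := p * FreeGroup.mk v with hq
  set q' := p' * FreeGroup.mk v' with hq'
  obtain ⟨γ, l, h⟩ := Γ.exists_joins z
  obtain ⟨i, j, hij, hi, hj⟩ := h.mem_cyl_iff.mp hz
  obtain ⟨i', j', hij', hi', hj'⟩ := h.mem_cyl_iff.mp hz'
  have hlt : i < j := by
    refine lt_of_le_of_ne hij ?_
    rintro rfl
    rw [← hj, ← hi, left_eq_mul] at hq
    apply hv
    rw [← hrv.toWord_mk, hq, FreeGroup.toWord_one]
  convert h.cyl_mem_cylinders (show min i i' < max j j' by omega) using 1
  ext y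
  obtain ⟨η, m, hy⟩ := Γ.exists_joins y
  rw [Set.mem_inter_iff, hy.mem_cyl_iff, hy.mem_cyl_iff, hy.mem_cyl_iff]
  -- All four vertices, in either line, have the same mutual distances.
  have hdist : ∀ {a b s t : ℤ}, η s = γ a → η t = γ b → (t - s).natAbs = (b - a).natAbs := by
    intro a b s t h1 h2
    rw [← hy.norm_sub, ← h.norm_sub, h1, h2]
  constructor
  · rintro ⟨⟨s, t, hst, hs, ht⟩, s', t', hst', hs', ht'⟩
    rw [← hi] at hs
    rw [← hj] at ht
    rw [← hi'] at hs'
    rw [← hj'] at ht'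
    have d1 := hdist hs ht
    have d2 := hdist hs hs'
    have d3 := hdist hs ht'
    have d4 := hdist ht hs'
    have d5 := hdist ht ht'
    have d6 := hdist hs' ht'
    rcases le_total i i' with h1 | h1 <;> rcases le_total j j' with h2 | h2
    · exact ⟨s, t', by omega, by rw [hs, min_eq_left h1], by rw [ht', max_eq_right h2]⟩
    · exact ⟨s, t, by omega, by rw [hs, min_eq_left h1], by rw [ht, max_eq_left h2]⟩
    · exact ⟨s', t', by omega, by rw [hs', min_eq_right h1], by rw [ht', max_eq_right h2]⟩
    · exact ⟨s', t, by omega, by rw [hs', min_eq_right h1], by rw [ht, max_eq_left h2]⟩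
  · rintro ⟨s, t, hst, hs, ht⟩
    have d := hdist hs ht
    have hsub : ∀ a b : ℤ, min i i' ≤ a → a ≤ b → b ≤ max j j' →
        ∃ c e, c ≤ e ∧ η c = γ a ∧ η e = γ b := by
      have hmid : ∀ a : ℤ, min i i' ≤ a → a ≤ max j j' → η (s + (a - min i i')) = γ a := by
        intro a h1 h2
        obtain ⟨n, hn⟩ : ∃ n : ℕ, a = min i i' + n := ⟨(a - min i i').toNat, by omega⟩
        obtain ⟨r, hr⟩ : ∃ r : ℕ, max j j' = min i i' + r :=
          ⟨(max j j' - min i i').toNat, by omega⟩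
        have htr : t = s + r := by omega
        have e1 := h.add_nat (min i i') r
        have e2 := hy.add_nat s r
        rw [← hr] at e1
        rw [← htr, hs, ht, e1] at e2
        have e3 := mk_injOn_isReduced (h.isReduced_seg _ _) (hy.isReduced_seg _ _)
          (mul_left_cancel e2)
        have e4 : seg m s n = seg l (min i i') n := by
          refine congrArg List.ofFn (funext fun c => ?_)
          have := congrFun (List.ofFn_injective e3) ⟨c, by omega⟩
          exact this.symm
        rw [show s + (a - min i i') = s + n by omega, hy.add_nat, hn, h.add_nat, e4, hs]
      intro a b h1 h2 h3
      exact ⟨_, _, by omega, hmid a h1 (h2.trans h3), hmid b (h1.trans h2) h3⟩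
    have h1 := hsub i j (min_le_left _ _) hij (le_max_left _ _)
    have h2 := hsub i' j' (min_le_right _ _) hij' (le_max_right _ _)
    rw [hi, hj] at h1
    rw [hi', hj'] at h2
    exact ⟨h1, h2⟩

variable (Γ) in
theorem isCompactOpenPiBasis_cylinders : IsCompactOpenPiBasis Γ.cylinders :=
  ⟨Γ.isTopologicalBasis_cylinders, Γ.isPiSystem_cylinders,
    fun _ hC => isCompact_of_mem_cylinders hC⟩

variable (Γ) in
theorem countable_cylinders : Γ.cylinders.Countable := by
  refine (Set.countable_range fun L : List (E × Bool) × List (E × Bool) =>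
    Γ.cyl (FreeGroup.mk L.1) (FreeGroup.mk L.1 * FreeGroup.mk L.2)).mono ?_
  rintro _ ⟨-, -, v, p, -, -, -, -, rfl⟩
  exact ⟨(p.toWord, v), by simp only [FreeGroup.mk_toWord]⟩

/-- A measure on the double boundary is determined by its values on cylinders. -/
theorem measure_ext {μ ν : Measure (DoubleBoundary (Fin N))} (hfin : ∀ C ∈ Γ.cylinders, μ C ≠ ∞)
    (h : ∀ C ∈ Γ.cylinders, μ C = ν C) : μ = ν := by
  refine Measure.ext_of_generateFrom_of_cover_subset (S := Γ.cylinders) (T := Γ.cylinders) ?_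
    Γ.isPiSystem_cylinders subset_rfl Γ.countable_cylinders
    Γ.isTopologicalBasis_cylinders.sUnion_eq hfin h
  exact Γ.isTopologicalBasis_cylinders.borel_eq_generateFrom

/-! ### Currents from measures of cylinders -/

theorem continuous_act (g : FreeGroup (Fin N)) :
    Continuous (DoubleBoundary.act g : DoubleBoundary (Fin N) → DoubleBoundary (Fin N)) := by
  have hc : Continuous fun x : Boundary (Fin N) => g • x := by
    rw [continuous_def]
    intro U hU
    rw [isOpen_iff_mem_nhds]
    intro x hx
    obtain ⟨k, hk⟩ := Boundary.exists_pre_subset hU hx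
    refine mem_of_superset ((Boundary.isOpen_setOf_pre_eq x (k + g.norm)).mem_nhds rfl) ?_
    intro y hy
    exact hk _ (pre_smul_eq g hy)
  exact Continuous.subtype_mk ((hc.comp (continuous_fst.comp continuous_subtype_val)).prodMk
    (hc.comp (continuous_snd.comp continuous_subtype_val))) _

theorem continuous_flip :
    Continuous (DoubleBoundary.flip : DoubleBoundary (Fin N) → DoubleBoundary (Fin N)) :=
  Continuous.subtype_mk ((continuous_snd.comp continuous_subtype_val).prodMk
    (continuous_fst.comp continuous_subtype_val)) _

variable (Γ) in
/-- A measure whose value on a cylinder is finite and depends only on the projected edge-path, not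
on its direction, is a geodesic current. -/
theorem exists_current {m : Measure (DoubleBoundary (Fin N))} (c : List (E × Bool) → ℝ≥0∞)
    (hm : ∀ (u w : V) (v : List (E × Bool)) (p : FreeGroup E), v ≠ [] → Γ.IsPath u v w →
      FreeGroup.IsReduced v → Γ.IsLift u p → m (Γ.cyl p (p * FreeGroup.mk v)) = c v)
    (hfin : ∀ v, c v ≠ ∞) (hinv : ∀ v, c (FreeGroup.invRev v) = c v) :
    ∃ ν : GeodesicCurrent N, ν.toMeasure = m := by
  have hfin' : ∀ C ∈ Γ.cylinders, m C ≠ ∞ := by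
    rintro _ ⟨u, w, v, p, hne, hp, hv, hl, rfl⟩
    rw [hm u w v p hne hp hv hl]
    exact hfin v
  refine ⟨⟨m, ?_, ?_, ?_⟩, rfl⟩
  · intro K hK
    have := Γ.isCompactOpenPiBasis_cylinders.isFiniteMeasureOnCompacts hfin'
    exact hK.measure_lt_top
  · intro g B hB
    have hmeas := (continuous_act g).measurable
    rw [← Measure.map_apply hmeas hB]
    congr 1
    refine (measure_ext (Γ := Γ) hfin' ?_).symm
    rintro _ ⟨u, w, v, p, hne, hp, hv, hl, rfl⟩
    rw [Measure.map_apply hmeas (isOpen_of_mem_cylinders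
      ⟨u, w, v, p, hne, hp, hv, hl, rfl⟩).measurableSet]
    have hpre : DoubleBoundary.act g ⁻¹' Γ.cyl p (p * FreeGroup.mk v) =
        Γ.cyl (Γ.markingHom g⁻¹ * p) (Γ.markingHom g⁻¹ * p * FreeGroup.mk v) := by
      ext z
      rw [Set.mem_preimage, act_mem_cyl_iff, map_inv, mul_assoc]
    rw [hpre, hm u w v p hne hp hv hl, hm u w v _ hne hp hv (hl.markingHom_mul g⁻¹)]
  · intro B hB
    have hmeas := (continuous_flip (N := N)).measurable
    rw [← Measure.map_apply hmeas hB]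
    congr 1
    refine (measure_ext (Γ := Γ) hfin' ?_).symm
    rintro _ ⟨u, w, v, p, hne, hp, hv, hl, rfl⟩
    rw [Measure.map_apply hmeas (isOpen_of_mem_cylinders
      ⟨u, w, v, p, hne, hp, hv, hl, rfl⟩).measurableSet]
    have hpre : DoubleBoundary.flip ⁻¹' Γ.cyl p (p * FreeGroup.mk v) =
        Γ.cyl (p * FreeGroup.mk v)
          (p * FreeGroup.mk v * FreeGroup.mk (FreeGroup.invRev v)) := by
      ext z
      rw [Set.mem_preimage, flip_mem_cyl_iff, ← FreeGroup.inv_mk, mul_inv_cancel_right]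
    rw [hpre, hm u w v p hne hp hv hl, hm w u _ _ (by simpa [FreeGroup.invRev] using hne)
      hp.invRev hv.invRev (hl.mul_mk hp), hinv]

end SimplicialChart

/-! ### Counting currents and occurrences in cyclic words -/

/-- The periodic bi-infinite sequence of letters obtained by repeating the word `w`. -/
def periodicLabel {β : Type*} (w : List β) (hw : w ≠ []) (n : ℤ) : β :=
  w[(n % w.length).toNat]'(by
    have h0 : 0 < w.length := List.length_pos_iff.mpr hw
    have h1 := Int.emod_nonneg n (show (w.length : ℤ) ≠ 0 by omega)
    have h2 := Int.emod_lt_of_pos n (show (0 : ℤ) < w.length by omega)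
    omega)

theorem periodicLabel_add_mul {β : Type*} (w : List β) (hw : w ≠ []) (n m : ℤ) :
    periodicLabel w hw (n + m * w.length) = periodicLabel w hw n := by
  simp only [periodicLabel, Int.add_mul_emod_self_right]

theorem periodicLabel_of_lt {β : Type*} (w : List β) (hw : w ≠ []) (n : ℕ) (hn : n < w.length) :
    periodicLabel w hw n = w[n] := by
  have : ((n : ℤ) % w.length).toNat = n := by
    rw [Int.emod_eq_of_lt (by omega) (by omega)]
    simp
  simp only [periodicLabel, this]

theorem seg_periodicLabel_add_mul {α : Type*} (w : List (α × Bool)) (hw : w ≠ []) (i m : ℤ)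
    (n : ℕ) : seg (periodicLabel w hw) (i + m * w.length) n = seg (periodicLabel w hw) i n := by
  refine congrArg List.ofFn (funext fun j => ?_)
  rw [add_right_comm, periodicLabel_add_mul]

theorem seg_periodicLabel_self {α : Type*} (w : List (α × Bool)) (hw : w ≠ []) :
    seg (periodicLabel w hw) 0 w.length = w := by
  apply List.ext_getElem
  · rw [length_seg]
  · intro i h1 h2
    simp only [seg, List.getElem_ofFn, zero_add]
    exact periodicLabel_of_lt w hw i h2

/-- The number of positions modulo `|w|` at which the word `v` is read in the cyclic word `w`. The
word `v` may be longer than `w`. -/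
def cyclicCount {α : Type*} [DecidableEq α] (w : List (α × Bool)) (hw : w ≠ [])
    (v : List (α × Bool)) : ℕ :=
  ((Finset.range w.length).filter fun i : ℕ => seg (periodicLabel w hw) i v.length = v).card

namespace SimplicialChart

open OrientedGraph

variable {N : ℕ} {V E : Type*} [Fintype V] [Fintype E] {Γ : SimplicialChart N V E}

/-- Sequences in `F_N` whose images converge to an end of the tree converge in `∂F_N`. -/
theorem exists_tendstoBoundary_of_markingHom [DecidableEq E] {u : ℕ → FreeGroup (Fin N)}
    {ζ : Boundary E}
    (h : TendstoBoundary (fun n => Γ.markingHom (u n)) ζ) :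
    ∃ x, TendstoBoundary u x ∧ Γ.bdry x = ζ := by
  suffices ∃ x, TendstoBoundary u x by
    obtain ⟨x, hx⟩ := this
    exact ⟨x, hx, (Γ.tendsto_bdry hx).unique h⟩
  apply exists_tendstoBoundary
  intro K
  obtain ⟨k, hk⟩ := Γ.exists_prefixAgree_of_markingHom K
  have h1 := tendstoBoundary_iff_prefixAgree.mp h k
  obtain ⟨m, hm⟩ := h1.exists
  refine ⟨u m, ?_⟩
  filter_upwards [h1] with n hn
  exact hk _ _ (hm.symm.trans hn)

variable (Γ) in
/-- The element `g` acts on the tree as a translation along the line through `d` whose labels are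
the repetitions of the cyclically reduced word `w`. -/
structure IsAxis (g : FreeGroup (Fin N)) (d : FreeGroup E) (w : List (E × Bool)) (hw : w ≠ []) :
    Prop where
  red : ∀ n, periodicLabel w hw (n + 1) ≠ invLetter (periodicLabel w hw n)
  conj : Γ.markingHom g = d * FreeGroup.mk w * d⁻¹

namespace IsAxis

variable {g : FreeGroup (Fin N)} {d : FreeGroup E} {w : List (E × Bool)} {hw : w ≠ []}

/-- The vertices of the axis of `g`. -/
abbrev line (_ : Γ.IsAxis g d w hw) (n : ℤ) : FreeGroup E := d * lineOf (periodicLabel w hw) n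

theorem isGeodLine (h : Γ.IsAxis g d w hw) : IsGeodLine h.line (periodicLabel w hw) :=
  (isGeodLine_lineOf h.red).mul_left d

theorem line_zero (h : Γ.IsAxis g d w hw) : h.line 0 = d := by
  simp [line, lineOf_zero]

theorem line_add_length (h : Γ.IsAxis g d w hw) (n : ℤ) :
    h.line (n + w.length) = Γ.markingHom g * h.line n := by
  have h1 := h.isGeodLine.shift w.length
  have h2 : (fun n : ℤ => periodicLabel w hw (n + w.length)) = periodicLabel w hw := by
    funext n
    have := periodicLabel_add_mul w hw n 1
    rwa [one_mul] at this
  rw [h2] at h1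
  refine h1.eq_of_eq (h.isGeodLine.mul_left (Γ.markingHom g)) ?_ n
  rw [h.isGeodLine.add_nat, seg_periodicLabel_self, h.line_zero, h.conj, inv_mul_cancel_right]

theorem line_add_mul_length (h : Γ.IsAxis g d w hw) (n m : ℤ) :
    h.line (n + m * w.length) = Γ.markingHom (g ^ m) * h.line n := by
  induction m with
  | zero => simp
  | succ m ih =>
    rw [add_one_mul, ← add_assoc, line_add_length, ih, ← mul_assoc, ← map_mul, ← zpow_one_add,
      add_comm]
  | pred m ih =>
    have := h.line_add_length (n + (-(m : ℤ) - 1) * w.length)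
    rw [show n + (-(m : ℤ) - 1) * w.length + w.length = n + -m * w.length by ring, ih] at this
    apply mul_left_cancel (a := Γ.markingHom g)
    rw [← this, ← mul_assoc (Γ.markingHom g), ← map_mul, ← zpow_one_add, add_sub_cancel]

variable [DecidableEq E]

/-- The poles of `g` are the ends of its axis. -/
theorem exists_isPoles (h : Γ.IsAxis g d w hw) :
    ∃ z, IsPoles g z ∧ Γ.Joins h.line (periodicLabel w hw) z := by
  have h0 : 0 < w.length := List.length_pos_iff.mpr hw
  have hpos := h.isGeodLine.tendsto_ray 0
  have hneg := h.isGeodLine.rev.tendsto_ray 0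
  simp only [zero_add] at hpos hneg
  have ha : Tendsto (fun n : ℕ => n * w.length) atTop atTop :=
    tendsto_id.atTop_mul_const' h0
  have h1 := (hpos.comp ha).mul_right d⁻¹
  have h2 := (hneg.comp ha).mul_right d⁻¹
  have e1 : ∀ n : ℕ, h.line ((n * w.length : ℕ) : ℤ) * d⁻¹ = Γ.markingHom (g ^ n) := by
    intro n
    have := h.line_add_mul_length 0 n
    rw [zero_add, h.line_zero, zpow_natCast] at this
    push_cast
    rw [this, mul_inv_cancel_right]
  have e2 : ∀ n : ℕ, h.line (-((n * w.length : ℕ) : ℤ)) * d⁻¹ = Γ.markingHom (g⁻¹ ^ n) := by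
    intro n
    have := h.line_add_mul_length 0 (-n)
    rw [zero_add, h.line_zero, zpow_neg, zpow_natCast, ← inv_pow] at this
    push_cast
    rw [← neg_mul, this, mul_inv_cancel_right]
  simp only [e1] at h1
  simp only [e2] at h2
  obtain ⟨y, hy, hy'⟩ := exists_tendstoBoundary_of_markingHom h1
  obtain ⟨x, hx, hx'⟩ := exists_tendstoBoundary_of_markingHom h2
  have hc : Connects h.line (periodicLabel w hw) (Γ.bdry x) (Γ.bdry y) :=
    ⟨h.isGeodLine, by rw [hx']; exact hneg, by rw [hy']; exact hpos⟩
  exact ⟨⟨(x, y), fun e => hc.ne (congrArg Γ.bdry e)⟩, ⟨hx, hy⟩, hc⟩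

theorem ne_one (h : Γ.IsAxis g d w hw) : g ≠ 1 := by
  rintro rfl
  have h0 : 0 < w.length := List.length_pos_iff.mpr hw
  have h1 := h.line_add_length 0
  rw [map_one, one_mul] at h1
  have := h.isGeodLine.injective h1
  omega

/-- The translates of the axis running through a given lift of an edge-path correspond to the
occurrences of this path in the cyclic word. -/
theorem encard_act_mem_cyl (h : Γ.IsAxis g d w hw) {z : DoubleBoundary (Fin N)}
    (hz : Γ.Joins h.line (periodicLabel w hw) z) {u u' : V} {v : List (E × Bool)}
    {p : FreeGroup E} (hne : v ≠ []) (hpath : Γ.IsPath u v u') (hv : FreeGroup.IsReduced v)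
    (hp : Γ.IsLift u p) :
    {c : FreeGroup (Fin N) ⧸ Subgroup.zpowers g |
      DoubleBoundary.act c.out z ∈ Γ.cyl p (p * FreeGroup.mk v)}.encard =
      cyclicCount w hw v := by
  set l := periodicLabel w hw with hl
  have h0 : 0 < w.length := List.length_pos_iff.mpr hw
  have hmem : ∀ x : FreeGroup (Fin N), DoubleBoundary.act x z ∈ Γ.cyl p (p * FreeGroup.mk v) ↔
      ∃ i, Γ.markingHom x * h.line i = p ∧ seg l i v.length = v :=
    fun x => (hz.act x).mem_cyl_mul_mk_iff hv
  have hlift : ∀ i, seg l i v.length = v → Γ.IsLift u (h.line i) := by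
    intro i hi
    obtain ⟨a, ha⟩ := hz.exists_isLift i
    obtain ⟨b, hb⟩ := hz.exists_isLift (i + v.length)
    have h1 := ha.isPath_toWord hb
    rw [h.isGeodLine.add_nat, inv_mul_cancel_left, hi, hv.toWord_mk] at h1
    obtain ⟨e, v, rfl⟩ := List.exists_cons_of_ne_nil hne
    rw [← hpath.1, h1.1]
    exact ha
  have hex : ∀ i : ℕ, ∃ x, seg l i v.length = v → Γ.markingHom x * h.line i = p := by
    intro i
    by_cases hi : seg l i v.length = v
    · obtain ⟨x, hx⟩ := (hlift i hi).exists_markingHom_mul_eq hp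
      exact ⟨x, fun _ => hx⟩
    · exact ⟨1, fun h => absurd h hi⟩
  choose x hx using hex
  have himage : {c : FreeGroup (Fin N) ⧸ Subgroup.zpowers g |
      DoubleBoundary.act c.out z ∈ Γ.cyl p (p * FreeGroup.mk v)} =
      (fun i : ℕ => (x i : FreeGroup (Fin N) ⧸ Subgroup.zpowers g)) ''
        ((Finset.range w.length).filter fun i : ℕ => seg l i v.length = v) := by
    ext c
    simp only [Set.mem_ofPred_eq, Set.mem_image, Finset.coe_filter, Finset.mem_range, hmem]
    constructor
    · rintro ⟨j, hj, hs⟩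
      have hr0 := Int.emod_nonneg j (show (w.length : ℤ) ≠ 0 by omega)
      have hr1 := Int.emod_lt_of_pos j (show (0 : ℤ) < w.length by omega)
      obtain ⟨r, hr⟩ : ∃ r : ℕ, (r : ℤ) = j % w.length := ⟨(j % w.length).toNat, by omega⟩
      have hjr : j = r + j / w.length * w.length := by
        rw [hr, mul_comm, Int.emod_add_mul_ediv]
      rw [hjr, hl, seg_periodicLabel_add_mul, ← hl] at hs
      refine ⟨r, ⟨by omega, hs⟩, ?_⟩
      rw [hjr, h.line_add_mul_length, ← mul_assoc, ← map_mul, ← hx r hs] at hj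
      have := Γ.markingHom_injective (mul_right_cancel hj)
      rw [← this]
      conv_rhs => rw [← QuotientGroup.out_eq' c]
      rw [eq_comm, QuotientGroup.eq, inv_mul_cancel_left]
      exact Subgroup.zpow_mem_zpowers g _
    · rintro ⟨i, ⟨hi, hs⟩, rfl⟩
      obtain ⟨⟨_, m, rfl⟩, hm⟩ := QuotientGroup.mk_out_eq_mul (Subgroup.zpowers g) (x i)
      refine ⟨i + -m * w.length, ?_, ?_⟩
      · rw [hm, h.line_add_mul_length, ← mul_assoc, ← map_mul]
        simp only [zpow_neg, mul_inv_cancel_right]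
        exact hx i hs
      · rw [hl, seg_periodicLabel_add_mul, ← hl, hs]
  rw [himage, Set.InjOn.encard_image, Set.encard_coe_eq_coe_finsetCard]
  · rfl
  · intro i hi j hj hij
    simp only [Finset.coe_filter, Finset.mem_range, Set.mem_ofPred_eq] at hi hj
    simp only at hij
    rw [QuotientGroup.eq] at hij
    obtain ⟨m, hm⟩ := hij
    simp only at hm
    rw [eq_inv_mul_iff_mul_eq] at hm
    have h1 := hx i hi.2
    have h2 := hx j hj.2
    rw [← hm, map_mul, mul_assoc, ← h.line_add_mul_length, ← h1] at h2
    have h3 := h.isGeodLine.injective (mul_left_cancel h2)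
    have h4 : (i : ℤ) % w.length = (j : ℤ) % w.length := by
      rw [← h3, Int.add_mul_emod_self_right]
    rw [Int.emod_eq_of_lt (by omega) (by omega), Int.emod_eq_of_lt (by omega) (by omega)] at h4
    exact_mod_cast h4

/-- The counting measure of the cylinder of a path `v` is the number of occurrences of `v` and of
its inverse in the cyclic word read along the axis. -/
theorem countingMeasure_cyl (h : Γ.IsAxis g d w hw) {u u' : V} {v : List (E × Bool)}
    {p : FreeGroup E} (hne : v ≠ []) (hpath : Γ.IsPath u v u') (hv : FreeGroup.IsReduced v)
    (hp : Γ.IsLift u p) :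
    countingMeasure g (Γ.cyl p (p * FreeGroup.mk v)) =
      ((cyclicCount w hw v + cyclicCount w hw (FreeGroup.invRev v) : ℕ) : ℝ≥0∞) := by
  obtain ⟨z, hz, hzj⟩ := h.exists_isPoles
  let _ : Unique {z : DoubleBoundary (Fin N) // IsPoles g z} :=
    ⟨⟨⟨z, hz⟩⟩, fun z' => Subtype.ext (Subtype.ext (Prod.ext
      (z'.2.1.unique hz.1) (z'.2.2.unique hz.2)))⟩
  have hdef : (default : {z : DoubleBoundary (Fin N) // IsPoles g z}).1 = z := rfl
  set C := Γ.cyl p (p * FreeGroup.mk v) with hCdef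
  have hC : MeasurableSet C :=
    (isOpen_of_mem_cylinders ⟨u, u', v, p, hne, hpath, hv, hp, rfl⟩).measurableSet
  have h1 := h.encard_act_mem_cyl hzj hne hpath hv hp
  have h2 := h.encard_act_mem_cyl hzj (v := FreeGroup.invRev v)
    (by simpa [FreeGroup.invRev] using hne) hpath.invRev hv.invRev (hp.mul_mk hpath)
  rw [← FreeGroup.inv_mk, mul_inv_cancel_right] at h2
  have hflip : ∀ x : FreeGroup (Fin N), DoubleBoundary.act x z.flip ∈ C ↔
      DoubleBoundary.act x z ∈ Γ.cyl (p * FreeGroup.mk v) p :=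
    fun x => flip_mem_cyl_iff (z := DoubleBoundary.act x z)
  have hsum : ∀ A : Set (FreeGroup (Fin N) ⧸ Subgroup.zpowers g),
      ∑' c, A.indicator (1 : FreeGroup (Fin N) ⧸ Subgroup.zpowers g → ℝ≥0∞) c =
        (A.encard : ℝ≥0∞) := by
    intro A
    rw [← tsum_subtype]
    exact ENNReal.tsum_set_one A
  have hdirac : ∀ y : DoubleBoundary (Fin N), Measure.dirac y C = C.indicator 1 y :=
    fun y => Measure.dirac_apply' y hC
  calc countingMeasure g C
      = ∑' c : FreeGroup (Fin N) ⧸ Subgroup.zpowers g,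
          (C.indicator (1 : DoubleBoundary (Fin N) → ℝ≥0∞) (DoubleBoundary.act c.out z) +
            C.indicator 1 (DoubleBoundary.act c.out z.flip)) := by
        rw [countingMeasure, Measure.sum_apply _ hC]
        refine tsum_congr fun c => ?_
        rw [Measure.sum_apply _ hC,
          tsum_eq_single default (fun b hb => absurd (Unique.eq_default b) hb), hdef,
          Measure.add_apply, hdirac, hdirac]
    _ = ∑' c, {c : FreeGroup (Fin N) ⧸ Subgroup.zpowers g |
            DoubleBoundary.act c.out z ∈ C}.indicator
              (1 : FreeGroup (Fin N) ⧸ Subgroup.zpowers g → ℝ≥0∞) c +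
          ∑' c, {c : FreeGroup (Fin N) ⧸ Subgroup.zpowers g |
            DoubleBoundary.act c.out z ∈ Γ.cyl (p * FreeGroup.mk v) p}.indicator 1 c := by
        rw [← ENNReal.tsum_add]
        refine tsum_congr fun c => ?_
        congr 1
        by_cases hc : DoubleBoundary.act c.out z ∈ Γ.cyl (p * FreeGroup.mk v) p
        · rw [Set.indicator_of_mem ((hflip _).mpr hc), Set.indicator_of_mem (by exact hc)]
          rfl
        · rw [Set.indicator_of_notMem fun h => hc ((hflip _).mp h),
            Set.indicator_of_notMem (by exact hc)]
    _ = _ := by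
        rw [hsum, hsum, h1, h2]
        simp

end IsAxis

end SimplicialChart

/-! ### A strong law of large numbers for bounded orthogonal variables -/

section Orthogonal

variable {Ω : Type*} [MeasurableSpace Ω] {P : Measure Ω} [IsProbabilityMeasure P] {D : ℕ → Ω → ℝ}

/-- The second moment of a sum of `n` bounded orthogonal variables grows at most linearly. -/
theorem integral_sq_sum_le (hm : ∀ i, Measurable (D i)) (hb : ∀ i ω, |D i ω| ≤ 1)
    (ho : ∀ i j, i < j → ∫ ω, D i ω * D j ω ∂P = 0) (n : ℕ) :
    Integrable (fun ω => (∑ i ∈ Finset.range n, D i ω) ^ 2) P ∧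
      ∫ ω, (∑ i ∈ Finset.range n, D i ω) ^ 2 ∂P ≤ n := by
  have hD : ∀ i j, Integrable (fun ω => D i ω * D j ω) P := by
    intro i j
    refine Integrable.of_bound ((hm i).mul (hm j)).aestronglyMeasurable 1 (ae_of_all _ fun ω => ?_)
    rw [Real.norm_eq_abs, abs_mul]
    exact mul_le_one₀ (hb i ω) (abs_nonneg _) (hb j ω)
  induction n with
  | zero => simp
  | succ n ih =>
    have hcross : Integrable (fun ω => ∑ i ∈ Finset.range n, D i ω * D n ω) P :=
      integrable_finsetSum _ fun i _ => hD i n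
    have hsq : Integrable (fun ω => D n ω * D n ω) P := hD n n
    have heq : (fun ω => (∑ i ∈ Finset.range (n + 1), D i ω) ^ 2) = fun ω =>
        (∑ i ∈ Finset.range n, D i ω) ^ 2 + (2 * ∑ i ∈ Finset.range n, D i ω * D n ω +
          D n ω * D n ω) := by
      funext ω
      rw [Finset.sum_range_succ, ← Finset.sum_mul]
      ring
    have hcross2 := hcross.const_mul 2
    have hrest : Integrable (fun ω => 2 * ∑ i ∈ Finset.range n, D i ω * D n ω + D n ω * D n ω) P :=
      hcross2.add hsq
    rw [heq]
    refine ⟨ih.1.add hrest, ?_⟩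
    rw [integral_add ih.1 hrest, integral_add hcross2 hsq, integral_const_mul,
      integral_finsetSum _ fun i _ => hD i n,
      Finset.sum_eq_zero fun i hi => ho i n (Finset.mem_range.mp hi)]
    have h1 : ∫ ω, D n ω * D n ω ∂P ≤ ∫ _, (1 : ℝ) ∂P := by
      refine integral_mono hsq (integrable_const 1) fun ω => ?_
      have := mul_le_one₀ (hb n ω) (abs_nonneg _) (hb n ω)
      rwa [abs_mul_abs_self] at this
    rw [integral_const, probReal_univ, one_smul] at h1
    push_cast
    linarith [ih.2]

/-- The averages of a bounded sequence vary little between consecutive squares, so that convergence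
along the squares suffices. -/
theorem tendsto_sum_div_of_tendsto_sq {a : ℕ → ℝ} (hb : ∀ i, |a i| ≤ 1)
    (h : Tendsto (fun j : ℕ => (∑ i ∈ Finset.range ((j + 1) ^ 2), a i) / ((j + 1 : ℕ) : ℝ) ^ 2)
      atTop (𝓝 0)) :
    Tendsto (fun n : ℕ => (∑ i ∈ Finset.range n, a i) / n) atTop (𝓝 0) := by
  have h1 : Tendsto (fun j : ℕ => (∑ i ∈ Finset.range (j ^ 2), a i) / (j : ℝ) ^ 2) atTop (𝓝 0) :=
    (tendsto_add_atTop_iff_nat 1).mp h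
  have hsqrt : Tendsto Nat.sqrt atTop atTop :=
    tendsto_atTop.mpr fun b => by
      filter_upwards [eventually_ge_atTop (b * b)] with n hn
      exact Nat.le_sqrt.mpr hn
  have h2 : Tendsto (fun j : ℕ => |(∑ i ∈ Finset.range (j ^ 2), a i) / (j : ℝ) ^ 2| + 2 / (j : ℝ))
      atTop (𝓝 0) := by
    have := h1.abs.add (tendsto_const_div_atTop_nhds_zero_nat 2)
    simpa using this
  refine squeeze_zero_norm' ?_ (h2.comp hsqrt)
  filter_upwards [eventually_ge_atTop 1] with n hn
  set j := Nat.sqrt n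
  have hj1 : 1 ≤ j := Nat.le_sqrt.mpr (by simpa using hn)
  have hjn : j * j ≤ n := Nat.sqrt_le n
  have hnj : n ≤ j * j + j + j := Nat.sqrt_le_add n
  have hjpos : (0 : ℝ) < j := by exact_mod_cast hj1
  have hnpos : (0 : ℝ) < n := by exact_mod_cast hn
  have hjn' : (j : ℝ) ^ 2 ≤ n := by
    rw [sq]
    exact_mod_cast hjn
  have hsplit : |∑ i ∈ Finset.range n, a i| ≤ |∑ i ∈ Finset.range (j ^ 2), a i| + 2 * j := by
    rw [← Finset.sum_range_add_sum_Ico _ (show j ^ 2 ≤ n by rwa [sq])]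
    refine (abs_add_le _ _).trans (add_le_add le_rfl ?_)
    refine (Finset.abs_sum_le_sum_abs _ _).trans ?_
    refine (Finset.sum_le_card_nsmul _ _ 1 fun i _ => hb i).trans ?_
    rw [Nat.card_Ico, nsmul_eq_mul, mul_one, sq]
    have : n - j * j ≤ 2 * j := by omega
    exact_mod_cast this
  simp only [Function.comp_apply]
  rw [norm_div, Real.norm_eq_abs, Real.norm_eq_abs, abs_of_pos hnpos]
  calc |∑ i ∈ Finset.range n, a i| / (n : ℝ)
      ≤ (|∑ i ∈ Finset.range (j ^ 2), a i| + 2 * j) / (j : ℝ) ^ 2 := by gcongr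
    _ = |(∑ i ∈ Finset.range (j ^ 2), a i) / (j : ℝ) ^ 2| + 2 / (j : ℝ) := by
        rw [abs_div, abs_of_pos (show (0 : ℝ) < (j : ℝ) ^ 2 by positivity)]
        field_simp

/-- Bounded orthogonal random variables satisfy the strong law of large numbers. The second moments
of the averages along squares are summable. -/
theorem ae_tendsto_of_orthogonal (hm : ∀ i, Measurable (D i)) (hb : ∀ i ω, |D i ω| ≤ 1)
    (ho : ∀ i j, i < j → ∫ ω, D i ω * D j ω ∂P = 0) :
    ∀ᵐ ω ∂P, Tendsto (fun n : ℕ => (∑ i ∈ Finset.range n, D i ω) / n) atTop (𝓝 0) := by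
  let A : ℕ → Ω → ℝ := fun j ω =>
    ((∑ i ∈ Finset.range ((j + 1) ^ 2), D i ω) / ((j + 1 : ℕ) : ℝ) ^ 2) ^ 2
  have hAm : ∀ j, Measurable (A j) := fun j =>
    ((Finset.measurable_sum _ fun i _ => hm i).div_const _).pow_const 2
  have hA : ∀ j, ∫⁻ ω, ENNReal.ofReal (A j ω) ∂P ≤ ENNReal.ofReal (1 / ((j + 1 : ℕ) : ℝ) ^ 2) := by
    intro j
    obtain ⟨hi, hle⟩ := integral_sq_sum_le hm hb ho ((j + 1) ^ 2)
    have hAe : A j = fun ω => (∑ i ∈ Finset.range ((j + 1) ^ 2), D i ω) ^ 2 /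
        (((j + 1 : ℕ) : ℝ) ^ 2) ^ 2 := by
      funext ω
      exact div_pow _ _ 2
    have hAi : Integrable (A j) P := by
      rw [hAe]
      exact hi.div_const _
    rw [← ofReal_integral_eq_lintegral_ofReal hAi (ae_of_all _ fun ω => sq_nonneg _)]
    apply ENNReal.ofReal_le_ofReal
    rw [hAe, integral_div]
    have hpos : (0 : ℝ) < ((j + 1 : ℕ) : ℝ) ^ 2 := by positivity
    rw [div_le_div_iff₀ (by positivity) hpos, one_mul, sq (((j + 1 : ℕ) : ℝ) ^ 2)]
    push_cast at hle ⊢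
    exact mul_le_mul_of_nonneg_right hle (by positivity)
  have hsum : ∫⁻ ω, ∑' j, ENNReal.ofReal (A j ω) ∂P ≠ ∞ := by
    rw [lintegral_tsum fun j => (hAm j).ennreal_ofReal.aemeasurable]
    refine ne_top_of_le_ne_top ?_ (ENNReal.tsum_le_tsum hA)
    have hs : Summable fun j : ℕ => 1 / ((j + 1 : ℕ) : ℝ) ^ 2 :=
      (summable_nat_add_iff 1).mpr (Real.summable_one_div_nat_pow.mpr one_lt_two)
    exact hs.tsum_ofReal_ne_top
  filter_upwards [ae_lt_top (Measurable.tsum fun j => (hAm j).ennreal_ofReal) hsum]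
    with ω hω
  refine tendsto_sum_div_of_tendsto_sq (hb · ω) ?_
  have h1 := ENNReal.tendsto_atTop_zero_of_tsum_ne_top hω.ne
  have h2 : Tendsto (fun j => A j ω) atTop (𝓝 0) := by
    have := (ENNReal.tendsto_toReal ENNReal.zero_ne_top).comp h1
    refine this.congr fun j => ?_
    exact ENNReal.toReal_ofReal (sq_nonneg _)
  have h3 := h2.sqrt
  simp only [A, Real.sqrt_sq_eq_abs, Real.sqrt_zero] at h3
  exact (tendsto_zero_iff_abs_tendsto_zero _).mpr h3

end Orthogonal

/-! ### Stationary distributions of irreducible chains -/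

section Words

variable {S Ω : Type*} [DecidableEq S] {Y : ℕ → Ω → S}

/-- The indicator of the event that the word `u` is read at time `i`. -/
def hit (Y : ℕ → Ω → S) (u : List S) (i : ℕ)
    (ω : Ω) : ℝ :=
  if ∀ j (h : j < u.length), Y (i + j) ω = u[j] then 1 else 0

/-- The number of times before `n` at which the word `u` is read. -/
def wordCount (Y : ℕ → Ω → S) (u : List S)
    (n : ℕ) (ω : Ω) : ℝ := ∑ i ∈ Finset.range n, hit Y u i ω

theorem hit_append_singleton (u : List S) (s : S) (i : ℕ) (ω : Ω) :
    hit Y (u ++ [s]) i ω = hit Y u i ω * if Y (i + u.length) ω = s then 1 else 0 := by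
  have : (∀ j (h : j < (u ++ [s]).length), Y (i + j) ω = (u ++ [s])[j]) ↔
      (∀ j (h : j < u.length), Y (i + j) ω = u[j]) ∧ Y (i + u.length) ω = s := by
    constructor
    · intro h
      refine ⟨fun j hj => ?_, ?_⟩
      · rw [h j (by simp; omega), List.getElem_append_left hj]
      · rw [h u.length (by simp), List.getElem_append_right le_rfl]
        simp
    · rintro ⟨h1, h2⟩ j hj
      by_cases hju : j < u.length
      · rw [List.getElem_append_left hju, h1 j hju]
      · obtain rfl : j = u.length := by simp at hj; omega
        rw [List.getElem_append_right le_rfl, h2]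
        simp
  unfold hit
  rw [if_congr this rfl rfl]
  split_ifs <;> simp_all

theorem hit_nonneg (u : List S) (i : ℕ) (ω : Ω) : 0 ≤ hit Y u i ω := by
  unfold hit
  split_ifs <;> norm_num

theorem hit_le_one (u : List S) (i : ℕ) (ω : Ω) : hit Y u i ω ≤ 1 := by
  unfold hit
  split_ifs <;> norm_num

theorem hit_congr (u : List S) {i m : ℕ} (hm : i + u.length ≤ m + 1) {ω ω' : Ω}
    (h : ∀ j ≤ m, Y j ω = Y j ω') : hit Y u i ω = hit Y u i ω' := by
  unfold hit
  refine if_congr (forall_congr' fun j => forall_congr' fun hj => ?_) rfl rfl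
  rw [h (i + j) (by omega)]

end Words

theorem map_range_eq_iff {S Ω : Type*} {Y : ℕ → Ω → S} {L : List S} {ω : Ω} :
    (List.range L.length).map (fun i => Y i ω) = L ↔ ∀ i (h : i < L.length), Y i ω = L[i] := by
  constructor
  · intro h i hi
    have h1 : i < ((List.range L.length).map fun i => Y i ω).length := by simpa using hi
    have h2 : ((List.range L.length).map fun i => Y i ω)[i] = Y i ω := by simp
    rw [← h2]
    simp only [h]
  · intro h
    apply List.ext_getElem
    · simp
    · intro i h1 h2
      simpa using h i h2

namespace FSMC

variable {S : Type*} [Fintype S] (X : FSMC S)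

theorem sum_mul_nStep [DecidableEq S] {ν : S → ℝ} (h : ∀ s', ∑ s, ν s * X.p s s' = ν s') (n : ℕ)
    (s' : S) : ∑ s, ν s * X.nStep n s s' = ν s' := by
  have h1 : Matrix.vecMul ν (Matrix.of X.p) = ν := by
    funext s'
    simpa [Matrix.vecMul, dotProduct] using h s'
  have h2 : Matrix.vecMul ν (Matrix.of X.p ^ n) = ν := by
    induction n with
    | zero => simp
    | succ n ih => rw [pow_succ, ← Matrix.vecMul_vecMul, ih, h1]
  have := congrFun h2 s'
  simpa [Matrix.vecMul, dotProduct, nStep] using this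

theorem nStep_nonneg [DecidableEq S] (n : ℕ) (s s' : S) : 0 ≤ X.nStep n s s' := by
  unfold nStep
  induction n generalizing s' with
  | zero => 
    rw [pow_zero, Matrix.one_apply]
    split_ifs <;> norm_num
  | succ n ih =>
    rw [pow_succ, Matrix.mul_apply]
    exact Finset.sum_nonneg fun t _ => mul_nonneg (ih t) (X.nonneg t s')

variable {X}

theorem pos_of_invariant [DecidableEq S] (hirr : X.IsIrreducible) {ν : S → ℝ} (h0 : ∀ s, 0 ≤ ν s)
    (h : ∀ s', ∑ s, ν s * X.p s s' = ν s') {s : S} (hs : 0 < ν s) (s' : S) : 0 < ν s' := by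
  obtain ⟨n, -, hn⟩ := hirr s s'
  rw [← X.sum_mul_nStep h n s']
  exact Finset.sum_pos' (fun t _ => mul_nonneg (h0 t) (X.nStep_nonneg n t s'))
    ⟨s, Finset.mem_univ s, mul_pos hs hn⟩

/-- If `d` is the difference of two stationary distributions, then `|d|` and hence `|d| + d` and
`|d| - d` are invariant. By irreducibility each of them vanishes or is everywhere positive, so that
`d` has constant sign, while its total mass is zero. -/
theorem IsStationary.unique [DecidableEq S] (hirr : X.IsIrreducible) {ν ν' : S → ℝ}
    (h : X.IsStationary ν) (h' : X.IsStationary ν') : ν = ν' := by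
  set d : S → ℝ := fun s => ν s - ν' s with hd
  have hinv : ∀ s', ∑ s, d s * X.p s s' = d s' := by
    intro s'
    simp only [hd, sub_mul, Finset.sum_sub_distrib, h.2 s', h'.2 s']
  have hsum : ∑ s, d s = 0 := by
    simp only [hd, Finset.sum_sub_distrib, h.1.2, h'.1.2, sub_self]
  have hle : ∀ s', |d s'| ≤ ∑ s, |d s| * X.p s s' := by
    intro s'
    rw [← hinv s']
    refine (Finset.abs_sum_le_sum_abs _ _).trans (Finset.sum_le_sum fun s _ => ?_)
    rw [abs_mul, abs_of_nonneg (X.nonneg s s')]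
  have habs : ∀ s', ∑ s, |d s| * X.p s s' = |d s'| := by
    have htot : ∑ s', ∑ s, |d s| * X.p s s' = ∑ s', |d s'| := by
      rw [Finset.sum_comm]
      simp only [← Finset.mul_sum, X.sum_eq_one, mul_one]
    intro s'
    exact ((Finset.sum_eq_sum_iff_of_le fun s' _ => hle s').mp htot.symm s'
      (Finset.mem_univ s')).symm
  have key : ∀ ε : ℝ, (∃ s, 0 < |d s| + ε * d s) → (∀ s, 0 ≤ |d s| + ε * d s) →
      ∀ s, 0 < |d s| + ε * d s := by
    rintro ε ⟨s, hs⟩ h0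
    refine pos_of_invariant hirr h0 (fun s' => ?_) hs
    simp only [add_mul, Finset.sum_add_distrib, habs, mul_assoc, ← Finset.mul_sum, hinv]
  have hpos := key 1
  have hneg := key (-1)
  simp only [one_mul, neg_one_mul] at hpos hneg
  have hp0 : ∀ s, 0 ≤ |d s| + d s := fun s => by linarith [neg_abs_le (d s)]
  have hn0 : ∀ s, 0 ≤ |d s| + -d s := fun s => by linarith [le_abs_self (d s)]
  funext s
  by_contra hne
  have hds : d s ≠ 0 := sub_ne_zero.mpr hne
  rcases lt_or_gt_of_ne hds with hs | hs
  · have hall := hneg ⟨s, by linarith [abs_nonneg (d s)]⟩ hn0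
    have : ∀ t, d t < 0 := fun t => by
      by_contra ht
      have := hall t
      rw [abs_of_nonneg (not_lt.mp ht)] at this
      linarith
    exact absurd hsum (Finset.sum_neg (fun t _ => this t) ⟨s, Finset.mem_univ s⟩).ne
  · have hall := hpos ⟨s, by linarith [abs_nonneg (d s)]⟩ hp0
    have : ∀ t, 0 < d t := fun t => by
      by_contra ht
      have := hall t
      rw [abs_of_nonpos (not_lt.mp ht)] at this
      linarith
    exact absurd hsum (Finset.sum_pos (fun t _ => this t) ⟨s, Finset.mem_univ s⟩).ne'

theorem wordProb_append_singleton (μ : S → ℝ) {L : List S} (hL : L ≠ []) (s : S) :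
    X.wordProb μ (L ++ [s]) = X.wordProb μ L * X.p (L.getLast hL) s := by
  have hchain : ∀ (L : List S) (a : S), X.chainProb a (L ++ [s]) =
      X.chainProb a L * X.p ((a :: L).getLast (List.cons_ne_nil a L)) s := by
    intro L
    induction L with
    | nil => intro a; simp [chainProb]
    | cons b L ih =>
      intro a
      rw [List.cons_append, chainProb, chainProb, ih b, List.getLast_cons (List.cons_ne_nil b L),
        mul_assoc]
  obtain ⟨a, L, rfl⟩ := List.exists_cons_of_ne_nil hL
  rw [List.cons_append, wordProb, wordProb, hchain, mul_assoc]

/-! ### Frequencies of words in a Markov process -/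

section MarkovSequence

variable {μ : S → ℝ} {Ω : Type*} [MeasurableSpace Ω] {P : Measure Ω} {Y : ℕ → Ω → S}

theorem wordProb_nonneg (hμ : ∀ s, 0 ≤ μ s) (L : List S) : 0 ≤ X.wordProb μ L := by
  have hchain : ∀ (L : List S) (a : S), 0 ≤ X.chainProb a L := by
    intro L
    induction L with
    | nil => intro a; exact zero_le_one
    | cons b L ih => intro a; exact mul_nonneg (X.nonneg a b) (ih b)
  cases L with
  | nil => exact zero_le_one
  | cons a L => exact mul_nonneg (hμ a) (hchain L a)

namespace IsMarkovSequence

/-- Almost surely, all transitions have positive probability. -/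
theorem ae_pos (hY : X.IsMarkovSequence μ P Y) : ∀ᵐ ω ∂P, ∀ i, 0 < X.p (Y i ω) (Y (i + 1) ω) := by
  have h1 : ∀ᵐ ω ∂P, ∀ L : List S, ∀ s, ∀ hL : L ≠ [], X.p (L.getLast hL) s = 0 →
      ω ∉ {ω | (List.range (L ++ [s]).length).map (fun i => Y i ω) = L ++ [s]} := by
    rw [ae_all_iff]
    intro L
    rw [ae_all_iff]
    intro s
    by_cases hL : L ≠ []
    swap
    · exact ae_of_all _ fun ω h => absurd h hL
    by_cases hp : X.p (L.getLast hL) s = 0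
    swap
    · exact ae_of_all _ fun ω _ h => absurd h hp
    have h0 : P {ω | (List.range (L ++ [s]).length).map (fun i => Y i ω) = L ++ [s]} = 0 := by
      rw [hY.2, wordProb_append_singleton μ hL, hp, mul_zero, ENNReal.ofReal_zero]
    filter_upwards [measure_eq_zero_iff_ae_notMem.mp h0] with ω hω _ _
    exact hω
  filter_upwards [h1] with ω hω i
  refine lt_of_le_of_ne (X.nonneg _ _) fun h => ?_
  refine hω ((List.range (i + 1)).map fun j => Y j ω) (Y (i + 1) ω) (by simp) ?_ ?_
  · rw [← h.symm]
    congr 1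
    simp [List.range_succ]
  · have : ((List.range (i + 1)).map fun j => Y j ω) ++ [Y (i + 1) ω] =
        (List.range (i + 1 + 1)).map fun j => Y j ω := by simp [List.range_succ]
    rw [this]
    simp

theorem measurable_hit [DecidableEq S] (hY : X.IsMarkovSequence μ P Y) (u : List S) (i : ℕ) :
    Measurable (hit Y u i) := by
  refine Measurable.ite ?_ measurable_const measurable_const
  simp only [Set.ofPred_forall]
  exact MeasurableSet.iInter fun j => MeasurableSet.iInter fun hj => hY.1 _ _

variable [IsProbabilityMeasure P]

/-- The Markov property: the deviation of the next step from its conditional probability is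
orthogonal to every function of the past. -/
theorem integral_mul_sub_eq_zero [DecidableEq S] (hμ : IsDistribution μ)
    (hY : X.IsMarkovSequence μ P Y) (m : ℕ) (s : S) {G : Ω → ℝ}
    (hG : ∀ ω ω', (∀ i ≤ m, Y i ω = Y i ω') → G ω = G ω') :
    ∫ ω, G ω * ((if Y (m + 1) ω = s then 1 else 0) - X.p (Y m ω) s) ∂P = 0 := by
  -- The integrand is a combination of indicators of the events `A z` and `B z` that the process
  -- begins with the word `z` of length `m + 1`, and with `z s`.
  let Z : Ω → Fin (m + 1) → S := fun ω i => Y i ω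
  have hfac : Function.FactorsThrough G Z := fun ω ω' h =>
    hG ω ω' fun i hi => congrFun h ⟨i, Nat.lt_succ_of_le hi⟩
  let A : (Fin (m + 1) → S) → Set Ω := fun z =>
    {ω | (List.range (List.ofFn z).length).map (fun i => Y i ω) = List.ofFn z}
  let B : (Fin (m + 1) → S) → Set Ω := fun z =>
    {ω | (List.range (List.ofFn z ++ [s]).length).map (fun i => Y i ω) = List.ofFn z ++ [s]}
  have hA : ∀ z ω, ω ∈ A z ↔ Z ω = z := by
    intro z ω
    simp only [A, Set.mem_ofPred_eq, map_range_eq_iff, funext_iff, Z]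
    constructor
    · intro h i
      have := h i (by rw [List.length_ofFn]; exact i.2)
      rwa [List.getElem_ofFn] at this
    · intro h i hi
      rw [List.getElem_ofFn]
      exact h ⟨i, by rwa [List.length_ofFn] at hi⟩
  have hB : ∀ z ω, ω ∈ B z ↔ Z ω = z ∧ Y (m + 1) ω = s := by
    intro z ω
    rw [← hA]
    simp only [A, B, Set.mem_ofPred_eq, map_range_eq_iff]
    constructor
    · intro h
      refine ⟨fun i hi => ?_, ?_⟩
      · rw [h i (by simp at hi ⊢; omega), List.getElem_append_left hi]
      · rw [h (m + 1) (by simp), List.getElem_append_right (by simp)]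
        simp
    · rintro ⟨h1, h2⟩ i hi
      by_cases him : i < (List.ofFn z).length
      · rw [List.getElem_append_left him]
        exact h1 i him
      · have : i = m + 1 := by simp at hi him; omega
        subst this
        rw [List.getElem_append_right (by simp)]
        simpa using h2
  have hAm : ∀ z, MeasurableSet (A z) := by
    intro z
    have : A z = ⋂ i : Fin (m + 1), Y i ⁻¹' {z i} := by
      ext ω
      rw [hA]
      simp [funext_iff, Z]
    rw [this]
    exact MeasurableSet.iInter fun i => hY.1 i (z i)
  have hBm : ∀ z, MeasurableSet (B z) := by
    intro z
    have : B z = A z ∩ Y (m + 1) ⁻¹' {s} := by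
      ext ω
      rw [hB, Set.mem_inter_iff, hA]
      rfl
    rw [this]
    exact (hAm z).inter (hY.1 _ _)
  have hsplit : ∀ ω, G ω * ((if Y (m + 1) ω = s then 1 else 0) - X.p (Y m ω) s) =
      ∑ z, Function.extend Z G 0 z * ((B z).indicator 1 ω -
        X.p (z (Fin.last m)) s * (A z).indicator 1 ω) := by
    intro ω
    rw [Finset.sum_eq_single (Z ω)]
    · rw [hfac.extend_apply, Set.indicator_of_mem ((hA _ _).mpr rfl)]
      congr 1
      by_cases hs : Y (m + 1) ω = s
      · rw [if_pos hs, Set.indicator_of_mem ((hB _ _).mpr ⟨rfl, hs⟩)]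
        simp [Z]
      · rw [if_neg hs, Set.indicator_of_notMem fun h => hs ((hB _ _).mp h).2]
        simp [Z]
    · intro z _ hz
      rw [Set.indicator_of_notMem fun h => hz ((hB _ _).mp h).1.symm,
        Set.indicator_of_notMem fun h => hz ((hA _ _).mp h).symm]
      simp
    · exact fun h => absurd (Finset.mem_univ _) h
  have hiA : ∀ z, Integrable ((A z).indicator (1 : Ω → ℝ)) P := fun z =>
    (integrable_indicator_iff (hAm z)).mpr (integrableOn_const (measure_ne_top _ _))
  have hiB : ∀ z, Integrable ((B z).indicator (1 : Ω → ℝ)) P := fun z =>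
    (integrable_indicator_iff (hBm z)).mpr (integrableOn_const (measure_ne_top _ _))
  have hiAB : ∀ z, Integrable (fun ω => (B z).indicator (1 : Ω → ℝ) ω -
      X.p (z (Fin.last m)) s * (A z).indicator (1 : Ω → ℝ) ω) P := fun z =>
    (hiB z).sub ((hiA z).const_mul _)
  simp only [hsplit]
  rw [integral_finsetSum _ fun z _ => (hiAB z).const_mul _]
  refine Finset.sum_eq_zero fun z _ => ?_
  rw [integral_const_mul, integral_sub (hiB z) ((hiA z).const_mul _), integral_const_mul,
    integral_indicator_one (hAm z), integral_indicator_one (hBm z)]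
  have hne : List.ofFn z ≠ [] := by simp
  have h1 : P.real (A z) = X.wordProb μ (List.ofFn z) := by
    rw [Measure.real, hY.2, ENNReal.toReal_ofReal (wordProb_nonneg hμ.1 _)]
  have h2 : P.real (B z) = X.wordProb μ (List.ofFn z) * X.p (z (Fin.last m)) s := by
    rw [Measure.real, hY.2, ENNReal.toReal_ofReal (wordProb_nonneg hμ.1 _),
      wordProb_append_singleton μ hne, List.getLast_ofFn]
    rfl
  rw [h1, h2]
  ring

variable [DecidableEq S]

/-- The difference between the frequency of the word `u s` and its expectation given the frequency
of the word `u` tends to zero. -/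
theorem ae_tendsto_wordCount_append (hμ : IsDistribution μ) (hY : X.IsMarkovSequence μ P Y) :
    ∀ᵐ ω ∂P, ∀ (u : List S) (hu : u ≠ []) (s : S),
      Tendsto (fun n : ℕ => wordCount Y (u ++ [s]) n ω / n -
        wordCount Y u n ω / n * X.p (u.getLast hu) s) atTop (𝓝 0) := by
  rw [ae_all_iff]
  intro u
  by_cases hu : u ≠ []
  swap
  · exact ae_of_all _ fun ω h => absurd h hu
  suffices ∀ s, ∀ᵐ ω ∂P, Tendsto (fun n : ℕ => wordCount Y (u ++ [s]) n ω / n -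
        wordCount Y u n ω / n * X.p (u.getLast hu) s) atTop (𝓝 0) by
    filter_upwards [ae_all_iff.mpr this] with ω hω _ s
    exact hω s
  intro s
  obtain ⟨k, hk⟩ : ∃ k, u.length = k + 1 :=
    ⟨u.length - 1, by have := List.length_pos_iff.mpr hu; omega⟩
  set c := X.p (u.getLast hu) s with hc
  have hc0 : 0 ≤ c := X.nonneg _ _
  have hc1 : c ≤ 1 := by
    rw [← X.sum_eq_one (u.getLast hu)]
    exact Finset.single_le_sum (f := fun s => X.p (u.getLast hu) s)
      (fun t _ => X.nonneg _ t) (Finset.mem_univ s)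
  let D : ℕ → Ω → ℝ := fun i ω => hit Y (u ++ [s]) i ω - hit Y u i ω * c
  have hDform : ∀ i ω, D i ω = hit Y u i ω *
      ((if Y (i + k + 1) ω = s then 1 else 0) - X.p (Y (i + k) ω) s) := by
    intro i ω
    simp only [D]
    rw [hit_append_singleton, ← mul_sub, hk, ← add_assoc]
    by_cases h : ∀ j (h : j < u.length), Y (i + j) ω = u[j]
    · have : Y (i + k) ω = u.getLast hu := by
        rw [h k (by omega), List.getLast_eq_getElem]
        simp only [hk, Nat.add_sub_cancel]
      rw [hc, this]
    · rw [hit, if_neg h, zero_mul, zero_mul]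
  have hDm : ∀ i, Measurable (D i) := fun i =>
    (measurable_hit hY _ i).sub ((measurable_hit hY _ i).mul_const c)
  have hDb : ∀ i ω, |D i ω| ≤ 1 := by
    intro i ω
    have h1 := hit_nonneg (Y := Y) (u ++ [s]) i ω
    have h2 := hit_le_one (Y := Y) (u ++ [s]) i ω
    have h3 := hit_nonneg (Y := Y) u i ω
    have h4 := hit_le_one (Y := Y) u i ω
    have h5 := mul_nonneg h3 hc0
    have h6 := mul_le_one₀ h4 hc0 hc1
    rw [abs_le]
    constructor <;> simp only [D] <;> linarith
  have hDo : ∀ i j, i < j → ∫ ω, D i ω * D j ω ∂P = 0 := by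
    intro i j hij
    have := hY.integral_mul_sub_eq_zero hμ (j + k) s (G := fun ω => D i ω * hit Y u j ω) (by
      intro ω ω' h
      simp only [D]
      rw [hit_congr (u ++ [s]) (m := j + k) (by simp; omega) h,
        hit_congr u (m := j + k) (by omega) h, hit_congr u (m := j + k) (by omega) h])
    rw [← this]
    congr 1
    funext ω
    rw [hDform j, mul_assoc]
  filter_upwards [ae_tendsto_of_orthogonal hDm hDb hDo] with ω hω
  refine hω.congr fun n => ?_
  simp only [D, wordCount, Finset.sum_sub_distrib, ← Finset.sum_mul]
  ring

/-- Almost surely, the frequency of every word converges to its probability under the stationary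
distribution. By compactness the frequencies of the states have limit points, and every limit point
is a stationary distribution, hence unique. Longer words follow by induction on the length. -/
theorem exists_ae_tendsto_wordCount (hμ : IsDistribution μ) (hY : X.IsMarkovSequence μ P Y)
    (hirr : X.IsIrreducible) : ∃ μ₀, X.IsStationary μ₀ ∧ ∀ᵐ ω ∂P, ∀ u : List S, u ≠ [] →
      Tendsto (fun n : ℕ => wordCount Y u n ω / n) atTop (𝓝 (X.wordProb μ₀ u)) := by
  let f : Ω → ℕ → S → ℝ := fun ω n s => wordCount Y [s] n ω / n
  let K : Set (S → ℝ) := Set.univ.pi fun _ => Set.Icc 0 1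
  have hK : IsCompact K := isCompact_univ_pi fun _ => isCompact_Icc
  have hfK : ∀ ω n, f ω n ∈ K := by
    intro ω n s _
    refine ⟨div_nonneg (Finset.sum_nonneg fun i _ => hit_nonneg _ i ω) (Nat.cast_nonneg n), ?_⟩
    refine div_le_one_of_le₀ ?_ (Nat.cast_nonneg n)
    refine (Finset.sum_le_card_nsmul _ _ 1 fun i _ => hit_le_one [s] i ω).trans ?_
    simp
  have hsingle : ∀ s i ω, hit Y [s] i ω = if Y i ω = s then 1 else 0 := by
    intro s i ω
    simp [hit]
  have hsum : ∀ ω, ∀ᶠ n in atTop, ∑ s, f ω n s = 1 := by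
    intro ω
    filter_upwards [eventually_ge_atTop 1] with n hn
    have hn' : (n : ℝ) ≠ 0 := by positivity
    simp only [f, wordCount, hsingle, ← Finset.sum_div]
    rw [Finset.sum_comm]
    simp [hn']
  have hae := hY.ae_tendsto_wordCount_append hμ
  have hdiff : ∀ ω, (∀ (u : List S) (hu : u ≠ []) (s : S),
      Tendsto (fun n : ℕ => wordCount Y (u ++ [s]) n ω / n -
        wordCount Y u n ω / n * X.p (u.getLast hu) s) atTop (𝓝 0)) →
      ∀ s', Tendsto (fun n => f ω n s' - ∑ s, f ω n s * X.p s s') atTop (𝓝 0) := by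
    intro ω hω s'
    -- The words `s s'` end in `s'`: summed over `s`, they count the visits to `s'`, shifted by one.
    have h1 : Tendsto (fun n : ℕ => ∑ s, (wordCount Y ([s] ++ [s']) n ω / n -
        f ω n s * X.p s s')) atTop (𝓝 (∑ _s : S, 0)) :=
      tendsto_finsetSum _ fun s _ => hω [s] (by simp) s'
    have h2 : Tendsto (fun n : ℕ => (hit Y [s'] 0 ω - hit Y [s'] n ω) / (n : ℝ)) atTop (𝓝 0) := by
      refine squeeze_zero_norm (fun n => ?_) (tendsto_const_div_atTop_nhds_zero_nat 1)
      rw [norm_div, Real.norm_natCast]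
      gcongr
      rw [Real.norm_eq_abs, abs_le]
      have a1 := hit_nonneg (Y := Y) [s'] 0 ω
      have a2 := hit_le_one (Y := Y) [s'] 0 ω
      have a3 := hit_nonneg (Y := Y) [s'] n ω
      have a4 := hit_le_one (Y := Y) [s'] n ω
      constructor <;> linarith
    have h3 := h1.add h2
    rw [Finset.sum_const_zero, add_zero] at h3
    refine h3.congr fun n => ?_
    have hpair : ∑ s, wordCount Y ([s] ++ [s']) n ω =
        ∑ i ∈ Finset.range n, hit Y [s'] (i + 1) ω := by
      simp only [wordCount]
      rw [Finset.sum_comm]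
      refine Finset.sum_congr rfl fun i _ => ?_
      simp only [hit_append_singleton, hsingle, List.length_singleton]
      simp
    have htel : ∑ i ∈ Finset.range n, hit Y [s'] (i + 1) ω =
        wordCount Y [s'] n ω + hit Y [s'] n ω - hit Y [s'] 0 ω := by
      have a1 := Finset.sum_range_succ (fun i => hit Y [s'] i ω) n
      have a2 := Finset.sum_range_succ' (fun i => hit Y [s'] i ω) n
      simp only [wordCount]
      linarith
    rw [Finset.sum_sub_distrib, ← Finset.sum_div, hpair, htel]
    simp only [f]
    ring
  have hstat : ∀ ω, (∀ s', Tendsto (fun n => f ω n s' - ∑ s, f ω n s * X.p s s') atTop (𝓝 0)) →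
      ∀ ν, MapClusterPt ν atTop (f ω) → X.IsStationary ν := by
    intro ω hω ν hν
    obtain ⟨U, hU, hlim⟩ := mapClusterPt_iff_ultrafilter.mp hν
    have hlim' : ∀ s, Tendsto (fun n => f ω n s) U (𝓝 (ν s)) := tendsto_pi_nhds.mp hlim
    refine ⟨⟨fun s => ge_of_tendsto' (hlim' s) fun n => (hfK ω n s trivial).1, ?_⟩, fun s' => ?_⟩
    · refine tendsto_nhds_unique (tendsto_finsetSum _ fun s _ => hlim' s) ?_
      exact (tendsto_congr' ((hsum ω).filter_mono hU)).mpr tendsto_const_nhds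
    · have h1 := (hlim' s').sub
        (tendsto_finsetSum Finset.univ fun s _ => (hlim' s).mul_const (X.p s s'))
      have h2 := tendsto_nhds_unique h1 ((hω s').mono_left hU)
      linarith
  obtain ⟨μ₀, hμ₀⟩ : ∃ μ₀, X.IsStationary μ₀ := by
    obtain ⟨ω, hω⟩ := hae.exists
    obtain ⟨ν, -, hν⟩ := hK.exists_mapClusterPt (f := atTop) (u := f ω)
      (tendsto_principal.mpr (Eventually.of_forall fun n => hfK ω n))
    exact ⟨ν, hstat ω (hdiff ω hω) ν hν⟩
  refine ⟨μ₀, hμ₀, ?_⟩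
  filter_upwards [hae] with ω hω u
  have hf : Tendsto (f ω) atTop (𝓝 μ₀) :=
    hK.tendsto_nhds_of_unique_mapClusterPt (Eventually.of_forall fun n => hfK ω n)
      fun ν _ hν => IsStationary.unique hirr (hstat ω (hdiff ω hω) ν hν) hμ₀
  induction u using List.reverseRecOn with
  | nil => exact fun h => absurd rfl h
  | append_singleton L s ih =>
    intro _
    by_cases hL : L = []
    · subst hL
      simpa [wordProb, chainProb] using tendsto_pi_nhds.mp hf s
    · have h1 := (hω L hL s).add ((ih hL).mul_const (X.p (L.getLast hL) s))
      rw [zero_add, ← wordProb_append_singleton μ₀ hL] at h1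
      exact h1.congr fun n => sub_add_cancel _ _

end IsMarkovSequence

end MarkovSequence

end FSMC

/-! ### Words read along a walk and in its closing -/

/-- If the cyclic word `w` begins with the first `n` letters of a sequence, then the occurrences of
`v` in `w` and in the sequence can only differ at positions where `v` is not read within these `n`
letters. -/
theorem abs_cyclicCount_sub_wordCount_le {α Ω : Type*} [DecidableEq α] {w : List (α × Bool)}
    (hw : w ≠ []) {Y : ℕ → Ω → α × Bool} {ω : Ω} {n : ℕ} (hn : n ≤ w.length)
    (hY : ∀ i (h : i < n), w[i] = Y i ω) (v : List (α × Bool)) :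
    |(cyclicCount w hw v : ℝ) - wordCount Y v n ω| ≤ v.length + (w.length - n) := by
  have h1 : (cyclicCount w hw v : ℝ) = ∑ i ∈ Finset.range w.length,
      if seg (periodicLabel w hw) i v.length = v then (1 : ℝ) else 0 := by
    rw [cyclicCount, Finset.sum_boole]
  have h2 : wordCount Y v n ω = ∑ i ∈ Finset.range w.length, if i < n then hit Y v i ω else 0 := by
    rw [wordCount, ← Finset.sum_filter]
    congr 1
    ext i
    simp only [Finset.mem_range, Finset.mem_filter]
    omega
  rw [h1, h2, ← Finset.sum_sub_distrib]
  have h3 : ∀ i ∈ Finset.range w.length,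
      |(if seg (periodicLabel w hw) i v.length = v then (1 : ℝ) else 0) -
        (if i < n then hit Y v i ω else 0)| ≤ if n < i + v.length ∨ n ≤ i then 1 else 0 := by
    intro i _
    split_ifs with ha hb hc hc hb hc hc
    · rw [abs_le]
      constructor <;> linarith [hit_nonneg (Y := Y) v i ω, hit_le_one (Y := Y) v i ω]
    · push Not at hc
      have : hit Y v i ω = 1 := by
        rw [hit, if_pos]
        intro j hj
        have h4 : (seg (periodicLabel w hw) i v.length)[j]'(by rwa [length_seg]) = v[j] := by
          simp only [ha]
        rw [← h4]
        simp only [seg, List.getElem_ofFn]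
        rw [← hY (i + j) (by omega)]
        exact_mod_cast (periodicLabel_of_lt w hw (i + j) (by omega)).symm
      rw [this]
      norm_num
    · norm_num
    · omega
    · rw [abs_le]
      constructor <;> linarith [hit_nonneg (Y := Y) v i ω, hit_le_one (Y := Y) v i ω]
    · push Not at hc
      have : hit Y v i ω = 0 := by
        rw [hit, if_neg]
        intro h
        apply ha
        apply List.ext_getElem
        · rw [length_seg]
        · intro j hj hj'
          rw [← h j hj', ← hY (i + j) (by omega)]
          simp only [seg, List.getElem_ofFn]
          exact_mod_cast periodicLabel_of_lt w hw (i + j) (by omega)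
      rw [this]
      norm_num
    · norm_num
    · norm_num
  refine (Finset.abs_sum_le_sum_abs _ _).trans ((Finset.sum_le_sum h3).trans ?_)
  rw [Finset.sum_boole]
  have h5 : (Finset.range w.length).filter (fun i => n < i + v.length ∨ n ≤ i) ⊆
      Finset.Ico (n - v.length) w.length := by
    intro i
    simp only [Finset.mem_filter, Finset.mem_range, Finset.mem_Ico]
    omega
  have h6 := Finset.card_le_card h5
  rw [Nat.card_Ico] at h6
  rw [← Nat.cast_sub hn]
  exact_mod_cast h6.trans (by omega)

theorem wordCount_coe {β Ω : Type*} [DecidableEq β] {S : Finset β} (Y : ℕ → Ω → S) (v : List β)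
    (n : ℕ) (ω : Ω) : wordCount (fun i ω => (Y i ω : β)) v n ω =
      if h : ∀ e ∈ v, e ∈ S then wordCount Y (v.attachWith (· ∈ S) h) n ω else 0 := by
  split_ifs with h
  · refine Finset.sum_congr rfl fun i _ => ?_
    unfold hit
    refine if_congr ?_ rfl rfl
    constructor
    · intro h' j hj
      apply Subtype.ext
      rw [List.getElem_attachWith]
      exact h' j (by simpa using hj)
    · intro h' j hj
      have := h' j (by simpa using hj)
      rw [List.getElem_attachWith] at this
      exact congrArg Subtype.val this
  · refine Finset.sum_eq_zero fun i _ => ?_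
    unfold hit
    rw [if_neg]
    intro h'
    apply h
    intro e he
    obtain ⟨j, hj, rfl⟩ := List.getElem_of_mem he
    rw [← h' j hj]
    exact (Y (i + j) ω).2

theorem tendsto_wordCount_coe {E Ω : Type*} [DecidableEq E] {S : Finset (E × Bool)} {X : FSMC S}
    {μ₀ : S → ℝ} {Y : ℕ → Ω → S} {ω : Ω}
    (h : ∀ u : List S, u ≠ [] →
      Tendsto (fun n : ℕ => wordCount Y u n ω / n) atTop (𝓝 (X.wordProb μ₀ u)))
    {v : List (E × Bool)} (hv : v ≠ []) :
    Tendsto (fun n : ℕ => wordCount (fun i ω => (Y i ω : E × Bool)) v n ω / n) atTop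
      (𝓝 (extWordProb X μ₀ v)) := by
  simp only [wordCount_coe, extWordProb]
  split_ifs with hS
  · exact h _ (by simpa [← List.length_eq_zero_iff] using hv)
  · simp

theorem periodicLabel_ne_invLetter {α : Type*} {w : List (α × Bool)} (hw : w ≠ [])
    (h : FreeGroup.IsReduced (w ++ [w.head hw])) (n : ℤ) :
    periodicLabel w hw (n + 1) ≠ invLetter (periodicLabel w hw n) := by
  have h0 : 0 < w.length := List.length_pos_iff.mpr hw
  have hr0 := Int.emod_nonneg n (show (w.length : ℤ) ≠ 0 by omega)
  have hr1 := Int.emod_lt_of_pos n (show (0 : ℤ) < w.length by omega)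
  obtain ⟨r, hr⟩ : ∃ r : ℕ, (r : ℤ) = n % w.length := ⟨(n % w.length).toNat, by omega⟩
  have hnr : n = r + n / w.length * w.length := by
    rw [hr, mul_comm, Int.emod_add_mul_ediv]
  have hrw : r < w.length := by omega
  have h1 := isReduced_iff_getElem.mp h r (by simpa using hrw)
  rw [List.getElem_append_left hrw] at h1
  rw [hnr, add_right_comm, periodicLabel_add_mul, periodicLabel_add_mul,
    periodicLabel_of_lt w hw r hrw]
  rcases Nat.lt_or_ge (r + 1) w.length with h2 | h2
  · rw [List.getElem_append_left h2] at h1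
    have := periodicLabel_of_lt w hw (r + 1) h2
    push_cast at this
    rwa [this]
  · obtain h3 : r + 1 = w.length := by omega
    have h4 := periodicLabel_add_mul w hw 0 1
    have h5 := periodicLabel_of_lt w hw 0 h0
    rw [one_mul, zero_add, ← h3] at h4
    push_cast at h4 h5
    rw [h4, h5]
    rw [List.getElem_append_right h2] at h1
    simpa [List.head_eq_getElem] using h1

namespace SimplicialChart

open OrientedGraph

variable {N : ℕ} {V E : Type*} [Fintype V] [Fintype E] {Γ : SimplicialChart N V E}
  {β : E × Bool → E × Bool → List (E × Bool)} {δ : V → List (E × Bool)}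

theorem IsClosingSystem.isPath (hβ : Γ.IsClosingSystem β) (e e' : E × Bool) :
    Γ.IsPath (Γ.t e) (β e e') (Γ.o e') := by
  obtain ⟨m, h1, h2⟩ := isPath_append_iff.mp (hβ e e').1.2
  rwa [show Γ.o e' = m from h2.1]

/-- The closing of a reduced path is a closed path, reduced as a cyclic word. -/
theorem IsClosingSystem.closing (hβ : Γ.IsClosingSystem β) {e : E × Bool} {L : List (E × Bool)}
    {u : V} (hp : Γ.IsPath (Γ.o e) (e :: L) u) (hr : FreeGroup.IsReduced (e :: L)) :
    ∃ M, closing β (e :: L) = (e :: L) ++ M ∧ Γ.IsPath (Γ.o e) ((e :: L) ++ M) (Γ.o e) ∧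
      FreeGroup.IsReduced ((e :: L) ++ M ++ [e]) := by
  obtain ⟨K, a, hK⟩ : ∃ K a, e :: L = K ++ [a] :=
    ⟨_, _, (List.dropLast_append_getLast (List.cons_ne_nil e L)).symm⟩
  refine ⟨β a e, ?_, ?_, ?_⟩
  · rw [FreeCurrents.closing, dif_pos (List.cons_ne_nil e L)]
    have h1 : (K ++ [a]).head (by simp) = e := by simp only [← hK, List.head_cons]
    simp only [hK, List.getLast_append_singleton, h1]
  · refine hp.append ?_
    have : Γ.t a = u := by
      rw [hK] at hp
      obtain ⟨m, -, h⟩ := isPath_append_iff.mp hp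
      exact h.2
    rw [← this]
    exact hβ.isPath a e
  · rw [hK, List.append_assoc (K ++ [a])]
    rw [hK] at hr
    exact hr.append_overlap (hβ a e).2 (List.cons_ne_nil _ _)

theorem loopElt_of_isPath (hδ : ∀ v, Γ.IsPath Γ.base (δ v) v) {e : E × Bool} {L : List (E × Bool)}
    (h : Γ.IsPath (Γ.o e) (e :: L) (Γ.o e)) :
    Γ.loopElt δ (e :: L) = Γ.pathElt δ (Γ.o e) (Γ.o e) (e :: L) := by
  have h' := ((hδ (Γ.o e)).append h).append (hδ (Γ.o e)).invRev
  rw [loopElt, dif_pos h']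
  apply Γ.markingHom_injective
  rw [markingHom_pathElt hδ h, markingHom_apply, MulEquiv.apply_symm_apply, FreeGroup.inv_mk,
    ← mk_append, ← mk_append]

theorem loopElt_eq_one_or (hδ : ∀ v, Γ.IsPath Γ.base (δ v) v) (L : List (E × Bool)) :
    Γ.loopElt δ L = 1 ∨ ∃ v, Γ.IsPath v L v ∧ Γ.loopElt δ L = Γ.pathElt δ v v L := by
  rcases L with - | ⟨e, L⟩
  · exact Or.inl rfl
  · by_cases h : Γ.IsPath Γ.base (δ (Γ.o e) ++ (e :: L) ++ FreeGroup.invRev (δ (Γ.o e))) Γ.base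
    · obtain ⟨b, h1, h2⟩ := isPath_append_iff.mp h
      obtain ⟨a, h3, h4⟩ := isPath_append_iff.mp h1
      obtain rfl := h3.end_unique (hδ _)
      have h5 := h2.invRev
      rw [FreeGroup.invRev_invRev] at h5
      obtain rfl := h5.end_unique (hδ _)
      exact Or.inr ⟨_, h4, loopElt_of_isPath hδ h4⟩
    · exact Or.inl (by rw [loopElt, dif_neg h])

variable (β) in
theorem exists_length_closing_le : ∃ B : ℕ, ∀ L : List (E × Bool),
    (closing β L).length ≤ L.length + B := by
  refine ⟨Finset.univ.sup fun e : (E × Bool) × (E × Bool) => (β e.1 e.2).length, fun L => ?_⟩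
  unfold FreeCurrents.closing
  split_ifs with h
  · rw [List.length_append]
    exact Nat.add_le_add_left (Finset.le_sup
      (f := fun e : (E × Bool) × (E × Bool) => (β e.1 e.2).length)
      (Finset.mem_univ (L.getLast h, L.head h))) _
  · simp

theorem length_walk {E Ω : Type*} {S : Finset (E × Bool)} (Y : ℕ → Ω → S) (n : ℕ) (ω : Ω) :
    (walk Y n ω).length = n := by
  simp [walk]

/-- The closed-up walks form a tame process. -/
theorem isTame_loopElt_closing {Ω : Type*} {S : Finset (E × Bool)} (Y : ℕ → Ω → S)
    (hδ : ∀ v, Γ.IsPath Γ.base (δ v) v) :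
    IsTame fun n ω => Γ.loopElt δ (FreeCurrents.closing β (walk Y n ω)) := by
  intro A
  obtain ⟨c, hc⟩ := Γ.exists_norm_pathElt_le hδ (fun g => (A.repr g).norm) (by simp)
    (fun g h => by simpa using FreeGroup.norm_mul_le (A.repr g) (A.repr h))
  obtain ⟨B, hB⟩ := exists_length_closing_le β
  -- The summand `1` only serves to make the constant positive.
  refine ⟨c * (1 + B) + 1, by positivity, fun n hn ω => ?_⟩
  have h1 := hB (walk Y n ω)
  rw [length_walk] at h1
  have h2 : (A.repr (Γ.loopElt δ (FreeCurrents.closing β (walk Y n ω)))).norm ≤ c * (n + B) := by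
    rcases loopElt_eq_one_or hδ (FreeCurrents.closing β (walk Y n ω)) with h | ⟨v, hv, h⟩
    · rw [h]
      simp
    · rw [h]
      exact (hc _ _ _ hv).trans (Nat.mul_le_mul_left c h1)
  have h3 : c * (n + B) ≤ (c * (1 + B) + 1) * n := by
    have : n + B ≤ (1 + B) * n := by nlinarith
    nlinarith [Nat.mul_le_mul_left c this]
  exact_mod_cast h2.trans h3

variable {Ω : Type*} {S : Finset (E × Bool)} {X : FSMC S} {Y : ℕ → Ω → S} {ω : Ω}

theorem isPath_walk (hbased : Γ.IsBased X) (hpos : ∀ i, 0 < X.p (Y i ω) (Y (i + 1) ω)) (n : ℕ) :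
    Γ.IsPath (Γ.o (Y 0 ω)) (walk Y (n + 1) ω) (Γ.t (Y n ω)) := by
  induction n with
  | zero => exact isPath_singleton _
  | succ n ih =>
    rw [walk, List.range_succ, List.map_append]
    refine IsPath.append ih ?_
    rw [(hbased.2 _ _ (hpos n)).1]
    exact isPath_singleton _

theorem isReduced_walk (hbased : Γ.IsBased X) (hpos : ∀ i, 0 < X.p (Y i ω) (Y (i + 1) ω)) (n : ℕ) :
    FreeGroup.IsReduced (walk Y n ω) := by
  rw [isReduced_iff_getElem]
  intro i hi
  simp only [walk, List.getElem_map, List.getElem_range]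
  exact (hbased.2 _ _ (hpos i)).2

/-- Along a trajectory of the chain, the closing of the walk is the label of the axis of its element
of `F_N`. -/
theorem exists_isAxis_loopElt_closing (hbased : Γ.IsBased X)
    (hpos : ∀ i, 0 < X.p (Y i ω) (Y (i + 1) ω)) (hβ : Γ.IsClosingSystem β)
    (hδ : ∀ v, Γ.IsPath Γ.base (δ v) v) {n : ℕ} (hn : n ≠ 0) :
    ∃ w hw d, FreeCurrents.closing β (walk Y n ω) = w ∧ Γ.IsAxis (Γ.loopElt δ w) d w hw ∧
      ∃ hle : n ≤ w.length, ∀ i (h : i < n), w[i] = (Y i ω : E × Bool) := by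
  obtain ⟨n, rfl⟩ := Nat.exists_eq_succ_of_ne_zero hn
  have hp := isPath_walk hbased hpos n
  have hr := isReduced_walk hbased hpos (n + 1)
  obtain ⟨L, hL⟩ : ∃ L, walk Y (n + 1) ω = (Y 0 ω : E × Bool) :: L := by
    rw [walk, List.range_succ_eq_map]
    exact ⟨_, rfl⟩
  have hlen := length_walk Y (n + 1) ω
  have hget : ∀ i (h : i < (walk Y (n + 1) ω).length),
      (walk Y (n + 1) ω)[i] = (Y i ω : E × Bool) := by
    intro i h
    simp [walk]
  rw [hL] at hp hr
  obtain ⟨M, h1, h2, h3⟩ := hβ.closing hp hr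
  rw [← hL] at h1
  refine ⟨_, by simp [hL], FreeGroup.mk (δ (Γ.o (Y 0 ω))), h1, ⟨?_, ?_⟩, by simp [length_walk], ?_⟩
  · apply periodicLabel_ne_invLetter
    simpa [hL] using h3
  · rw [List.cons_append] at h2
    rw [hL, List.cons_append, loopElt_of_isPath hδ h2, markingHom_pathElt hδ h2]
  · intro i h
    rw [List.getElem_append_left (by omega)]
    exact hget i _

end SimplicialChart

/-! ### The characteristic current -/

theorem sum_extWordProb_singleton {E : Type*} [Fintype E] [DecidableEq E]
    {S : Finset (E × Bool)} {X : FSMC S} {μ₀ : S → ℝ} (h : IsDistribution μ₀) :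
    ∑ e : E × Bool, extWordProb X μ₀ [e] = 1 := by
  rw [← h.2, ← Finset.sum_subset (Finset.subset_univ S), ← Finset.sum_coe_sort]
  · refine Finset.sum_congr rfl fun e _ => ?_
    simp [extWordProb, FSMC.wordProb, FSMC.chainProb]
  · intro e _ he
    simp [extWordProb, he]

theorem extWordProb_nonneg {E : Type*} [DecidableEq E] {S : Finset (E × Bool)} {X : FSMC S}
    {μ₀ : S → ℝ} (h : IsDistribution μ₀) (v : List (E × Bool)) : 0 ≤ extWordProb X μ₀ v := by
  unfold extWordProb
  split_ifs
  · exact FSMC.wordProb_nonneg h.1 _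
  · exact le_rfl

/-- The trajectory `ω` follows transitions of positive probability, and every word occurs in it with
the frequency given by the distribution `μ₀`. -/
structure IsTypical {S Ω : Type*} [Fintype S] [DecidableEq S] (X : FSMC S) (μ₀ : S → ℝ)
    (Y : ℕ → Ω → S) (ω : Ω) : Prop where
  pos : ∀ i, 0 < X.p (Y i ω) (Y (i + 1) ω)
  tendsto : ∀ u : List S, u ≠ [] →
    Tendsto (fun n : ℕ => wordCount Y u n ω / n) atTop (𝓝 (X.wordProb μ₀ u))

theorem exists_nonzeroCurrent_smul {N : ℕ} (η : NonzeroCurrent N) {c : ℝ≥0} (hc : 0 < c) :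
    ∃ κ : NonzeroCurrent N, κ.1.toMeasure = c • η.1.toMeasure := by
  refine ⟨⟨⟨c • η.1.toMeasure, fun K hK => ?_, fun g B hB => ?_, fun B hB => ?_⟩, ?_⟩, rfl⟩
  · rw [Measure.smul_apply]
    exact ENNReal.mul_lt_top ENNReal.coe_lt_top (η.1.finite_on_compacts K hK)
  · rw [Measure.smul_apply, Measure.smul_apply, η.1.invariant g B hB]
  · rw [Measure.smul_apply, Measure.smul_apply, η.1.flip_invariant B hB]
  · exact smul_ne_zero hc.ne' η.2

namespace SimplicialChart

variable {N : ℕ} {V E : Type*} [Fintype V] [Fintype E] [DecidableEq E] {Γ : SimplicialChart N V E}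

/-- The counting measure of `g` is a nonzero current: the first edge of the axis is read at least
once. -/
theorem IsAxis.exists_nonzeroCurrent {g : FreeGroup (Fin N)} {d : FreeGroup E}
    {w : List (E × Bool)} {hw : w ≠ []} (h : Γ.IsAxis g d w hw) :
    ∃ η : NonzeroCurrent N, η.1.toMeasure = countingMeasure g := by
  obtain ⟨η, hη⟩ := Γ.exists_current (m := countingMeasure g)
    (fun v => ((cyclicCount w hw v + cyclicCount w hw (FreeGroup.invRev v) : ℕ) : ℝ≥0∞))
    (fun u u' v p hne hpath hv hp => h.countingMeasure_cyl hne hpath hv hp)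
    (fun v => ENNReal.natCast_ne_top _)
    (fun v => by rw [FreeGroup.invRev_invRev, add_comm])
  refine ⟨⟨η, fun h0 => ?_⟩, hη⟩
  have hpos : 0 < w.length := List.length_pos_iff.mpr hw
  let e := periodicLabel w hw 0
  obtain ⟨p, hp⟩ := Γ.exists_isLift (Γ.o e)
  have h1 := h.countingMeasure_cyl (List.cons_ne_nil e []) (OrientedGraph.isPath_singleton e)
    FreeGroup.IsReduced.singleton hp
  rw [← hη, h0, Measure.coe_zero, Pi.zero_apply, eq_comm, Nat.cast_eq_zero, Nat.add_eq_zero_iff,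
    cyclicCount, Finset.card_eq_zero] at h1
  have h2 : 0 ∈ (Finset.range w.length).filter
      fun i : ℕ => seg (periodicLabel w hw) i [e].length = [e] := by
    rw [Finset.mem_filter, Finset.mem_range]
    exact ⟨hpos, by simp [seg, e]⟩
  rw [h1.1] at h2
  exact absurd h2 (Finset.notMem_empty _)

/-- Convergence of currents can be tested on cylinders. -/
theorem tendsto_of_tendsto_cylinders {κ : ℕ → NonzeroCurrent N} {ν : NonzeroCurrent N}
    (h : ∀ C ∈ Γ.cylinders,
      Tendsto (fun n => (κ n).1.toMeasure.real C) atTop (𝓝 (ν.1.toMeasure.real C))) :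
    Tendsto κ atTop (𝓝 ν) := by
  rw [tendsto_subtype_rng, nhds_induced, tendsto_comap_iff, tendsto_pi_nhds]
  have hfin : ∀ (ν : GeodesicCurrent N), ∀ C ∈ Γ.cylinders, ν.toMeasure C ≠ ∞ :=
    fun ν C hC => (ν.finite_on_compacts C (isCompact_of_mem_cylinders hC)).ne
  exact Γ.isCompactOpenPiBasis_cylinders.tendsto_integral (fun n => hfin (κ n).1) (hfin ν.1) h

section Typical

variable {Ω : Type*} {S : Finset (E × Bool)} {X : FSMC S} {μ₀ : S → ℝ} {Y : ℕ → Ω → S} {ω : Ω}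
  {β : E × Bool → E × Bool → List (E × Bool)} {δ : V → List (E × Bool)}

/-- Along a typical trajectory, the normalized counting currents converge on cylinders. -/
theorem tendsto_countingMeasure_cyl (hω : IsTypical X μ₀ Y ω) (hbased : Γ.IsBased X)
    (hβ : Γ.IsClosingSystem β) (hδ : ∀ v, Γ.IsPath Γ.base (δ v) v) {u u' : V}
    {v : List (E × Bool)} {p : FreeGroup E} (hne : v ≠ []) (hpath : Γ.IsPath u v u')
    (hv : FreeGroup.IsReduced v) (hp : Γ.IsLift u p) :
    Tendsto (fun n : ℕ => ((n : ℝ≥0)⁻¹ •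
        countingMeasure (Γ.loopElt δ (closing β (walk Y n ω)))).real (Γ.cyl p (p * FreeGroup.mk v)))
      atTop (𝓝 (extWordProb X μ₀ v + extWordProb X μ₀ (FreeGroup.invRev v))) := by
  obtain ⟨B, hB⟩ := exists_length_closing_le β
  have hne' : FreeGroup.invRev v ≠ [] := by simpa [FreeGroup.invRev] using hne
  have h1 := (tendsto_wordCount_coe hω.tendsto hne).add (tendsto_wordCount_coe hω.tendsto hne')
  set Z : ℕ → Ω → E × Bool := fun i ω => (Y i ω : E × Bool) with hZ
  suffices h : Tendsto (fun n : ℕ => ((n : ℝ≥0)⁻¹ • countingMeasure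
      (Γ.loopElt δ (closing β (walk Y n ω)))).real (Γ.cyl p (p * FreeGroup.mk v)) -
        (wordCount Z v n ω / n + wordCount Z (FreeGroup.invRev v) n ω / n)) atTop (𝓝 0) by
    simpa using h.add h1
  refine squeeze_zero_norm' (a := fun n : ℕ => 2 * (v.length + B : ℝ) / n) ?_
    (tendsto_const_div_atTop_nhds_zero_nat _)
  filter_upwards [eventually_ne_atTop 0] with n hn
  obtain ⟨w, hw, d, hcl, hax, hle, hget⟩ :=
    exists_isAxis_loopElt_closing hbased hω.pos hβ hδ hn
  have hlen := hB (walk Y n ω)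
  rw [length_walk, hcl] at hlen
  have hlen' : (w.length : ℝ) ≤ n + B := by exact_mod_cast hlen
  have h2 := abs_cyclicCount_sub_wordCount_le hw hle (Y := Z) hget v
  have h3 := abs_cyclicCount_sub_wordCount_le hw hle (Y := Z) hget (FreeGroup.invRev v)
  rw [FreeGroup.invRev_length] at h3
  have hn' : (0 : ℝ) < n := by exact_mod_cast Nat.pos_of_ne_zero hn
  have h4 : ((n : ℝ≥0)⁻¹ • countingMeasure
      (Γ.loopElt δ (closing β (walk Y n ω)))).real (Γ.cyl p (p * FreeGroup.mk v)) =
      (cyclicCount w hw v + cyclicCount w hw (FreeGroup.invRev v)) / n := by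
    rw [hcl, measureReal_nnreal_smul_apply, measureReal_def,
      hax.countingMeasure_cyl hne hpath hv hp, ENNReal.toReal_natCast]
    push_cast
    rw [inv_mul_eq_div]
  rw [h4, Real.norm_eq_abs, ← add_div, ← sub_div, abs_div, abs_of_pos hn']
  gcongr
  rw [abs_le] at h2 h3 ⊢
  constructor <;> linarith [h2.1, h2.2, h3.1, h3.2]

variable (Γ) in
/-- A characteristic current exists, as a limit of normalized counting currents along a typical
trajectory. -/
theorem exists_isCharacteristicCurrent (hω : IsTypical X μ₀ Y ω) (hμ₀ : X.IsStationary μ₀)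
    (hbased : Γ.IsBased X) (hβ : Γ.IsClosingSystem β) (hδ : ∀ v, Γ.IsPath Γ.base (δ v) v) :
    ∃ ν, Γ.IsCharacteristicCurrent X ν := by
  let m : ℕ → Measure (DoubleBoundary (Fin N)) := fun n =>
    (n : ℝ≥0)⁻¹ • countingMeasure (Γ.loopElt δ (closing β (walk Y n ω)))
  have hfin : ∀ n, ∀ C ∈ Γ.cylinders, m n C ≠ ∞ := by
    rintro n _ ⟨u, u', v, p, hne, hpath, hv, hp, rfl⟩
    rcases eq_or_ne n 0 with rfl | hn
    · -- Here `0⁻¹ = 0`, so that `m 0 = 0`.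
      simp [m]
    · obtain ⟨w, hw, d, hcl, hax, -⟩ := exists_isAxis_loopElt_closing hbased hω.pos hβ hδ hn
      simp only [m, Measure.smul_apply, hcl, hax.countingMeasure_cyl hne hpath hv hp]
      exact ENNReal.mul_ne_top ENNReal.coe_ne_top (ENNReal.natCast_ne_top _)
  have hlim : ∀ C, ∃ a, C ∈ Γ.cylinders → Tendsto (fun n => (m n).real C) atTop (𝓝 a) := by
    intro C
    by_cases hC : C ∈ Γ.cylinders
    · obtain ⟨u, u', v, p, hne, hpath, hv, hp, rfl⟩ := hC
      exact ⟨_, fun _ => tendsto_countingMeasure_cyl hω hbased hβ hδ hne hpath hv hp⟩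
    · exact ⟨0, fun h => absurd h hC⟩
  choose L hL using hlim
  obtain ⟨ν, hν⟩ := Γ.isCompactOpenPiBasis_cylinders.exists_measure hfin hL
  have hcyl : ∀ (u u' : V) (v : List (E × Bool)) (p : FreeGroup E), v ≠ [] → Γ.IsPath u v u' →
      FreeGroup.IsReduced v → Γ.IsLift u p → ν (Γ.cyl p (p * FreeGroup.mk v)) =
        ENNReal.ofReal (extWordProb X μ₀ v + extWordProb X μ₀ (FreeGroup.invRev v)) := by
    intro u u' v p hne hpath hv hp
    have hC : Γ.cyl p (p * FreeGroup.mk v) ∈ Γ.cylinders := ⟨u, u', v, p, hne, hpath, hv, hp, rfl⟩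
    rw [hν _ hC, tendsto_nhds_unique (hL _ hC)
      (tendsto_countingMeasure_cyl hω hbased hβ hδ hne hpath hv hp)]
  obtain ⟨ν, rfl⟩ := Γ.exists_current (m := ν) _ hcyl (fun v => ENNReal.ofReal_ne_top)
    (fun v => by rw [FreeGroup.invRev_invRev, add_comm])
  refine ⟨ν, μ₀, hμ₀, hcyl, fun p hp => ?_⟩
  -- Both `μ₀(e)` and `μ₀(e⁻¹)` sum up to `1` over the oriented edges.
  have h1 := sum_extWordProb_singleton (X := X) hμ₀.1
  have h2 : ∑ e : E × Bool, extWordProb X μ₀ (FreeGroup.invRev [e]) = 1 := by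
    rw [← h1]
    refine Fintype.sum_bijective invLetter
      (Function.Involutive.bijective fun e => invLetter_invLetter e) _ _ fun e => ?_
    rw [invRev_singleton]
  have h3 : ∀ e : E × Bool, ν.toMeasure (Γ.cyl (p e) (p e * FreeGroup.mk [e])) =
      ENNReal.ofReal (extWordProb X μ₀ [e] + extWordProb X μ₀ (FreeGroup.invRev [e])) :=
    fun e => hcyl _ _ _ _ (List.cons_ne_nil e []) (OrientedGraph.isPath_singleton e)
      FreeGroup.IsReduced.singleton (hp e)
  simp only [h3]
  rw [← ENNReal.ofReal_sum_of_nonneg fun e _ => add_nonneg (extWordProb_nonneg hμ₀.1 _)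
      (extWordProb_nonneg hμ₀.1 _), Finset.sum_add_distrib, h1, h2, one_add_one_eq_two,
    ENNReal.ofReal_ofNat, ENNReal.div_self two_ne_zero ENNReal.ofNat_ne_top]

theorem IsCharacteristicCurrent.toMeasure_ne_zero {ν : GeodesicCurrent N}
    (h : Γ.IsCharacteristicCurrent X ν) : ν.toMeasure ≠ 0 := by
  obtain ⟨-, -, -, h3⟩ := h
  choose p hp using fun e : E × Bool => Γ.exists_isLift (Γ.o e)
  intro h0
  have := h3 p hp
  simp [h0] at this

theorem IsCharacteristicCurrent.unique (hirr : X.IsIrreducible) {ν ν' : GeodesicCurrent N}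
    (h : Γ.IsCharacteristicCurrent X ν) (h' : Γ.IsCharacteristicCurrent X ν') : ν = ν' := by
  obtain ⟨μ₀, hμ₀, h, -⟩ := h
  obtain ⟨μ₀', hμ₀', h', -⟩ := h'
  obtain rfl := hμ₀.unique hirr hμ₀'
  refine GeodesicCurrent.ext (measure_ext (Γ := Γ) ?_ ?_)
  · intro C hC
    exact (ν.finite_on_compacts C (isCompact_of_mem_cylinders hC)).ne
  · rintro _ ⟨u, u', v, p, hne, hpath, hv, hp, rfl⟩
    rw [h u u' v p hne hpath hv hp, h' u u' v p hne hpath hv hp]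

/-- Along a typical trajectory, the projective counting currents converge to the class of the
characteristic current. -/
theorem IsCharacteristicCurrent.exists_tendsto (hirr : X.IsIrreducible) {ν : GeodesicCurrent N}
    (hν : Γ.IsCharacteristicCurrent X ν) (hω : IsTypical X μ₀ Y ω) (hμ₀ : X.IsStationary μ₀)
    (hbased : Γ.IsBased X) (hβ : Γ.IsClosingSystem β) (hδ : ∀ v, Γ.IsPath Γ.base (δ v) v) :
    ∃ η : ℕ → NonzeroCurrent N,
      (∀ᶠ n in atTop, Γ.loopElt δ (closing β (walk Y n ω)) ≠ 1 ∧
        (η n).1.toMeasure = countingMeasure (Γ.loopElt δ (closing β (walk Y n ω)))) ∧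
      Tendsto (fun n => (⟦η n⟧ : ProjectiveCurrent N)) atTop (𝓝 ⟦⟨ν, hν.toMeasure_ne_zero⟩⟧) := by
  set ν₀ : NonzeroCurrent N := ⟨ν, hν.toMeasure_ne_zero⟩ with hν₀
  obtain ⟨μ₀', hμ₀', hcyl, -⟩ := hν
  obtain rfl := hμ₀.unique hirr hμ₀'
  have h1 : ∀ n : ℕ, ∃ η κ : NonzeroCurrent N, n ≠ 0 →
      Γ.loopElt δ (closing β (walk Y n ω)) ≠ 1 ∧
      η.1.toMeasure = countingMeasure (Γ.loopElt δ (closing β (walk Y n ω))) ∧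
      κ.1.toMeasure = (n : ℝ≥0)⁻¹ • η.1.toMeasure := by
    intro n
    by_cases hn : n = 0
    · exact ⟨ν₀, ν₀, fun h => absurd hn h⟩
    · obtain ⟨w, hw, d, hcl, hax, -⟩ := exists_isAxis_loopElt_closing hbased hω.pos hβ hδ hn
      obtain ⟨η, hη⟩ := hax.exists_nonzeroCurrent
      obtain ⟨κ, hκ⟩ := exists_nonzeroCurrent_smul η (c := (n : ℝ≥0)⁻¹)
        (inv_pos.mpr (by exact_mod_cast Nat.pos_of_ne_zero hn))
      rw [hcl]
      exact ⟨η, κ, fun _ => ⟨hax.ne_one, hη, hκ⟩⟩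
  choose η κ h using h1
  refine ⟨η, ?_, ?_⟩
  · filter_upwards [eventually_ne_atTop 0] with n hn
    exact ⟨(h n hn).1, (h n hn).2.1⟩
  -- The topology is tested on the representatives `κ n`, normalized by the number of steps.
  have hκ : Tendsto κ atTop (𝓝 ν₀) := by
    refine tendsto_of_tendsto_cylinders (Γ := Γ) ?_
    rintro _ ⟨u, u', v, p, hne, hpath, hv, hp, rfl⟩
    have h2 : ν₀.1.toMeasure.real (Γ.cyl p (p * FreeGroup.mk v)) =
        extWordProb X μ₀ v + extWordProb X μ₀ (FreeGroup.invRev v) := by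
      rw [measureReal_def, hcyl u u' v p hne hpath hv hp, ENNReal.toReal_ofReal
        (add_nonneg (extWordProb_nonneg hμ₀.1 _) (extWordProb_nonneg hμ₀.1 _))]
    rw [h2]
    refine (tendsto_countingMeasure_cyl hω hbased hβ hδ hne hpath hv hp).congr' ?_
    filter_upwards [eventually_ne_atTop 0] with n hn
    rw [(h n hn).2.2, (h n hn).2.1]
  refine ((continuous_quotient_mk'.tendsto ν₀).comp hκ).congr' ?_
  filter_upwards [eventually_ne_atTop 0] with n hn
  have hn' : (0 : ℝ≥0) < n := by exact_mod_cast Nat.pos_of_ne_zero hn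
  refine (Quotient.sound ?_).symm
  exact ⟨(n : ℝ≥0)⁻¹, inv_pos.mpr hn', (h n hn).2.2⟩

end Typical

end SimplicialChart

end FreeCurrents

end

theorem theoremt {N : ℕ} (hN : 2 ≤ N)
    {V E : Type*} [Fintype V] [Fintype E] [DecidableEq E]
    (Γ : FreeCurrents.SimplicialChart N V E)
    (S : Finset (E × Bool)) (X : FreeCurrents.FSMC S)
    (hbased : Γ.IsBased X) (hirr : X.IsIrreducible)
    (μ : S → ℝ) (hμ : FreeCurrents.IsDistribution μ)
    {Ω : Type*} [MeasurableSpace Ω] (P : Measure Ω) [IsProbabilityMeasure P]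
    (Y : ℕ → Ω → S) (hY : X.IsMarkovSequence μ P Y)
    (β : E × Bool → E × Bool → List (E × Bool)) (hβ : Γ.IsClosingSystem β)
    (δ : V → List (E × Bool)) (hδ : ∀ v, Γ.IsPath Γ.base (δ v) v) :
    (∃! ν : FreeCurrents.GeodesicCurrent N, Γ.IsCharacteristicCurrent X ν) ∧
    FreeCurrents.IsTame
      (fun n ω => Γ.loopElt δ (FreeCurrents.closing β (FreeCurrents.walk Y n ω))) ∧
    ∀ ν : FreeCurrents.GeodesicCurrent N, Γ.IsCharacteristicCurrent X ν →
      FreeCurrents.IsAdapted P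
        (fun n ω => Γ.loopElt δ (FreeCurrents.closing β (FreeCurrents.walk Y n ω))) ν := by
  obtain ⟨μ₀, hμ₀, hfreq⟩ := hY.exists_ae_tendsto_wordCount hμ hirr
  have htyp : ∀ᵐ ω ∂P, FreeCurrents.IsTypical X μ₀ Y ω := by
    filter_upwards [hY.ae_pos, hfreq] with ω h1 h2
    exact ⟨h1, h2⟩
  refine ⟨?_, FreeCurrents.SimplicialChart.isTame_loopElt_closing Y hδ, fun ν hν =>
    ⟨hν.toMeasure_ne_zero, ?_⟩⟩
  · -- A single typical trajectory already yields the characteristic current as a limit.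
    obtain ⟨ω, hω⟩ := htyp.exists
    obtain ⟨ν, hν⟩ := Γ.exists_isCharacteristicCurrent hω hμ₀ hbased hβ hδ
    exact ⟨ν, hν, fun ν' hν' => hν'.unique hirr hν⟩
  · filter_upwards [htyp] with ω hω
    exact hν.exists_tendsto hirr hω hμ₀ hbased hβ hδ
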